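/- Let $G$ be an abelian group, let $k$ be a commutative ring with an action of $G$ by ring automorphisms (written $g\lambda$ for $g\in G$, $\lambda\in k$), let $n\ge 0$ be an integer and let $\delta\in k$. A *$G$-Temperley–Lieb $n$-diagram* consists of two columns of $n$ nodes, in which every node is joined by an edge to exactly one other node (in either column), such that the edges can be drawn without crossings in the strip between the two columns; each edge is labelled by an element of $G$. The *$G$-Temperley–Lieb algebra* $G\mathcal{TL}_n(\delta)$ is the $k$-algebra of formal $k$-linear combinations of such diagrams, with the following bilinear multiplication. To form the product of diagrams $x$ and $y$, identify the right-hand nodes of $x$ with the left-hand nodes of $y$ and forget the middle column; the label of each resulting edge is the product of the labels of the edges it is made of; each closed loop is removed and replaced by the scalar factor $g\delta$, where $g\in G$ is the product of the labels of the edges in the loop. The *trivial module* $\mathbb{1}$ over $G\mathcal{TL}_n(\delta)$ (both left and right) is a copy of $k$ on which a diagram with no left-to-left and no right-to-right edges acts as $1$ and every other diagram acts as $0$. Over the group algebra $k[G^n]$ (with its usual $k$-bilinear multiplication), $\mathbb{1}$ is a copy of $k$ on which every group element acts as $1$. **Theorem.** If $\delta\in k$ is invertible, then there are isomorphisms of graded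 $k$-modules $$\mathrm{Tor}_\star^{G\mathcal{TL}_n(\delta)}(\mathbb{1},\mathbb{1})\;\cong\;\mathrm{Tor}_\star^{k[G^n]}(\mathbb{1},\mathbb{1})\;\cong\; H_\star(G^n;k),$$ where $H_\star(G^n;k)$ is group homology with trivial coefficients $k$. -/

import Mathlib

open CategoryTheory TensorProduct

universe u

/-! ### Gluing two families of edges -/

/-- The pushout of `f : I → B` and `g : I → E`: the disjoint union of `B` and `E`, with `f i`
glued to `g i` for every `i`. -/
def Glue {I B E : Type*} (f : I → B) (g : I → E) : Type _ :=
  Quot (fun a b : B ⊕ E => ∃ i, a = Sum.inl (f i) ∧ b = Sum.inr (g i))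

namespace Glue

/-- The class of an element of `B ⊕ E`. -/
def mk {I B E : Type*} (f : I → B) (g : I → E) (a : B ⊕ E) : Glue f g := Quot.mk _ a

theorem sound {I B E : Type*} (f : I → B) (g : I → E) (i : I) :
    mk f g (Sum.inl (f i)) = mk f g (Sum.inr (g i)) := Quot.sound ⟨i, rfl, rfl⟩

theorem mk_surjective {I B E : Type*} (f : I → B) (g : I → E) : Function.Surjective (mk f g) :=
  Quot.mk_surjective

/-- The universal property of the pushout. -/
def lift {I B E C : Type*} {f : I → B} {g : I → E} (p : B → C) (q : E → C)
    (h : ∀ i, p (f i) = q (g i)) : Glue f g → C :=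
  Quot.lift (Sum.elim p q) (by rintro _ _ ⟨i, rfl, rfl⟩; exact h i)

@[simp] theorem lift_inl {I B E C : Type*} {f : I → B} {g : I → E} (p : B → C) (q : E → C)
    (h : ∀ i, p (f i) = q (g i)) (b : B) : lift p q h (mk f g (Sum.inl b)) = p b := rfl

@[simp] theorem lift_inr {I B E C : Type*} {f : I → B} {g : I → E} (p : B → C) (q : E → C)
    (h : ∀ i, p (f i) = q (g i)) (e : E) : lift p q h (mk f g (Sum.inr e)) = q e := rfl

instance {I B E : Type*} [Finite B] [Finite E] (f : I → B) (g : I → E) : Finite (Glue f g) :=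
  Finite.of_surjective _ (mk_surjective f g)

noncomputable instance {I B E : Type*} [Finite B] [Finite E] (f : I → B) (g : I → E) :
    Fintype (Glue f g) := Fintype.ofFinite _

end Glue

open Classical in
/-- The product of the labels `l a` over the fibre of `q` at `b`. -/
noncomputable def fibreProd {A B G : Type*} [Fintype A] [CommMonoid G] (q : A → B) (l : A → G)
    (b : B) : G := ∏ a with q a = b, l a

theorem fibreProd_comp {A B C G : Type*} [Fintype A] [Fintype B] [CommMonoid G] (q : A → B)
    (p : B → C) (l : A → G) (c : C) :
    fibreProd p (fibreProd q l) c = fibreProd (p ∘ q) l c := by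
  classical
  unfold fibreProd
  rw [← Finset.prod_fiberwise_of_maps_to (s := Finset.univ.filter (fun a => (p ∘ q) a = c))
    (t := Finset.univ.filter (fun b => p b = c)) (g := q) (by intro a; simp)]
  refine Finset.prod_congr (by ext; simp) fun b hb => ?_
  refine Finset.prod_congr ?_ fun _ _ => rfl
  ext a
  simp only [Finset.mem_filter, Finset.mem_univ, true_and, Function.comp] at hb ⊢
  constructor
  · rintro rfl; exact ⟨hb, rfl⟩
  · exact fun h => h.2

theorem fibreProd_bij {A B A' B' G : Type*} [Fintype A] [Fintype A'] [CommMonoid G]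
    (q : A → B) (q' : A' → B') (l : A → G) (l' : A' → G) (b : B) (b' : B') (i : A → A')
    (hi : Function.Injective i) (hl : ∀ a, q a = b → l' (i a) = l a)
    (hq : ∀ a, q a = b → q' (i a) = b')
    (hs : ∀ a', q' a' = b' → ∃ a, q a = b ∧ i a = a') :
    fibreProd q' l' b' = fibreProd q l b := by
  classical
  unfold fibreProd
  symm
  refine Finset.prod_bij (fun a _ => i a) ?_ ?_ ?_ ?_
  · intro a ha; simpa using hq a (by simpa using ha)
  · intro a _ a' _ h; exact hi h
  · intro a' ha'
    obtain ⟨a, h1, h2⟩ := hs a' (by simpa using ha')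
    exact ⟨a, by simpa using h1, h2⟩
  · intro a ha; exact (hl a (by simpa using ha)).symm

theorem fibreProd_single {A B G : Type*} [Fintype A] [CommMonoid G]
    (q : A → B) (l : A → G) (a : A) (h : ∀ a', q a' = q a → a' = a) :
    fibreProd q l (q a) = l a := by
  classical
  unfold fibreProd
  rw [Finset.prod_eq_single a]
  · intro b hb hne; exact absurd (h b (by simpa using hb)) hne
  · intro h; simp at h

theorem fibreProd_equiv {A B C G : Type*} [Fintype A] [CommMonoid G] (e : B ≃ C)
    (q : A → B) (l : A → G) (b : B) : fibreProd (fun a => e (q a)) l (e b) = fibreProd q l b := by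
  classical
  unfold fibreProd
  simp only [EmbeddingLike.apply_eq_iff_eq]

theorem fibreProd_sum_type {A B C G : Type*} [Fintype A] [Fintype B] [CommMonoid G]
    (q : A ⊕ B → C) (α : A → G) (β : B → G) (c : C) :
    fibreProd q (Sum.elim α β) c =
      fibreProd (fun a => q (Sum.inl a)) α c * fibreProd (fun b => q (Sum.inr b)) β c := by
  classical
  unfold fibreProd
  simp only [Finset.prod_filter, Fintype.prod_sum_type, Sum.elim_inl, Sum.elim_inr]

namespace Glue

/-- The label of a class: the product of the labels of its members. -/
noncomputable def label {I B E G : Type*} [Fintype B] [Fintype E] [CommMonoid G] (f : I → B)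
    (g : I → E) (β : B → G) (γ : E → G) : Glue f g → G :=
  fibreProd (mk f g) (Sum.elim β γ)

/-- Restricting the left-hand family to a subset `S` containing everything that is glued only
splits off the classes outside `S`. -/
noncomputable def splitLeft {I S D E : Type*} (ι : S → D) (hι : Function.Injective ι) (h : I → S)
    (g : I → E) : Glue (ι ∘ h) g ≃ Glue h g ⊕ {d : D // d ∉ Set.range ι} := by
  classical
  refine
    { toFun := lift (fun d => if hd : d ∈ Set.range ι then Sum.inl (mk h g (Sum.inl hd.choose))
          else Sum.inr ⟨d, hd⟩) (fun e => Sum.inl (mk h g (Sum.inr e))) ?_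
      invFun := Sum.elim (lift (fun s => mk _ _ (Sum.inl (ι s))) (fun e => mk _ _ (Sum.inr e))
          (fun i => sound (ι ∘ h) g i)) (fun d => mk _ _ (Sum.inl d.1))
      left_inv := ?_
      right_inv := ?_ }
  · intro i
    have hd : ι (h i) ∈ Set.range ι := ⟨_, rfl⟩
    have : hd.choose = h i := hι hd.choose_spec
    simp only [Function.comp, hd, dite_true, this, sound]
  · intro t
    obtain ⟨d | e, rfl⟩ := mk_surjective _ _ t
    · by_cases hd : d ∈ Set.range ι
      · simp only [lift_inl, hd, dite_true, Sum.elim_inl, hd.choose_spec]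
      · simp only [lift_inl, hd, dite_false, Sum.elim_inr]
    · simp
  · rintro (t | d)
    · obtain ⟨s | e, rfl⟩ := mk_surjective _ _ t
      · have hd : ι s ∈ Set.range ι := ⟨_, rfl⟩
        have : hd.choose = s := hι hd.choose_spec
        simp only [Sum.elim_inl, lift_inl, hd, dite_true, this]
      · simp
    · have := d.2
      simp only [Sum.elim_inr, lift_inl, this, dite_false]

/-- The mirror image of `splitLeft`. -/
noncomputable def splitRight {I S D B : Type*} (ι : S → D) (hι : Function.Injective ι) (f : I → B)
    (h : I → S) : Glue f (ι ∘ h) ≃ Glue f h ⊕ {d : D // d ∉ Set.range ι} := by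
  classical
  refine
    { toFun := lift (fun e => Sum.inl (mk f h (Sum.inl e)))
        (fun d => if hd : d ∈ Set.range ι then Sum.inl (mk f h (Sum.inr hd.choose))
          else Sum.inr ⟨d, hd⟩) ?_
      invFun := Sum.elim (lift (fun e => mk _ _ (Sum.inl e)) (fun s => mk _ _ (Sum.inr (ι s)))
          (fun i => sound f (ι ∘ h) i)) (fun d => mk _ _ (Sum.inr d.1))
      left_inv := ?_
      right_inv := ?_ }
  · intro i
    have hd : ι (h i) ∈ Set.range ι := ⟨_, rfl⟩
    have : hd.choose = h i := hι hd.choose_spec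
    simp only [Function.comp, hd, dite_true, this, sound]
  · intro t
    obtain ⟨e | d, rfl⟩ := mk_surjective _ _ t
    · simp
    · by_cases hd : d ∈ Set.range ι
      · simp only [lift_inr, hd, dite_true, Sum.elim_inl, hd.choose_spec]
      · simp only [lift_inr, hd, dite_false, Sum.elim_inr]
  · rintro (t | d)
    · obtain ⟨e | s, rfl⟩ := mk_surjective _ _ t
      · simp
      · have hd : ι s ∈ Set.range ι := ⟨_, rfl⟩
        have : hd.choose = s := hι hd.choose_spec
        simp only [Sum.elim_inl, lift_inr, hd, dite_true, this]
    · have := d.2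
      simp only [Sum.elim_inr, lift_inr, this, dite_false]

theorem splitLeft_symm_inl_mk {I S D E : Type*} (ι : S → D) (hι : Function.Injective ι)
    (h : I → S) (g : I → E) (c : S ⊕ E) : (splitLeft ι hι h g).symm (Sum.inl (mk h g c)) =
      mk (ι ∘ h) g (Sum.map ι id c) := by
  rcases c with c | c <;> rfl

theorem splitLeft_symm_inr {I S D E : Type*} (ι : S → D) (hι : Function.Injective ι)
    (h : I → S) (g : I → E) (d : {d : D // d ∉ Set.range ι}) :
    (splitLeft ι hι h g).symm (Sum.inr d) = mk (ι ∘ h) g (Sum.inl d.1) := rfl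

theorem splitRight_symm_inl_mk {I S D B : Type*} (ι : S → D) (hι : Function.Injective ι)
    (f : I → B) (h : I → S) (c : B ⊕ S) : (splitRight ι hι f h).symm (Sum.inl (mk f h c)) =
      mk f (ι ∘ h) (Sum.map id ι c) := by
  rcases c with c | c <;> rfl

theorem splitRight_symm_inr {I S D B : Type*} (ι : S → D) (hι : Function.Injective ι)
    (f : I → B) (h : I → S) (d : {d : D // d ∉ Set.range ι}) :
    (splitRight ι hι f h).symm (Sum.inr d) = mk f (ι ∘ h) (Sum.inr d.1) := rfl

theorem label_splitLeft_inl {I S D E G : Type*} [Fintype S] [Fintype D] [Fintype E]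
    [CommMonoid G] (ι : S → D) (hι : Function.Injective ι) (h : I → S) (g : I → E)
    (β : D → G) (γ : E → G) (t : Glue h g) :
    label (ι ∘ h) g β γ ((splitLeft ι hι h g).symm (Sum.inl t)) = label h g (β ∘ ι) γ t := by
  refine fibreProd_bij _ _ _ _ _ _ (Sum.map ι id) (hι.sumMap Function.injective_id) ?_ ?_ ?_
  · rintro (a | a) - <;> rfl
  · rintro a rfl; exact (splitLeft_symm_inl_mk ι hι h g a).symm
  · rintro (d | e) ha
    · by_cases hd : d ∈ Set.range ι
      · obtain ⟨s, rfl⟩ := hd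
        refine ⟨Sum.inl s, ?_, rfl⟩
        have := splitLeft_symm_inl_mk ι hι h g (Sum.inl s)
        simp only [Sum.map_inl, ha] at this
        simpa using this
      · have := splitLeft_symm_inr ι hι h g ⟨d, hd⟩
        simp only [ha] at this
        simp at this
    · refine ⟨Sum.inr e, ?_, rfl⟩
      have := splitLeft_symm_inl_mk ι hι h g (Sum.inr e)
      simp only [Sum.map_inr, id, ha] at this
      simpa using this

theorem label_splitLeft_inr {I S D E G : Type*} [Fintype D] [Fintype E]
    [CommMonoid G] (ι : S → D) (hι : Function.Injective ι) (h : I → S) (g : I → E)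
    (β : D → G) (γ : E → G) (d : {d : D // d ∉ Set.range ι}) :
    label (ι ∘ h) g β γ ((splitLeft ι hι h g).symm (Sum.inr d)) = β d := by
  rw [splitLeft_symm_inr]
  refine fibreProd_single (mk (ι ∘ h) g) (Sum.elim β γ) (Sum.inl d.1) ?_
  intro a ha
  rw [← splitLeft_symm_inr ι hι, Equiv.eq_symm_apply] at ha
  rcases a with d' | e
  · by_cases hd : d' ∈ Set.range ι
    · obtain ⟨s, rfl⟩ := hd
      have := splitLeft_symm_inl_mk ι hι h g (Sum.inl s)
      rw [Equiv.symm_apply_eq] at this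
      simp only [Sum.map_inl, ha] at this
      simp at this
    · have := splitLeft_symm_inr ι hι h g ⟨d', hd⟩
      rw [Equiv.symm_apply_eq] at this
      simp only [ha, Sum.inr.injEq] at this
      rw [← this]
  · have := splitLeft_symm_inl_mk ι hι h g (Sum.inr e)
    rw [Equiv.symm_apply_eq] at this
    simp only [Sum.map_inr, id, ha] at this
    simp at this

theorem label_splitRight_inl {I S D B G : Type*} [Fintype S] [Fintype D] [Fintype B]
    [CommMonoid G] (ι : S → D) (hι : Function.Injective ι) (f : I → B) (h : I → S)
    (β : B → G) (γ : D → G) (t : Glue f h) :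
    label f (ι ∘ h) β γ ((splitRight ι hι f h).symm (Sum.inl t)) = label f h β (γ ∘ ι) t := by
  refine fibreProd_bij _ _ _ _ _ _ (Sum.map id ι) (Function.injective_id.sumMap hι) ?_ ?_ ?_
  · rintro (a | a) - <;> rfl
  · rintro a rfl; exact (splitRight_symm_inl_mk ι hι f h a).symm
  · rintro (e | d) ha
    · refine ⟨Sum.inl e, ?_, rfl⟩
      have := splitRight_symm_inl_mk ι hι f h (Sum.inl e)
      simp only [Sum.map_inl, id, ha] at this
      simpa using this
    · by_cases hd : d ∈ Set.range ι
      · obtain ⟨s, rfl⟩ := hd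
        refine ⟨Sum.inr s, ?_, rfl⟩
        have := splitRight_symm_inl_mk ι hι f h (Sum.inr s)
        simp only [Sum.map_inr, ha] at this
        simpa using this
      · have := splitRight_symm_inr ι hι f h ⟨d, hd⟩
        simp only [ha] at this
        simp at this

theorem label_splitRight_inr {I S D B G : Type*} [Fintype D] [Fintype B]
    [CommMonoid G] (ι : S → D) (hι : Function.Injective ι) (f : I → B) (h : I → S)
    (β : B → G) (γ : D → G) (d : {d : D // d ∉ Set.range ι}) :
    label f (ι ∘ h) β γ ((splitRight ι hι f h).symm (Sum.inr d)) = γ d := by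
  rw [splitRight_symm_inr]
  refine fibreProd_single (mk f (ι ∘ h)) (Sum.elim β γ) (Sum.inr d.1) ?_
  intro a ha
  rw [← splitRight_symm_inr ι hι, Equiv.eq_symm_apply] at ha
  rcases a with e | d'
  · have := splitRight_symm_inl_mk ι hι f h (Sum.inl e)
    rw [Equiv.symm_apply_eq] at this
    simp only [Sum.map_inl, id, ha] at this
    simp at this
  · by_cases hd : d' ∈ Set.range ι
    · obtain ⟨s, rfl⟩ := hd
      have := splitRight_symm_inl_mk ι hι f h (Sum.inr s)
      rw [Equiv.symm_apply_eq] at this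
      simp only [Sum.map_inr, ha] at this
      simp at this
    · have := splitRight_symm_inr ι hι f h ⟨d', hd⟩
      rw [Equiv.symm_apply_eq] at this
      simp only [ha, Sum.inr.injEq] at this
      rw [← this]

/-- Gluing three families is associative. -/
def assoc {I J A B C : Type*} (f₁ : I → A) (g₁ : I → B) (f₂ : J → B) (g₂ : J → C) :
    Glue (fun j => mk f₁ g₁ (Sum.inr (f₂ j))) g₂ ≃
      Glue f₁ (fun i => mk f₂ g₂ (Sum.inl (g₁ i))) where
  toFun := lift (lift (fun a => mk _ _ (Sum.inl a)) (fun b => mk _ _ (Sum.inr (mk _ _ (Sum.inl b))))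
      (fun i => sound f₁ (fun i => mk f₂ g₂ (Sum.inl (g₁ i))) i))
    (fun c => mk _ _ (Sum.inr (mk _ _ (Sum.inr c))))
    (fun j => congrArg (fun t => mk _ _ (Sum.inr t)) (sound f₂ g₂ j))
  invFun := lift (fun a => mk _ _ (Sum.inl (mk _ _ (Sum.inl a))))
    (lift (fun b => mk _ _ (Sum.inl (mk _ _ (Sum.inr b)))) (fun c => mk _ _ (Sum.inr c))
      (fun j => sound (fun j => mk f₁ g₁ (Sum.inr (f₂ j))) g₂ j))
    (fun i => congrArg (fun t => mk _ _ (Sum.inl t)) (sound f₁ g₁ i))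
  left_inv t := by
    obtain ⟨t | c, rfl⟩ := mk_surjective _ _ t
    · obtain ⟨a | b, rfl⟩ := mk_surjective _ _ t <;> rfl
    · rfl
  right_inv t := by
    obtain ⟨a | t, rfl⟩ := mk_surjective _ _ t
    · rfl
    · obtain ⟨b | c, rfl⟩ := mk_surjective _ _ t <;> rfl

theorem label_eq_mul {I B E G : Type*} [Fintype B] [Fintype E] [CommMonoid G] (f : I → B)
    (g : I → E) (β : B → G) (γ : E → G) (t : Glue f g) :
    label f g β γ t = fibreProd (fun b => mk f g (Sum.inl b)) β t *
      fibreProd (fun e => mk f g (Sum.inr e)) γ t :=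
  fibreProd_sum_type _ _ _ _

theorem label_assoc {I J A B C G : Type*} [Fintype A] [Fintype B] [Fintype C] [CommMonoid G]
    (f₁ : I → A) (g₁ : I → B) (f₂ : J → B) (g₂ : J → C) (α : A → G) (β : B → G) (γ : C → G)
    (t : Glue (fun j => mk f₁ g₁ (Sum.inr (f₂ j))) g₂) :
    label f₁ (fun i => mk f₂ g₂ (Sum.inl (g₁ i))) α (label f₂ g₂ β γ) (assoc f₁ g₁ f₂ g₂ t) =
      label (fun j => mk f₁ g₁ (Sum.inr (f₂ j))) g₂ (label f₁ g₁ α β) γ t := by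
  have h₁ : label f₁ g₁ α β = fibreProd (mk f₁ g₁) (Sum.elim α β) := rfl
  have h₂ : label f₂ g₂ β γ = fibreProd (mk f₂ g₂) (Sum.elim β γ) := rfl
  rw [label_eq_mul, label_eq_mul, h₁, h₂, fibreProd_comp, fibreProd_comp, fibreProd_sum_type,
    fibreProd_sum_type, ← mul_assoc]
  rw [← fibreProd_equiv (assoc f₁ g₁ f₂ g₂), ← fibreProd_equiv (assoc f₁ g₁ f₂ g₂),
    ← fibreProd_equiv (assoc f₁ g₁ f₂ g₂)]
  rfl

end Glue

/-! ### Labelled diagrams and their composition -/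

/-- A `G`-Brauer `n`-diagram. The nodes are `Sum.inl i` (the `i`-th node of the left column) and
`Sum.inr j` (the `j`-th node of the right column). Every node is joined to exactly one other node
by an edge; `rel v w` says that `v = w` or that `v` and `w` are joined. The label of an edge, an
element of `G`, is recorded at both of its end nodes. -/
structure GBrauerDiagram (G : Type u) (n : ℕ) where
  rel : Setoid (Fin n ⊕ Fin n)
  pair : ∀ v, ∃! w, w ≠ v ∧ rel v w
  label : Fin n ⊕ Fin n → G
  label_eq : ∀ v w, rel v w → label v = label w

namespace GBrauerDiagram

variable {G : Type u} {n : ℕ}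

@[ext] theorem ext {x y : GBrauerDiagram G n} (h : ∀ v w, x.rel v w ↔ y.rel v w)
    (h' : ∀ v, x.label v = y.label v) : x = y := by
  obtain ⟨r, _, l, _⟩ := x
  obtain ⟨r', _, l', _⟩ := y
  obtain rfl : r = r' := Setoid.ext h
  obtain rfl : l = l' := funext h'
  rfl

/-- The type of edges of a diagram. -/
def Edge (x : GBrauerDiagram G n) : Type := Quotient x.rel

instance (x : GBrauerDiagram G n) : Finite x.Edge := inferInstanceAs (Finite (Quotient x.rel))

noncomputable instance (x : GBrauerDiagram G n) : Fintype x.Edge := Fintype.ofFinite _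

/-- The edge at a node. -/
def edge (x : GBrauerDiagram G n) (v : Fin n ⊕ Fin n) : x.Edge := Quotient.mk x.rel v

theorem edge_eq_iff (x : GBrauerDiagram G n) {v w : Fin n ⊕ Fin n} :
    x.edge v = x.edge w ↔ x.rel v w := Quotient.eq

theorem edge_surjective (x : GBrauerDiagram G n) : Function.Surjective x.edge :=
  Quotient.mk_surjective

/-- The label of an edge. -/
def edgeLabel (x : GBrauerDiagram G n) : x.Edge → G := Quotient.lift x.label x.label_eq

@[simp] theorem edgeLabel_edge (x : GBrauerDiagram G n) (v : Fin n ⊕ Fin n) :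
    x.edgeLabel (x.edge v) = x.label v := rfl

/-- The connected components of the concatenation of `x` and `y`: the edge of `x` at the `m`-th
right-hand node of `x` is glued to the edge of `y` at the `m`-th left-hand node of `y`. -/
abbrev Strand (x y : GBrauerDiagram G n) : Type :=
  Glue (fun m : Fin n => x.edge (Sum.inr m)) (fun m : Fin n => y.edge (Sum.inl m))

/-- The strand through a node of the left column of `x` or of the right column of `y`. -/
def outer (x y : GBrauerDiagram G n) : Fin n ⊕ Fin n → Strand x y :=
  Sum.elim (fun i => Glue.mk _ _ (Sum.inl (x.edge (Sum.inl i))))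
    (fun j => Glue.mk _ _ (Sum.inr (y.edge (Sum.inr j))))

/-- The label of a strand: the product of the labels of all the edges it consists of. -/
noncomputable def strandLabel [CommMonoid G] (x y : GBrauerDiagram G n) : Strand x y → G :=
  Glue.label _ _ x.edgeLabel y.edgeLabel

section Pairing

/-- The node joined to `v`. -/
noncomputable def mate (x : GBrauerDiagram G n) (v : Fin n ⊕ Fin n) : Fin n ⊕ Fin n :=
  (x.pair v).choose

theorem mate_ne (x : GBrauerDiagram G n) (v : Fin n ⊕ Fin n) : x.mate v ≠ v :=
  (x.pair v).choose_spec.1.1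

theorem rel_mate (x : GBrauerDiagram G n) (v : Fin n ⊕ Fin n) : x.rel v (x.mate v) :=
  (x.pair v).choose_spec.1.2

theorem eq_mate (x : GBrauerDiagram G n) {v w : Fin n ⊕ Fin n} (h : w ≠ v) (h' : x.rel v w) :
    w = x.mate v := (x.pair v).choose_spec.2 w ⟨h, h'⟩

theorem mate_mate (x : GBrauerDiagram G n) (v : Fin n ⊕ Fin n) : x.mate (x.mate v) = v :=
  (x.eq_mate (x.mate_ne v).symm (x.rel.symm (x.rel_mate v))).symm

/-- The nodes of `x` and those of `y`, before the middle columns are identified. -/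
abbrev Node (n : ℕ) : Type := (Fin n ⊕ Fin n) ⊕ (Fin n ⊕ Fin n)

/-- The strand through a node. -/
def strandOf (x y : GBrauerDiagram G n) : Node n → Strand x y :=
  Sum.elim (fun v => Glue.mk _ _ (Sum.inl (x.edge v))) (fun v => Glue.mk _ _ (Sum.inr (y.edge v)))

/-- Moving along an edge of `x` or of `y`. -/
noncomputable def along (x y : GBrauerDiagram G n) : Equiv.Perm (Node n) :=
  Function.Involutive.toPerm (Sum.map x.mate y.mate) (by
    rintro (v | v) <;> simp [mate_mate])

/-- Moving between the two copies of the middle column. -/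
def across (n : ℕ) : Equiv.Perm (Node n) :=
  Function.Involutive.toPerm
    (Sum.elim (Sum.elim (fun i => Sum.inl (Sum.inl i)) (fun m => Sum.inr (Sum.inl m)))
      (Sum.elim (fun m => Sum.inl (Sum.inr m)) (fun j => Sum.inr (Sum.inr j)))) (by
    rintro ((v | v) | (v | v)) <;> rfl)

/-- The outer nodes. -/
def outerNode (n : ℕ) : Fin n ⊕ Fin n → Node n := Sum.map Sum.inl Sum.inr

theorem strandOf_outerNode (x y : GBrauerDiagram G n) (v : Fin n ⊕ Fin n) :
    strandOf x y (outerNode n v) = outer x y v := by rcases v with v | v <;> rfl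

theorem strandOf_along (x y : GBrauerDiagram G n) (s : Node n) :
    strandOf x y (along x y s) = strandOf x y s := by
  rcases s with v | v
  · exact congrArg (fun e => Glue.mk _ _ (Sum.inl e)) (x.edge_eq_iff.2 (x.rel.symm (x.rel_mate v)))
  · exact congrArg (fun e => Glue.mk _ _ (Sum.inr e)) (y.edge_eq_iff.2 (y.rel.symm (y.rel_mate v)))

theorem strandOf_across (x y : GBrauerDiagram G n) (s : Node n) :
    strandOf x y (across n s) = strandOf x y s := by
  rcases s with (v | v) | (v | v)
  · rfl
  · exact (Glue.sound (fun m : Fin n => x.edge (Sum.inr m)) (fun m => y.edge (Sum.inl m)) v).symm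
  · exact Glue.sound (fun m : Fin n => x.edge (Sum.inr m)) (fun m => y.edge (Sum.inl m)) v
  · rfl

theorem strandOf_ind (x y : GBrauerDiagram G n) (P : Node n → Prop)
    (hα : ∀ s, P s → P (along x y s)) (hβ : ∀ s, P s → P (across n s)) {s t : Node n}
    (h : strandOf x y s = strandOf x y t) (hs : P s) : P t := by
  have inv : ∀ (z : GBrauerDiagram G n) (Q : Fin n ⊕ Fin n → Prop) (_ : ∀ v, Q v → Q (z.mate v))
      (v w : Fin n ⊕ Fin n), z.rel v w → Q v = Q w := by
    intro z Q hQ v w hvw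
    by_cases hne : w = v
    · rw [hne]
    · obtain rfl := z.eq_mate hne hvw
      refine propext ⟨hQ v, fun h => ?_⟩
      have := hQ _ h
      rwa [z.mate_mate] at this
  have hα₁ := inv x (fun v => P (Sum.inl v)) (fun v hv => hα _ hv)
  have hα₂ := inv y (fun v => P (Sum.inr v)) (fun v hv => hα _ hv)
  let F : Strand x y → Prop := Glue.lift (Quotient.lift _ hα₁) (Quotient.lift _ hα₂) (fun m =>
    propext ⟨hβ (Sum.inl (Sum.inr m)), hβ (Sum.inr (Sum.inl m))⟩)
  have hF : ∀ s, F (strandOf x y s) = P s := by rintro (v | v) <;> rfl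
  rw [← hF, ← h, hF]
  exact hs

theorem across_eq_iff (s : Node n) : across n s = s ↔ ∃ v, outerNode n v = s := by
  rcases s with (v | v) | (v | v)
  · exact ⟨fun _ => ⟨Sum.inl v, rfl⟩, fun _ => rfl⟩
  · refine ⟨fun h => (by cases h), ?_⟩
    rintro ⟨w | w, h⟩ <;> cases h
  · refine ⟨fun h => (by cases h), ?_⟩
    rintro ⟨w | w, h⟩ <;> cases h
  · exact ⟨fun _ => ⟨Sum.inr v, rfl⟩, fun _ => rfl⟩

theorem outerNode_injective : Function.Injective (outerNode n) :=
  Sum.inl_injective.sumMap Sum.inr_injective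

/-- Every strand that is not a loop has exactly two ends. -/
theorem outer_pair (x y : GBrauerDiagram G n) (v : Fin n ⊕ Fin n) :
    ∃! w, w ≠ v ∧ outer x y v = outer x y w := by
  set α := along x y with hα
  set β := across n with hβ
  have hα2 : α * α = 1 := by
    ext1 s; exact Function.Involutive.toPerm_involutive _ s
  have hβ2 : β * β = 1 := by
    ext1 s; exact Function.Involutive.toPerm_involutive _ s
  have hαne : ∀ s, α s ≠ s := by
    rintro (s | s) h
    · exact x.mate_ne s (Sum.inl_injective h)
    · exact y.mate_ne s (Sum.inr_injective h)
  set τ := β * α with hτ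
  have hinvα : α⁻¹ = α := inv_eq_of_mul_eq_one_left hα2
  have hinvβ : β⁻¹ = β := inv_eq_of_mul_eq_one_left hβ2
  have hconj : β * τ * β⁻¹ = τ⁻¹ := by
    rw [hτ, mul_inv_rev, hinvα, hinvβ, ← mul_assoc, hβ2, one_mul]
  have hconjk : ∀ k : ℤ, β * τ ^ k = τ ^ (-k) * β := by
    intro k
    have := conj_zpow (i := k) (a := β) (b := τ)
    rw [hconj, inv_zpow'] at this
    rw [this]; group
  set s₀ := outerNode n v with hs₀
  have hs : β s₀ = s₀ := (across_eq_iff _).2 ⟨v, rfl⟩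
  have hβk : ∀ k : ℤ, β ((τ ^ k) s₀) = (τ ^ (-k)) s₀ := by
    intro k
    have := congrArg (fun p : Equiv.Perm (Node n) => p s₀) (hconjk k)
    simpa [hs] using this
  have hαk : ∀ k : ℤ, α ((τ ^ k) s₀) = (τ ^ (-(k + 1))) s₀ := by
    intro k
    rw [← hβk, add_comm, zpow_add, zpow_one]
    have : α = β * τ := by rw [hτ, ← mul_assoc, hβ2, one_mul]
    conv_lhs => rw [this]
    rfl
  have hfix : ∀ k : ℤ, (τ ^ k) s₀ = s₀ ↔ (Function.minimalPeriod (τ • ·) s₀ : ℤ) ∣ k := by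
    intro k
    exact MulAction.zpow_smul_eq_iff_minimalPeriod_dvd (a := τ) (b := s₀) (n := k)
  have heq : ∀ k l : ℤ, (τ ^ k) s₀ = (τ ^ l) s₀ ↔
      (Function.minimalPeriod (τ • ·) s₀ : ℤ) ∣ k - l := by
    intro k l
    rw [← hfix, sub_eq_neg_add, zpow_add, zpow_neg, Equiv.Perm.mul_apply,
      Equiv.Perm.inv_eq_iff_eq]
  set p : ℕ := Function.minimalPeriod (τ • ·) s₀ with hp
  have hp0 : 0 < p := by
    have h1 : (τ ^ (orderOf τ : ℤ)) s₀ = s₀ := by rw [zpow_natCast, pow_orderOf_eq_one]; rfl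
    have h2 := (hfix _).1 h1
    rcases Nat.eq_zero_or_pos p with h | h
    · rw [h] at h2
      have := orderOf_pos τ
      simp only [Nat.cast_zero, zero_dvd_iff, Nat.cast_eq_zero] at h2
      omega
    · exact h
  obtain ⟨q, hq⟩ : ∃ q : ℕ, p = 2 * q := by
    rcases Nat.even_or_odd' p with ⟨q, h | h⟩
    · exact ⟨q, h⟩
    · exfalso
      refine hαne ((τ ^ (q : ℤ)) s₀) ?_
      rw [hαk, heq, h]
      exact ⟨-1, by push_cast; ring⟩
  have hq0 : 0 < q := by omega
  have hw : β ((τ ^ (q : ℤ)) s₀) = (τ ^ (q : ℤ)) s₀ := by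
    rw [hβk, heq, hq]; exact ⟨-1, by push_cast; ring⟩
  have hstrand : ∀ k : ℤ, strandOf x y ((τ ^ k) s₀) = strandOf x y s₀ := by
    have hone : ∀ s, strandOf x y (τ s) = strandOf x y s := by
      intro s
      rw [hτ, Equiv.Perm.mul_apply, hβ, strandOf_across, hα, strandOf_along]
    intro k
    induction k with
    | zero => simp
    | succ k ih => rw [add_comm, zpow_add, zpow_one, Equiv.Perm.mul_apply, hone, ih]
    | pred k ih =>
      rw [← ih, ← hone ((τ ^ (-(k : ℤ) - 1)) s₀), ← Equiv.Perm.mul_apply, ← zpow_one_add]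
      congr 3
      ring
  obtain ⟨w, hw'⟩ := (across_eq_iff _).1 hw
  refine ⟨w, ⟨?_, ?_⟩, ?_⟩
  · rintro rfl
    rw [← hs₀] at hw'
    have := (hfix q).1 hw'.symm
    rw [hq] at this
    have := Int.le_of_dvd (by exact_mod_cast hq0) this
    push_cast at this
    omega
  · rw [← strandOf_outerNode, ← strandOf_outerNode, hw', hstrand]
  · rintro w' ⟨hne, h⟩
    rw [← strandOf_outerNode, ← strandOf_outerNode] at h
    obtain ⟨k, hk⟩ := strandOf_ind x y (fun s => ∃ k : ℤ, s = (τ ^ k) s₀)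
      (by rintro _ ⟨k, rfl⟩; exact ⟨_, hαk k⟩) (by rintro _ ⟨k, rfl⟩; exact ⟨_, hβk k⟩) h
      ⟨0, by simp [hs₀]⟩
    have h1 : β (outerNode n w') = outerNode n w' := (across_eq_iff _).2 ⟨w', rfl⟩
    rw [hk, hβk, heq, hq] at h1
    obtain ⟨c, hc⟩ := h1
    have hkc : k = q * (-c) := by
      push_cast at hc
      linarith
    apply outerNode_injective
    rw [hw', hk, heq, hq]
    rcases Int.even_or_odd' (-c) with ⟨d, hd | hd⟩
    · exfalso
      apply hne
      apply outerNode_injective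
      rw [hk, ← hs₀, hfix, hq, hkc, hd]
      exact ⟨d, by push_cast; ring⟩
    · rw [hkc, hd]
      exact ⟨d, by push_cast; ring⟩

end Pairing

section Composition

variable [CommMonoid G]

/-- Composition: concatenate, forget the middle column, multiply the labels along each strand, and
delete the loops. -/
noncomputable instance : Mul (GBrauerDiagram G n) where
  mul x y :=
    { rel := Setoid.ker (outer x y)
      pair := outer_pair x y
      label := fun v => strandLabel x y (outer x y v)
      label_eq := fun _ _ h => congrArg (strandLabel x y) h }

theorem mul_rel (x y : GBrauerDiagram G n) (v w : Fin n ⊕ Fin n) :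
    (x * y).rel v w ↔ outer x y v = outer x y w := Iff.rfl

theorem mul_label (x y : GBrauerDiagram G n) (v : Fin n ⊕ Fin n) :
    (x * y).label v = strandLabel x y (outer x y v) := rfl

/-- A strand is a loop if it meets neither outer column. -/
def IsLoop (x y : GBrauerDiagram G n) (s : Strand x y) : Prop := s ∉ Set.range (outer x y)

open Classical in
/-- The scalar by which the loops of the concatenation of `x` and `y` are replaced: the product,
over all loops `s`, of `g • δ`, where `g` is the product of the
labels of the edges in `s`. -/
noncomputable def loopFactor {k : Type*} [CommMonoid k] [SMul G k] (δ : k)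
    (x y : GBrauerDiagram G n) : k :=
  ∏ s with IsLoop x y s, strandLabel x y s • δ

/-- The identity diagram: horizontal edges labelled by `1`. -/
instance : One (GBrauerDiagram G n) where
  one :=
    { rel := Setoid.ker (Sum.elim id id : Fin n ⊕ Fin n → Fin n)
      pair := by
        rintro (i | i)
        · refine ⟨Sum.inr i, ⟨by simp, rfl⟩, ?_⟩
          rintro (j | j) ⟨h, h'⟩
          · exact absurd (congrArg Sum.inl (show i = j from h').symm) h
          · exact congrArg Sum.inr (show i = j from h').symm
        · refine ⟨Sum.inl i, ⟨by simp, rfl⟩, ?_⟩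
          rintro (j | j) ⟨h, h'⟩
          · exact congrArg Sum.inl (show i = j from h').symm
          · exact absurd (congrArg Sum.inr (show i = j from h').symm) h
      label := fun _ => 1
      label_eq := fun _ _ _ => rfl }

/-- The edges of `x * y` are the strands that are not loops. -/
noncomputable def edgeToStrand (x y : GBrauerDiagram G n) : (x * y).Edge → Strand x y :=
  Quotient.lift (outer x y) (fun _ _ h => h)

theorem edgeToStrand_edge (x y : GBrauerDiagram G n) (v : Fin n ⊕ Fin n) :
    edgeToStrand x y ((x * y).edge v) = outer x y v := rfl

theorem edgeToStrand_injective (x y : GBrauerDiagram G n) :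
    Function.Injective (edgeToStrand x y) := by
  intro e f h
  obtain ⟨v, rfl⟩ := (x * y).edge_surjective e
  obtain ⟨w, rfl⟩ := (x * y).edge_surjective f
  exact (x * y).edge_eq_iff.2 h

theorem range_edgeToStrand (x y : GBrauerDiagram G n) :
    Set.range (edgeToStrand x y) = Set.range (outer x y) := by
  ext s
  constructor
  · rintro ⟨e, rfl⟩
    obtain ⟨v, rfl⟩ := (x * y).edge_surjective e
    exact ⟨v, rfl⟩
  · rintro ⟨v, rfl⟩
    exact ⟨(x * y).edge v, rfl⟩

theorem edgeLabel_mul (x y : GBrauerDiagram G n) :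
    (x * y).edgeLabel = strandLabel x y ∘ edgeToStrand x y := by
  funext e
  obtain ⟨v, rfl⟩ := (x * y).edge_surjective e
  rfl

end Composition

end GBrauerDiagram

namespace GBrauerDiagram

variable {G : Type u} {n : ℕ}

section Associativity

variable [CommMonoid G]

open Classical in
theorem loop_prod_split {T S D W k : Type*} [Fintype T] [Fintype S] [Fintype D] [CommMonoid k]
    (R : Set D) (e : T ≃ S ⊕ {d : D // d ∉ R}) (o : W → S) (F : T → k) (F₁ : S → k)
    (F₂ : D → k) (o₂ : W → D) (hR : R = Set.range o₂) (h₁ : ∀ s, F (e.symm (Sum.inl s)) = F₁ s)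
    (h₂ : ∀ d, F (e.symm (Sum.inr d)) = F₂ d.1) :
    ∏ t with t ∉ Set.range (fun w => e.symm (Sum.inl (o w))), F t =
      (∏ s with s ∉ Set.range o, F₁ s) * ∏ d with d ∉ Set.range o₂, F₂ d := by
  subst hR
  rw [Finset.prod_filter, ← Equiv.prod_comp e.symm, Fintype.prod_sum_type]
  congr 1
  · rw [Finset.prod_filter]
    refine Finset.prod_congr rfl fun s _ => ?_
    simp [h₁]
  · rw [Finset.prod_subtype (p := fun d => d ∉ Set.range o₂) (F := inferInstance) _ (by simp)]
    refine Finset.prod_congr rfl fun d _ => ?_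
    simp [h₂]

/-- The components of the concatenation of three diagrams, with the first two composed first. -/
abbrev TripleL (x y z : GBrauerDiagram G n) : Type :=
  Glue (fun j : Fin n => Glue.mk (fun m : Fin n => x.edge (Sum.inr m))
    (fun m : Fin n => y.edge (Sum.inl m)) (Sum.inr (y.edge (Sum.inr j))))
    (fun m : Fin n => z.edge (Sum.inl m))

/-- The components of the concatenation of three diagrams, with the last two composed first. -/
abbrev TripleR (x y z : GBrauerDiagram G n) : Type :=
  Glue (fun m : Fin n => x.edge (Sum.inr m))
    (fun i : Fin n => Glue.mk (fun m : Fin n => y.edge (Sum.inr m))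
      (fun m : Fin n => z.edge (Sum.inl m)) (Sum.inl (y.edge (Sum.inl i))))

noncomputable def splitL (x y z : GBrauerDiagram G n) :
    TripleL x y z ≃ Strand (x * y) z ⊕ {s : Strand x y // s ∉ Set.range (edgeToStrand x y)} :=
  Glue.splitLeft (edgeToStrand x y) (edgeToStrand_injective x y)
    (fun j : Fin n => (x * y).edge (Sum.inr j)) (fun m : Fin n => z.edge (Sum.inl m))

noncomputable def splitR (x y z : GBrauerDiagram G n) :
    TripleR x y z ≃ Strand x (y * z) ⊕ {s : Strand y z // s ∉ Set.range (edgeToStrand y z)} :=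
  Glue.splitRight (edgeToStrand y z) (edgeToStrand_injective y z)
    (fun m : Fin n => x.edge (Sum.inr m)) (fun i : Fin n => (y * z).edge (Sum.inl i))

noncomputable def labelL (x y z : GBrauerDiagram G n) : TripleL x y z → G :=
  Glue.label _ _ (strandLabel x y) z.edgeLabel

noncomputable def labelR (x y z : GBrauerDiagram G n) : TripleR x y z → G :=
  Glue.label _ _ x.edgeLabel (strandLabel y z)

theorem labelL_inl (x y z : GBrauerDiagram G n) (s : Strand (x * y) z) :
    labelL x y z ((splitL x y z).symm (Sum.inl s)) = strandLabel (x * y) z s := by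
  have := Glue.label_splitLeft_inl (edgeToStrand x y) (edgeToStrand_injective x y)
    (fun j : Fin n => (x * y).edge (Sum.inr j)) (fun m : Fin n => z.edge (Sum.inl m))
    (strandLabel x y) z.edgeLabel s
  rw [← edgeLabel_mul] at this
  exact this

theorem labelL_inr (x y z : GBrauerDiagram G n)
    (s : {s : Strand x y // s ∉ Set.range (edgeToStrand x y)}) :
    labelL x y z ((splitL x y z).symm (Sum.inr s)) = strandLabel x y s :=
  Glue.label_splitLeft_inr (edgeToStrand x y) (edgeToStrand_injective x y)
    (fun j : Fin n => (x * y).edge (Sum.inr j)) (fun m : Fin n => z.edge (Sum.inl m))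
    (strandLabel x y) z.edgeLabel s

theorem labelR_inl (x y z : GBrauerDiagram G n) (s : Strand x (y * z)) :
    labelR x y z ((splitR x y z).symm (Sum.inl s)) = strandLabel x (y * z) s := by
  have := Glue.label_splitRight_inl (edgeToStrand y z) (edgeToStrand_injective y z)
    (fun m : Fin n => x.edge (Sum.inr m)) (fun i : Fin n => (y * z).edge (Sum.inl i))
    x.edgeLabel (strandLabel y z) s
  rw [← edgeLabel_mul] at this
  exact this

theorem labelR_inr (x y z : GBrauerDiagram G n)
    (s : {s : Strand y z // s ∉ Set.range (edgeToStrand y z)}) :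
    labelR x y z ((splitR x y z).symm (Sum.inr s)) = strandLabel y z s :=
  Glue.label_splitRight_inr (edgeToStrand y z) (edgeToStrand_injective y z)
    (fun m : Fin n => x.edge (Sum.inr m)) (fun i : Fin n => (y * z).edge (Sum.inl i))
    x.edgeLabel (strandLabel y z) s

/-- Both ways of concatenating three diagrams have the same components. -/
def tripleEquiv (x y z : GBrauerDiagram G n) : TripleL x y z ≃ TripleR x y z :=
  Glue.assoc (fun m : Fin n => x.edge (Sum.inr m)) (fun m => y.edge (Sum.inl m))
    (fun m => y.edge (Sum.inr m)) (fun m => z.edge (Sum.inl m))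

theorem labelR_tripleEquiv (x y z : GBrauerDiagram G n) (t : TripleL x y z) :
    labelR x y z (tripleEquiv x y z t) = labelL x y z t :=
  Glue.label_assoc (fun m : Fin n => x.edge (Sum.inr m)) (fun m => y.edge (Sum.inl m))
    (fun m => y.edge (Sum.inr m)) (fun m => z.edge (Sum.inl m)) x.edgeLabel y.edgeLabel
    z.edgeLabel t

theorem tripleEquiv_outer (x y z : GBrauerDiagram G n) (v : Fin n ⊕ Fin n) :
    tripleEquiv x y z ((splitL x y z).symm (Sum.inl (outer (x * y) z v))) =
      (splitR x y z).symm (Sum.inl (outer x (y * z) v)) := by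
  rcases v with v | v <;> rfl

protected theorem mul_assoc (x y z : GBrauerDiagram G n) : x * y * z = x * (y * z) := by
  refine GBrauerDiagram.ext (fun v w => ?_) fun v => ?_
  · rw [mul_rel, mul_rel]
    constructor
    · intro h
      have := congrArg (fun s => tripleEquiv x y z ((splitL x y z).symm (Sum.inl s))) h
      simp only [tripleEquiv_outer] at this
      exact Sum.inl_injective ((splitR x y z).symm.injective this)
    · intro h
      have := congrArg (fun s => (splitR x y z).symm (Sum.inl s)) h
      simp only [← tripleEquiv_outer] at this
      exact Sum.inl_injective ((splitL x y z).symm.injective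
        ((tripleEquiv x y z).injective this))
  · rw [mul_label, mul_label, ← labelR_inl, ← tripleEquiv_outer, labelR_tripleEquiv, labelL_inl]

open Classical in
theorem loopFactor_assoc {k : Type*} [CommMonoid k] [SMul G k] (δ : k)
    (x y z : GBrauerDiagram G n) :
    loopFactor δ x y * loopFactor δ (x * y) z = loopFactor δ y z * loopFactor δ x (y * z) := by
  have hL := loop_prod_split (Set.range (edgeToStrand x y)) (splitL x y z) (outer (x * y) z)
    (fun t => labelL x y z t • δ) (fun s => strandLabel (x * y) z s • δ)
    (fun s => strandLabel x y s • δ) (outer x y) (range_edgeToStrand x y) (fun s => by rw [labelL_inl]) (fun s => by rw [labelL_inr])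
  have hR := loop_prod_split (Set.range (edgeToStrand y z)) (splitR x y z) (outer x (y * z))
    (fun t => labelR x y z t • δ) (fun s => strandLabel x (y * z) s • δ)
    (fun s => strandLabel y z s • δ) (outer y z) (range_edgeToStrand y z) (fun s => by rw [labelR_inl]) (fun s => by rw [labelR_inr])
  have loops : ∀ u v : GBrauerDiagram G n,
      loopFactor δ u v = ∏ s with s ∉ Set.range (outer u v), strandLabel u v s • δ := by
    intro u v
    exact Finset.prod_congr (by ext; simp [IsLoop]) fun _ _ => rfl
  rw [mul_comm, loops, loops, loops, loops]
  refine Eq.trans (by congr!) (hL.symm.trans (Eq.trans ?_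
    (hR.trans ((mul_comm _ _).trans (by congr!)))))
  refine Finset.prod_bij (fun t _ => tripleEquiv x y z t) ?_ ?_ ?_ ?_
  · intro t ht
    simp only [Finset.mem_filter, Finset.mem_univ, true_and, Set.mem_range, not_exists] at ht ⊢
    intro w hw
    rw [← tripleEquiv_outer, (tripleEquiv x y z).injective.eq_iff] at hw
    exact ht w hw
  · intro t _ t' _ h
    exact (tripleEquiv x y z).injective h
  · intro t ht
    refine ⟨(tripleEquiv x y z).symm t, ?_, by simp⟩
    simp only [Finset.mem_filter, Finset.mem_univ, true_and, Set.mem_range, not_exists] at ht ⊢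
    intro w hw
    apply ht w
    rw [← tripleEquiv_outer, hw, Equiv.apply_symm_apply]
  · intro t _
    rw [labelR_tripleEquiv]

theorem one_rel_mid (m : Fin n) : (1 : GBrauerDiagram G n).edge (Sum.inl m) =
    (1 : GBrauerDiagram G n).edge (Sum.inr m) := (edge_eq_iff _).2 rfl

theorem one_edgeLabel (e : (1 : GBrauerDiagram G n).Edge) :
    (1 : GBrauerDiagram G n).edgeLabel e = 1 := by
  obtain ⟨v, rfl⟩ := edge_surjective _ e
  rfl

/-- Concatenating with the identity on the left does not change the components. -/
def fromOne (y : GBrauerDiagram G n) : Strand 1 y → y.Edge :=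
  Glue.lift (Quotient.lift (fun v => y.edge (Sum.inl (Sum.elim id id v)))
    (fun _ _ h => congrArg (fun i => y.edge (Sum.inl i)) h)) id (fun _ => rfl)

/-- Concatenating with the identity on the right does not change the components. -/
def toOne (x : GBrauerDiagram G n) : Strand x 1 → x.Edge :=
  Glue.lift id (Quotient.lift (fun v => x.edge (Sum.inr (Sum.elim id id v)))
    (fun _ _ h => congrArg (fun i => x.edge (Sum.inr i)) h)) (fun _ => rfl)

theorem outer_one_left (y : GBrauerDiagram G n) (v : Fin n ⊕ Fin n) :
    outer 1 y v = Glue.mk _ _ (Sum.inr (y.edge v)) := by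
  rcases v with i | j
  · refine Eq.trans ?_ (Glue.sound (fun m : Fin n => (1 : GBrauerDiagram G n).edge (Sum.inr m))
      (fun m => y.edge (Sum.inl m)) i)
    exact congrArg (fun e => Glue.mk _ _ (Sum.inl e)) (one_rel_mid i)
  · rfl

theorem outer_one_right (x : GBrauerDiagram G n) (v : Fin n ⊕ Fin n) :
    outer x 1 v = Glue.mk _ _ (Sum.inl (x.edge v)) := by
  rcases v with i | j
  · rfl
  · refine Eq.trans ?_ (Glue.sound (fun m : Fin n => x.edge (Sum.inr m))
      (fun m => (1 : GBrauerDiagram G n).edge (Sum.inl m)) j).symm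
    exact congrArg (fun e => Glue.mk _ _ (Sum.inr e)) (one_rel_mid j).symm

theorem outer_one_left_surjective (y : GBrauerDiagram G n) : Function.Surjective (outer 1 y) := by
  intro s
  obtain ⟨e | e, rfl⟩ := Glue.mk_surjective _ _ s
  · obtain ⟨i | i, rfl⟩ := edge_surjective _ e
    · exact ⟨Sum.inl i, rfl⟩
    · rw [← one_rel_mid]
      exact ⟨Sum.inl i, rfl⟩
  · obtain ⟨v, rfl⟩ := edge_surjective _ e
    exact ⟨v, outer_one_left y v⟩

theorem outer_one_right_surjective (x : GBrauerDiagram G n) :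
    Function.Surjective (outer x 1) := by
  intro s
  obtain ⟨e | e, rfl⟩ := Glue.mk_surjective _ _ s
  · obtain ⟨v, rfl⟩ := edge_surjective _ e
    exact ⟨v, outer_one_right x v⟩
  · obtain ⟨i | i, rfl⟩ := edge_surjective _ e
    · rw [one_rel_mid]
      exact ⟨Sum.inr i, rfl⟩
    · exact ⟨Sum.inr i, rfl⟩

protected theorem one_mul (y : GBrauerDiagram G n) : 1 * y = y := by
  classical
  refine GBrauerDiagram.ext (fun v w => ?_) fun v => ?_
  · rw [mul_rel, outer_one_left, outer_one_left, ← edge_eq_iff]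
    exact ⟨fun h => congrArg (fromOne y) h, fun h => congrArg (fun e => Glue.mk _ _ (Sum.inr e)) h⟩
  · rw [mul_label, outer_one_left]
    refine (Glue.label_eq_mul _ _ _ _ _).trans ?_
    have h1 : fibreProd (fun b => Glue.mk (fun m : Fin n => (1 : GBrauerDiagram G n).edge
        (Sum.inr m)) (fun m : Fin n => y.edge (Sum.inl m)) (Sum.inl b))
        (1 : GBrauerDiagram G n).edgeLabel (Glue.mk _ _ (Sum.inr (y.edge v))) = 1 :=
      Finset.prod_eq_one fun e _ => one_edgeLabel e
    rw [h1, one_mul]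
    exact fibreProd_single (fun e => Glue.mk _ _ (Sum.inr e)) y.edgeLabel (y.edge v)
      (fun e he => congrArg (fromOne y) he)

protected theorem mul_one (x : GBrauerDiagram G n) : x * 1 = x := by
  classical
  refine GBrauerDiagram.ext (fun v w => ?_) fun v => ?_
  · rw [mul_rel, outer_one_right, outer_one_right, ← edge_eq_iff]
    exact ⟨fun h => congrArg (toOne x) h, fun h => congrArg (fun e => Glue.mk _ _ (Sum.inl e)) h⟩
  · rw [mul_label, outer_one_right]
    refine (Glue.label_eq_mul _ _ _ _ _).trans ?_
    have h1 : fibreProd (fun b => Glue.mk (fun m : Fin n => x.edge (Sum.inr m))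
        (fun m : Fin n => (1 : GBrauerDiagram G n).edge (Sum.inl m)) (Sum.inr b))
        (1 : GBrauerDiagram G n).edgeLabel (Glue.mk _ _ (Sum.inl (x.edge v))) = 1 :=
      Finset.prod_eq_one fun e _ => one_edgeLabel e
    rw [h1, mul_one]
    exact fibreProd_single (fun e => Glue.mk _ _ (Sum.inl e)) x.edgeLabel (x.edge v)
      (fun e he => congrArg (toOne x) he)

noncomputable instance : Monoid (GBrauerDiagram G n) where
  mul_assoc := GBrauerDiagram.mul_assoc
  one_mul := GBrauerDiagram.one_mul
  mul_one := GBrauerDiagram.mul_one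

theorem loopFactor_eq_one {k : Type*} [CommMonoid k] [SMul G k] (δ : k)
    (x y : GBrauerDiagram G n) (h : Function.Surjective (outer x y)) : loopFactor δ x y = 1 := by
  classical
  refine Finset.prod_eq_one fun s hs => ?_
  simp only [Finset.mem_filter] at hs
  exact absurd (h s) hs.2

end Associativity

section Planar

/-- The position of a node when the nodes are listed in their cyclic order around the boundary of
the strip: down the left column, then up the right column. -/
def position : Fin n ⊕ Fin n → ℕ := Sum.elim (fun i => i) (fun j => n + (Fin.rev j : ℕ))

/-- A diagram is planar if its edges can be drawn inside the strip without crossings, that is, if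
the end nodes of two edges never interlace in the cyclic order. -/
def IsPlanar (x : GBrauerDiagram G n) : Prop :=
  ∀ a b c d, x.rel a c → x.rel b d →
    ¬ (position a < position b ∧ position b < position c ∧ position c < position d)

theorem position_injective : Function.Injective (position : Fin n ⊕ Fin n → ℕ) := by
  rintro (i | i) (j | j) h <;> simp [position, Fin.ext_iff, Fin.val_rev] at h ⊢ <;> omega

/-- The indicator of `position a < position b`, modulo two. -/
def before (a b : Fin n ⊕ Fin n) : ZMod 2 := if position a < position b then 1 else 0

theorem IsPlanar.crossing {x : GBrauerDiagram G n} (hx : x.IsPlanar) {a b : Fin n ⊕ Fin n}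
    (h : ¬ x.rel a b) : before a b + before (x.mate a) b + (before a (x.mate b) +
      before (x.mate a) (x.mate b)) = 0 := by
  have ra := x.rel_mate a
  have rb := x.rel_mate b
  set a' := x.mate a
  set b' := x.mate b
  have hne : ∀ {s t}, x.rel a s → x.rel b t → position s ≠ position t := by
    intro s t hs ht hst
    rw [position_injective hst] at hs
    exact h (x.rel.trans hs (x.rel.symm ht))
  have n1 := hne (x.rel.refl a) (x.rel.refl b)
  have n2 := hne ra (x.rel.refl b)
  have n3 := hne (x.rel.refl a) rb
  have n4 := hne ra rb
  have ra' := x.rel.symm ra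
  have rb' := x.rel.symm rb
  unfold before
  split_ifs <;> first
    | decide
    | exact (hx a b a' b' ra rb ⟨by omega, by omega, by omega⟩).elim
    | exact (hx a' b a b' ra' rb ⟨by omega, by omega, by omega⟩).elim
    | exact (hx a b' a' b ra rb' ⟨by omega, by omega, by omega⟩).elim
    | exact (hx a' b' a b ra' rb' ⟨by omega, by omega, by omega⟩).elim
    | exact (hx b a b' a' rb ra ⟨by omega, by omega, by omega⟩).elim
    | exact (hx b' a b a' rb' ra ⟨by omega, by omega, by omega⟩).elim
    | exact (hx b a' b' a rb ra' ⟨by omega, by omega, by omega⟩).elim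
    | exact (hx b' a' b a rb' ra' ⟨by omega, by omega, by omega⟩).elim

theorem sum_mate (x : GBrauerDiagram G n) (F : Fin n ⊕ Fin n → ZMod 2) :
    ∑ v, F v = ∑ v with position v < position (x.mate v), (F v + F (x.mate v)) := by
  classical
  rw [Finset.sum_add_distrib, ← Finset.sum_filter_add_sum_filter_not Finset.univ
    (fun v => position v < position (x.mate v))]
  congr 1
  refine Finset.sum_bij' (fun v _ => x.mate v) (fun v _ => x.mate v) ?_ ?_ ?_ ?_ ?_
  · intro v hv
    have := position_injective.ne (x.mate_ne v)
    simp only [Finset.mem_filter, Finset.mem_univ, true_and, mate_mate] at hv ⊢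
    omega
  · intro v hv
    simp only [Finset.mem_filter, Finset.mem_univ, true_and, mate_mate] at hv ⊢
    omega
  · intro v _; exact x.mate_mate v
  · intro v _; exact x.mate_mate v
  · intro v _; rw [mate_mate]

theorem sum_invariant (x : GBrauerDiagram G n) (p : Fin n ⊕ Fin n → ZMod 2)
    (hp : ∀ v, p (x.mate v) = p v) : ∑ v, p v = 0 := by
  rw [x.sum_mate]
  refine Finset.sum_eq_zero fun v _ => ?_
  rw [hp]
  exact CharTwo.add_self_eq_zero _

theorem IsPlanar.sum_before {x : GBrauerDiagram G n} (hx : x.IsPlanar)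
    (p q : Fin n ⊕ Fin n → ZMod 2) (hp : ∀ v, p (x.mate v) = p v)
    (hq : ∀ v, q (x.mate v) = q v) (hpq : ∀ v w, x.rel v w → p v * q w = 0) :
    ∑ v, ∑ w, p v * q w * before v w = 0 := by
  rw [x.sum_mate]
  refine Finset.sum_eq_zero fun v _ => ?_
  rw [← Finset.sum_add_distrib, x.sum_mate]
  refine Finset.sum_eq_zero fun w _ => ?_
  rw [hp, hq]
  by_cases h : x.rel v w
  · rw [hpq v w h]; ring
  · have := hx.crossing h
    linear_combination (p v * q w) * this

theorem IsPlanar.mul [CommMonoid G] {x y : GBrauerDiagram G n} (hx : x.IsPlanar)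
    (hy : y.IsPlanar) : (x * y).IsPlanar := by
  classical
  rintro a b c d hac hbd ⟨h1, h2, h3⟩
  rw [mul_rel] at hac hbd
  have hab : outer x y a ≠ outer x y b := by
    intro h
    obtain ⟨w, -, hw⟩ := outer_pair x y a
    have e1 := hw b ⟨by rintro rfl; omega, h⟩
    have e2 := hw c ⟨by rintro rfl; omega, hac⟩
    rw [e1, e2] at h2
    omega
  set P := outer x y a
  set Q := outer x y b
  let p : Node n → ZMod 2 := fun s => if strandOf x y s = P then 1 else 0
  let q : Node n → ZMod 2 := fun s => if strandOf x y s = Q then 1 else 0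
  have hpq : ∀ s t, strandOf x y s = strandOf x y t → p s * q t = 0 := by
    intro s t hst
    simp only [p, q, hst]
    split_ifs with h h'
    · exact absurd (h.symm.trans h') hab
    all_goals simp
  have px : ∀ v, p (Sum.inl (x.mate v)) = p (Sum.inl v) := fun v => by
    have := strandOf_along x y (Sum.inl v)
    simp only [p]; rw [← this]; rfl
  have py : ∀ v, p (Sum.inr (y.mate v)) = p (Sum.inr v) := fun v => by
    have := strandOf_along x y (Sum.inr v)
    simp only [p]; rw [← this]; rfl
  have qx : ∀ v, q (Sum.inl (x.mate v)) = q (Sum.inl v) := fun v => by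
    have := strandOf_along x y (Sum.inl v)
    simp only [q]; rw [← this]; rfl
  have qy : ∀ v, q (Sum.inr (y.mate v)) = q (Sum.inr v) := fun v => by
    have := strandOf_along x y (Sum.inr v)
    simp only [q]; rw [← this]; rfl
  have pm : ∀ m : Fin n, p (Sum.inr (Sum.inl m)) = p (Sum.inl (Sum.inr m)) := fun m => by
    have := strandOf_across x y (Sum.inl (Sum.inr m))
    simp only [p]; rw [← this]; rfl
  have qm : ∀ m : Fin n, q (Sum.inr (Sum.inl m)) = q (Sum.inl (Sum.inr m)) := fun m => by
    have := strandOf_across x y (Sum.inl (Sum.inr m))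
    simp only [q]; rw [← this]; rfl
  have sx := hx.sum_before (fun v => p (Sum.inl v)) (fun v => q (Sum.inl v)) px qx
    (fun v w h => hpq _ _ (congrArg (fun e => Glue.mk _ _ (Sum.inl e)) (x.edge_eq_iff.2 h)))
  have sy := hy.sum_before (fun v => p (Sum.inr v)) (fun v => q (Sum.inr v)) py qy
    (fun v w h => hpq _ _ (congrArg (fun e => Glue.mk _ _ (Sum.inr e)) (y.edge_eq_iff.2 h)))
  have fy := sum_invariant y (fun v => q (Sum.inr v)) qy
  have bLL : ∀ i j : Fin n, before (Sum.inl i) (Sum.inl j) = if i < j then 1 else 0 := by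
    intro i j; simp [before, position]
  have bLR : ∀ i j : Fin n, before (Sum.inl i) (Sum.inr j) = 1 := by
    intro i j
    exact if_pos (by simp only [position, Sum.elim_inl, Sum.elim_inr, Fin.val_rev]; omega)
  have bRL : ∀ i j : Fin n, before (Sum.inr i) (Sum.inl j) = 0 := by
    intro i j
    exact if_neg (by simp only [position, Sum.elim_inl, Sum.elim_inr, Fin.val_rev]; omega)
  have bRR : ∀ i j : Fin n, before (Sum.inr i) (Sum.inr j) = if j < i then 1 else 0 := by
    intro i j
    simp only [before, position, Sum.elim_inr, Fin.val_rev, Fin.lt_def]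
    refine if_congr ?_ rfl rfl
    omega
  simp only [Fintype.sum_sum_type, pm, qm] at sx sy fy
  simp only [bLL, bLR, bRL, bRR, mul_one, mul_zero, Finset.sum_const_zero,
    zero_add, Finset.sum_add_distrib, ← Finset.mul_sum, ← Finset.sum_mul] at sx sy
  have mid : ∑ i : Fin n, ∑ j : Fin n, p (Sum.inl (Sum.inr i)) * q (Sum.inl (Sum.inr j)) *
        (if j < i then 1 else 0) + ∑ i : Fin n, ∑ j : Fin n, p (Sum.inl (Sum.inr i)) *
        q (Sum.inl (Sum.inr j)) * (if i < j then 1 else 0) =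
      (∑ i : Fin n, p (Sum.inl (Sum.inr i))) * ∑ i : Fin n, q (Sum.inl (Sum.inr i)) := by
    rw [Finset.sum_mul_sum, ← Finset.sum_add_distrib]
    refine Finset.sum_congr rfl fun i _ => ?_
    rw [← Finset.sum_add_distrib]
    refine Finset.sum_congr rfl fun j _ => ?_
    rcases lt_trichotomy i j with h | rfl | h
    · simp [h, h.not_gt]
    · simp [hpq (Sum.inl (Sum.inr i)) (Sum.inl (Sum.inr i)) rfl]
    · simp [h, h.not_gt]
  have out : ∑ v, ∑ w, p (outerNode n v) * q (outerNode n w) * before v w = 0 := by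
    simp only [Fintype.sum_sum_type, outerNode, Sum.map_inl, Sum.map_inr]
    simp only [bLL, bLR, bRL, bRR, mul_one, mul_zero, Finset.sum_const_zero,
      zero_add, Finset.sum_add_distrib, ← Finset.mul_sum, ← Finset.sum_mul]
    have two : (2 : ZMod 2) = 0 := by decide
    set pL := ∑ i : Fin n, p (Sum.inl (Sum.inl i))
    set pM := ∑ i : Fin n, p (Sum.inl (Sum.inr i))
    set pR := ∑ i : Fin n, p (Sum.inr (Sum.inr i))
    set qL := ∑ i : Fin n, q (Sum.inl (Sum.inl i))
    set qM := ∑ i : Fin n, q (Sum.inl (Sum.inr i))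
    set qR := ∑ i : Fin n, q (Sum.inr (Sum.inr i))
    have h4 : qR = qM := by linear_combination fy - qM * two
    linear_combination sx + sy - mid + (pL - pM) * h4 - pM * qM * two
  have hp : ∀ v, p (outerNode n v) = if v = a ∨ v = c then 1 else 0 := by
    intro v
    simp only [p, strandOf_outerNode]
    refine if_congr ⟨fun h => ?_, ?_⟩ rfl rfl
    · obtain ⟨w, -, hw⟩ := outer_pair x y a
      by_cases hv : v = a
      · exact Or.inl hv
      · exact Or.inr ((hw v ⟨hv, h.symm⟩).trans (hw c ⟨by rintro rfl; omega, hac⟩).symm)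
    · rintro (rfl | rfl)
      · rfl
      · exact hac.symm
  have hq : ∀ v, q (outerNode n v) = if v = b ∨ v = d then 1 else 0 := by
    intro v
    simp only [q, strandOf_outerNode]
    refine if_congr ⟨fun h => ?_, ?_⟩ rfl rfl
    · obtain ⟨w, -, hw⟩ := outer_pair x y b
      by_cases hv : v = b
      · exact Or.inl hv
      · exact Or.inr ((hw v ⟨hv, h.symm⟩).trans (hw d ⟨by rintro rfl; omega, hbd⟩).symm)
    · rintro (rfl | rfl)
      · rfl
      · exact hbd.symm
  have pick : ∀ (s t : Fin n ⊕ Fin n), s ≠ t → ∀ f : Fin n ⊕ Fin n → ZMod 2,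
      ∑ v, (if v = s ∨ v = t then 1 else 0) * f v = f s + f t := by
    intro s t hst f
    simp only [ite_mul, one_mul, zero_mul]
    rw [← Finset.sum_filter, show Finset.univ.filter (fun v => v = s ∨ v = t) = {s, t} by
      ext; simp, Finset.sum_pair hst]
  simp only [hp, hq, mul_assoc, ← Finset.mul_sum] at out
  rw [pick a c (by rintro rfl; omega), pick b d (by rintro rfl; omega),
    pick b d (by rintro rfl; omega)] at out
  have h4 : ¬ position c < position b := by omega
  have h5 : position a < position d := by omega
  simp only [before, h1, h3, h4, h5, if_true, if_false] at out
  exact absurd out (by decide)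

theorem isPlanar_one [CommMonoid G] : (1 : GBrauerDiagram G n).IsPlanar := by
  have key : ∀ v w : Fin n ⊕ Fin n, (1 : GBrauerDiagram G n).rel v w →
      v = w ∨ position v + position w + 1 = 2 * n := by
    rintro (i | i) (j | j) h
    · exact Or.inl (congrArg Sum.inl h)
    · obtain rfl : i = j := h
      right; simp only [position, Sum.elim_inl, Sum.elim_inr, Fin.val_rev]; omega
    · obtain rfl : i = j := h
      right; simp only [position, Sum.elim_inl, Sum.elim_inr, Fin.val_rev]; omega
    · exact Or.inl (congrArg Sum.inr h)
  rintro a b c d hac hbd ⟨h1, h2, h3⟩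
  rcases key a c hac with rfl | h
  · omega
  rcases key b d hbd with rfl | h'
  · omega
  omega

end Planar

section Permutation

/-- The diagram has no left-to-left and no right-to-right connections. -/
def AllThrough (x : GBrauerDiagram G n) : Prop :=
  (∀ i j : Fin n, x.rel (Sum.inl i) (Sum.inl j) → i = j) ∧
    ∀ i j : Fin n, x.rel (Sum.inr i) (Sum.inr j) → i = j

theorem AllThrough.exists_left {x : GBrauerDiagram G n} (h : x.AllThrough) (j : Fin n) :
    ∃ i : Fin n, x.rel (Sum.inr j) (Sum.inl i) := by
  have h1 := x.rel_mate (Sum.inr j)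
  have h2 := x.mate_ne (Sum.inr j)
  rcases hm : x.mate (Sum.inr j) with i | i
  · exact ⟨i, hm ▸ h1⟩
  · rw [hm] at h1 h2
    rw [h.2 _ _ h1] at h2
    exact absurd rfl h2

theorem AllThrough.exists_right {x : GBrauerDiagram G n} (h : x.AllThrough) (i : Fin n) :
    ∃ j : Fin n, x.rel (Sum.inl i) (Sum.inr j) := by
  have h1 := x.rel_mate (Sum.inl i)
  have h2 := x.mate_ne (Sum.inl i)
  rcases hm : x.mate (Sum.inl i) with j | j
  · rw [hm] at h1 h2
    rw [h.1 _ _ h1] at h2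
    exact absurd rfl h2
  · exact ⟨j, hm ▸ h1⟩

theorem allThrough_of_left {x : GBrauerDiagram G n}
    (h : ∀ i j : Fin n, x.rel (Sum.inl i) (Sum.inl j) → i = j) : x.AllThrough := by
  have ex : ∀ i : Fin n, ∃ j : Fin n, x.rel (Sum.inl i) (Sum.inr j) := by
    intro i
    have h1 := x.rel_mate (Sum.inl i)
    have h2 := x.mate_ne (Sum.inl i)
    rcases hm : x.mate (Sum.inl i) with j | j
    · rw [hm] at h1 h2
      rw [h _ _ h1] at h2
      exact absurd rfl h2
    · exact ⟨j, hm ▸ h1⟩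
  choose f hf using ex
  have inj : Function.Injective f := by
    intro i j hij
    refine h i j (x.rel.trans (hf i) ?_)
    rw [hij]
    exact x.rel.symm (hf j)
  have surj := Finite.surjective_of_injective inj
  refine ⟨h, fun i j hij => ?_⟩
  obtain ⟨i, rfl⟩ := surj i
  obtain ⟨j, rfl⟩ := surj j
  exact congrArg f (h i j (x.rel.trans (hf i) (x.rel.trans hij (x.rel.symm (hf j)))))

theorem allThrough_of_right {x : GBrauerDiagram G n}
    (h : ∀ i j : Fin n, x.rel (Sum.inr i) (Sum.inr j) → i = j) : x.AllThrough := by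
  have ex : ∀ i : Fin n, ∃ j : Fin n, x.rel (Sum.inr i) (Sum.inl j) := by
    intro i
    have h1 := x.rel_mate (Sum.inr i)
    have h2 := x.mate_ne (Sum.inr i)
    rcases hm : x.mate (Sum.inr i) with j | j
    · exact ⟨j, hm ▸ h1⟩
    · rw [hm] at h1 h2
      rw [h _ _ h1] at h2
      exact absurd rfl h2
  choose f hf using ex
  have inj : Function.Injective f := by
    intro i j hij
    refine h i j (x.rel.trans (hf i) ?_)
    rw [hij]
    exact x.rel.symm (hf j)
  have surj := Finite.surjective_of_injective inj
  refine ⟨fun i j hij => ?_, h⟩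
  obtain ⟨i, rfl⟩ := surj i
  obtain ⟨j, rfl⟩ := surj j
  exact congrArg f (h i j (x.rel.trans (hf i) (x.rel.trans hij (x.rel.symm (hf j)))))

theorem AllThrough.surjective_outer {x y : GBrauerDiagram G n} (hx : x.AllThrough)
    (hy : y.AllThrough) : Function.Surjective (outer x y) := by
  have left : ∀ v, ∃ w, outer x y w = Glue.mk _ _ (Sum.inl (x.edge v)) := by
    rintro (i | j)
    · exact ⟨Sum.inl i, rfl⟩
    · obtain ⟨i, hi⟩ := hx.exists_left j
      refine ⟨Sum.inl i, ?_⟩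
      rw [x.edge_eq_iff.2 hi]
      rfl
  have right : ∀ v, ∃ w, outer x y w = Glue.mk _ _ (Sum.inr (y.edge v)) := by
    rintro (i | j)
    · obtain ⟨j, hj⟩ := hy.exists_right i
      refine ⟨Sum.inr j, ?_⟩
      rw [y.edge_eq_iff.2 hj]
      rfl
    · exact ⟨Sum.inr j, rfl⟩
  intro s
  obtain ⟨e | e, rfl⟩ := Glue.mk_surjective _ _ s
  · obtain ⟨v, rfl⟩ := x.edge_surjective e
    exact left v
  · obtain ⟨v, rfl⟩ := y.edge_surjective e
    exact right v

variable [CommMonoid G]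

theorem AllThrough.mul {x y : GBrauerDiagram G n} (hx : x.AllThrough) (hy : y.AllThrough) :
    (x * y).AllThrough := by
  choose f hf using hx.exists_right
  have hfx : ∀ v w, x.rel v w → (Sum.elim f id v : Fin n) = Sum.elim f id w := by
    have toR : ∀ v, x.rel v (Sum.inr (Sum.elim f id v)) := by
      rintro (i | j)
      · exact hf i
      · exact x.rel.refl _
    intro v w hvw
    exact hx.2 _ _ (x.rel.trans (x.rel.symm (toR v)) (x.rel.trans hvw (toR w)))
  choose g hg using hy.exists_left
  have hgy : ∀ v w, y.rel v w → (Sum.elim id g v : Fin n) = Sum.elim id g w := by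
    have toL : ∀ v, y.rel v (Sum.inl (Sum.elim id g v)) := by
      rintro (i | j)
      · exact y.rel.refl _
      · exact hg j
    intro v w hvw
    exact hy.1 _ _ (y.rel.trans (y.rel.symm (toL v)) (y.rel.trans hvw (toL w)))
  let F : Strand x y → Fin n := Glue.lift (Quotient.lift _ hfx) (Quotient.lift _ hgy)
    (fun m => rfl)
  refine allThrough_of_left fun i j hij => ?_
  have h : f i = f j := congrArg F hij
  refine hx.1 _ _ (x.rel.trans (hf i) ?_)
  rw [h]
  exact x.rel.symm (hf j)

theorem AllThrough.of_mul {x y : GBrauerDiagram G n} (h : (x * y).AllThrough) :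
    x.AllThrough ∧ y.AllThrough := by
  constructor
  · refine allThrough_of_left fun i j hij => h.1 i j ?_
    rw [mul_rel]
    exact congrArg (fun e => Glue.mk _ _ (Sum.inl e)) (x.edge_eq_iff.2 hij)
  · refine allThrough_of_right fun i j hij => h.2 i j ?_
    rw [mul_rel]
    exact congrArg (fun e => Glue.mk _ _ (Sum.inr e)) (y.edge_eq_iff.2 hij)

theorem allThrough_one : (1 : GBrauerDiagram G n).AllThrough :=
  ⟨fun _ _ h => h, fun _ _ h => h⟩

end Permutation

end GBrauerDiagram

/-! ### Twisted monoid algebras -/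

/-- A normalized two-cocycle on a monoid with values in a commutative ring. -/
structure TwoCocycle (M k : Type*) [Monoid M] [CommRing k] where
  toFun : M → M → k
  one_left : ∀ x, toFun 1 x = 1
  one_right : ∀ x, toFun x 1 = 1
  assoc : ∀ x y z, toFun x y * toFun (x * y) z = toFun y z * toFun x (y * z)

/-- The algebra of formal `k`-linear combinations of elements of `M`, with the bilinear
multiplication in which `x` times `y` is `c x y` times the basis element `x * y`. -/
def TwistedMonoidAlgebra {M k : Type*} [Monoid M] [CommRing k] (_c : TwoCocycle M k) : Type _ :=
  M →₀ k

namespace TwistedMonoidAlgebra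

variable {M k : Type*} [Monoid M] [CommRing k] (c : TwoCocycle M k)

noncomputable instance : AddCommGroup (TwistedMonoidAlgebra c) :=
  inferInstanceAs (AddCommGroup (M →₀ k))

noncomputable instance : Module k (TwistedMonoidAlgebra c) := inferInstanceAs (Module k (M →₀ k))

/-- The basis element given by an element of the monoid. -/
noncomputable def of (x : M) : TwistedMonoidAlgebra c := Finsupp.single x (1 : k)

/-- The linear map with prescribed values on the basis elements. -/
noncomputable def linearLift {P : Type*} [AddCommGroup P] [Module k P] (v : M → P) :
    TwistedMonoidAlgebra c →ₗ[k] P := Finsupp.linearCombination k v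

@[simp] theorem linearLift_of {P : Type*} [AddCommGroup P] [Module k P] (v : M → P) (x : M) :
    linearLift c v (of c x) = v x :=
  (Finsupp.linearCombination_single k (1 : k) x).trans (one_smul k _)

theorem linear_ext {P : Type*} [AddCommGroup P] [Module k P]
    {f g : TwistedMonoidAlgebra c →ₗ[k] P} (h : ∀ x, f (of c x) = g (of c x)) : f = g :=
  Finsupp.lhom_ext' fun x => LinearMap.ext_ring (h x)

/-- The multiplication, as a bilinear map. -/
noncomputable def mulHom :
    TwistedMonoidAlgebra c →ₗ[k] TwistedMonoidAlgebra c →ₗ[k] TwistedMonoidAlgebra c :=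
  linearLift c fun x => linearLift c fun y => c.toFun x y • of c (x * y)

noncomputable instance : Mul (TwistedMonoidAlgebra c) := ⟨fun a b => mulHom c a b⟩

noncomputable instance : One (TwistedMonoidAlgebra c) := ⟨of c 1⟩

theorem mul_def (a b : TwistedMonoidAlgebra c) : a * b = mulHom c a b := rfl

theorem one_def : (1 : TwistedMonoidAlgebra c) = of c 1 := rfl

theorem of_mul_of (x y : M) : of c x * of c y = c.toFun x y • of c (x * y) := by
  rw [mul_def, mulHom, linearLift_of, linearLift_of]

noncomputable instance : Ring (TwistedMonoidAlgebra c) :=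
  { (inferInstance : AddCommGroup (TwistedMonoidAlgebra c)) with
    mul := (· * ·)
    one := 1
    left_distrib := fun a b d => map_add (mulHom c a) b d
    right_distrib := fun a b d => by
      show mulHom c (a + b) d = mulHom c a d + mulHom c b d
      rw [map_add]; rfl
    zero_mul := fun a => by
      show mulHom c 0 a = 0
      rw [map_zero]; rfl
    mul_zero := fun a => map_zero (mulHom c a)
    one_mul := fun a => by
      have : mulHom c (of c 1) = LinearMap.id := linear_ext c fun x => by
        rw [← mul_def, of_mul_of, c.one_left, one_mul, one_smul]; rfl
      exact congrArg (fun f => f a) this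
    mul_one := fun a => by
      have : (mulHom c).flip (of c 1) = LinearMap.id := linear_ext c fun x => by
        rw [LinearMap.flip_apply, ← mul_def, of_mul_of, c.one_right, mul_one, one_smul]; rfl
      exact congrArg (fun f => f a) this
    mul_assoc := fun a b d => by
      have h₁ : ∀ x y, mulHom c (of c x * of c y) = mulHom c (of c x) ∘ₗ mulHom c (of c y) :=
        fun x y => linear_ext c fun z => by
          rw [LinearMap.comp_apply, ← mul_def, ← mul_def c (of c y), of_mul_of, of_mul_of, map_smul,
            mul_def, map_smul, LinearMap.smul_apply, ← mul_def, ← mul_def, of_mul_of, of_mul_of,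
            smul_smul, smul_smul, c.assoc, mul_assoc]
      have h₂ : ∀ x, (mulHom c).flip d ∘ₗ mulHom c (of c x) =
          mulHom c (of c x) ∘ₗ (mulHom c).flip d :=
        fun x => linear_ext c fun y => congrArg (fun f => f d) (h₁ x y)
      have h₃ : (mulHom c).flip d ∘ₗ (mulHom c).flip b = (mulHom c).flip (b * d) :=
        linear_ext c fun x => congrArg (fun f => f b) (h₂ x)
      exact congrArg (fun f => f a) h₃ }

theorem smul_mul' (r : k) (a b : TwistedMonoidAlgebra c) : r • a * b = r • (a * b) := by
  rw [mul_def, map_smul]; rfl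

theorem mul_smul' (r : k) (a b : TwistedMonoidAlgebra c) : a * r • b = r • (a * b) :=
  map_smul (mulHom c a) r b

noncomputable instance : Algebra k (TwistedMonoidAlgebra c) :=
  Algebra.ofModule (smul_mul' c) (mul_smul' c)

/-- The algebra homomorphism to the ground ring with prescribed values on the basis elements. -/
noncomputable def liftToBase (χ : M → k) (h1 : χ 1 = 1)
    (hmul : ∀ x y, c.toFun x y * χ (x * y) = χ x * χ y) : TwistedMonoidAlgebra c →ₐ[k] k :=
  AlgHom.ofLinearMap (linearLift c χ) (by rw [one_def, linearLift_of, h1]) (fun a b => by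
    have h₁ : ∀ x, linearLift c χ ∘ₗ mulHom c (of c x) = χ x • linearLift c χ :=
      fun x => linear_ext c fun y => by
        rw [LinearMap.comp_apply, ← mul_def, of_mul_of, map_smul, LinearMap.smul_apply,
          linearLift_of, linearLift_of, smul_eq_mul, smul_eq_mul, hmul]
    have h₂ : linearLift c χ ∘ₗ (mulHom c).flip b = linearLift c χ b • linearLift c χ :=
      linear_ext c fun x => by
        have := congrArg (fun f => f b) (h₁ x)
        refine this.trans ?_
        rw [LinearMap.smul_apply, LinearMap.smul_apply, linearLift_of, smul_eq_mul, smul_eq_mul,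
          mul_comm]
    have := congrArg (fun f => f a) h₂
    refine this.trans ?_
    rw [LinearMap.smul_apply, smul_eq_mul, mul_comm])

@[simp] theorem liftToBase_of (χ : M → k) (h1 : χ 1 = 1)
    (hmul : ∀ x y, c.toFun x y * χ (x * y) = χ x * χ y) (x : M) :
    liftToBase c χ h1 hmul (of c x) = χ x := linearLift_of c χ x

end TwistedMonoidAlgebra

/-! ### The `G`-Temperley-Lieb algebra -/

/-- The `G`-Temperley-Lieb `n`-diagrams, that is, the planar `G`-Brauer `n`-diagrams. They are
closed under composition. -/
def GTLDiagram (G : Type u) [CommMonoid G] (n : ℕ) : Submonoid (GBrauerDiagram G n) where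
  carrier := {x | x.IsPlanar}
  mul_mem' := GBrauerDiagram.IsPlanar.mul
  one_mem' := GBrauerDiagram.isPlanar_one

/-- The scalars arising from the loops removed in the composition of two diagrams. -/
noncomputable def loopCocycle {k G : Type u} [CommRing k] [CommGroup G] [MulSemiringAction G k]
    (n : ℕ) (δ : k) : TwoCocycle (GTLDiagram G n) k where
  toFun x y := GBrauerDiagram.loopFactor δ x.1 y.1
  one_left x := GBrauerDiagram.loopFactor_eq_one _ _ _
    (GBrauerDiagram.outer_one_left_surjective x.1)
  one_right x := GBrauerDiagram.loopFactor_eq_one _ _ _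
    (GBrauerDiagram.outer_one_right_surjective x.1)
  assoc x y z := GBrauerDiagram.loopFactor_assoc δ x.1 y.1 z.1

/-- The `G`-Temperley-Lieb algebra: formal `k`-linear combinations of `G`-Temperley-Lieb
`n`-diagrams, with the bilinear extension of composition in which every loop with label `g` is
replaced by the scalar `g • δ`. -/
abbrev GTLAlgebra (k G : Type u) [CommRing k] [CommGroup G] [MulSemiringAction G k]
    (n : ℕ) (δ : k) : Type u := TwistedMonoidAlgebra (loopCocycle (G := G) n δ)

open Classical in
/-- The action of the `G`-Temperley-Lieb algebra on its trivial module: a diagram with no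
left-to-left and no right-to-right connections acts as `1`, every other diagram acts as `0`. -/
noncomputable def gtlAugmentation (k G : Type u) [CommRing k] [CommGroup G]
    [MulSemiringAction G k] (n : ℕ) (δ : k) : GTLAlgebra k G n δ →ₐ[k] k :=
  TwistedMonoidAlgebra.liftToBase _ (fun x => if x.1.AllThrough then 1 else 0)
    (if_pos GBrauerDiagram.allThrough_one) (fun x y => by
      by_cases h : (x * y).1.AllThrough
      · obtain ⟨hx, hy⟩ := GBrauerDiagram.AllThrough.of_mul h
        rw [if_pos h, if_pos hx, if_pos hy]
        simp only [mul_one]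
        exact GBrauerDiagram.loopFactor_eq_one _ _ _ (hx.surjective_outer hy)
      · rw [if_neg h, mul_zero]
        by_cases hx : x.1.AllThrough
        · by_cases hy : y.1.AllThrough
          · exact absurd (hx.mul hy) h
          · rw [if_neg hy, mul_zero]
        · rw [if_neg hx, zero_mul])

/-- The action of the group algebra on its trivial module: every group element acts as `1`. -/
noncomputable def groupAugmentation (k H : Type u) [CommRing k] [Group H] :
    MonoidAlgebra k H →ₐ[k] k := MonoidAlgebra.lift k k H 1

/-! ### Tor over a noncommutative algebra -/

/-- The ground ring `k`, as a left and right module over a `k`-algebra `A` that acts through a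
homomorphism `ε : A → k`. -/
def TrivialModule {k A : Type u} [CommRing k] [Ring A] [Algebra k A] (_ε : A →ₐ[k] k) : Type u := k

namespace TrivialModule

variable {k A : Type u} [CommRing k] [Ring A] [Algebra k A] (ε : A →ₐ[k] k)

instance : AddCommGroup (TrivialModule ε) := inferInstanceAs (AddCommGroup k)

instance : Module k (TrivialModule ε) := inferInstanceAs (Module k k)

instance : Module A (TrivialModule ε) := Module.compHom k ε.toRingHom

instance : Module Aᵐᵒᵖ (TrivialModule ε) :=
  Module.compHom k (ε.toRingHom.fromOpposite fun _ _ => Commute.all _ _)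

instance : IsScalarTower k Aᵐᵒᵖ (TrivialModule ε) where
  smul_assoc r a := fun (m : k) => by
    show (ε (MulOpposite.unop (r • a)) * m : k) = r * (ε (MulOpposite.unop a) * m)
    rw [MulOpposite.unop_smul, map_smul, smul_eq_mul, mul_assoc]

end TrivialModule

section Tor

variable (k A : Type u) [CommRing k] [Ring A] [Algebra k A]

/-- The relations `m a ⊗ n = m ⊗ a n` which turn `M ⊗[k] N` into `M ⊗[A] N`. -/
def balancedRelations (M N : Type u) [AddCommGroup M] [Module k M] [Module Aᵐᵒᵖ M]
    [AddCommGroup N] [Module k N] [Module A N] : Submodule k (M ⊗[k] N) :=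
  Submodule.span k {t | ∃ (m : M) (a : A) (n : N),
    t = (MulOpposite.op a • m) ⊗ₜ[k] n - m ⊗ₜ[k] (a • n)}

/-- The functor `N ↦ M ⊗[A] N` from left `A`-modules to `k`-modules, for a right `A`-module `M`. -/
noncomputable def tensorFunctor (M : Type u) [AddCommGroup M] [Module k M] [Module Aᵐᵒᵖ M]
    [IsScalarTower k Aᵐᵒᵖ M] : ModuleCat.{u} A ⥤ ModuleCat.{u} k where
  obj N :=
    letI : Module k N := Module.compHom N (algebraMap k A)
    ModuleCat.of k ((M ⊗[k] N) ⧸ balancedRelations k A M N)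
  map {N N'} f :=
    letI : Module k N := Module.compHom N (algebraMap k A)
    letI : Module k N' := Module.compHom N' (algebraMap k A)
    letI φ : N →ₗ[k] N' :=
      { toFun := f.hom
        map_add' := map_add f.hom
        map_smul' := fun r n => map_smul f.hom (algebraMap k A r) n }
    ModuleCat.ofHom (Submodule.mapQ _ _ (LinearMap.lTensor M φ) (by
      rw [balancedRelations, Submodule.span_le]
      rintro _ ⟨m, a, n, rfl⟩
      refine Submodule.subset_span ⟨m, a, f.hom n, ?_⟩
      rw [map_sub, LinearMap.lTensor_tmul, LinearMap.lTensor_tmul]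
      exact congrArg (fun t => _ - m ⊗ₜ[k] t) (map_smul f.hom a n)))
  map_id N := by
    let : Module k N := Module.compHom N (algebraMap k A)
    refine ModuleCat.hom_ext (Submodule.linearMap_qext _ (TensorProduct.ext' fun m n => ?_))
    rfl
  map_comp {N₁ N₂ N₃} f g := by
    let : Module k N₁ := Module.compHom N₁ (algebraMap k A)
    refine ModuleCat.hom_ext (Submodule.linearMap_qext _ (TensorProduct.ext' fun m n => ?_))
    rfl

instance (M : Type u) [AddCommGroup M] [Module k M] [Module Aᵐᵒᵖ M] [IsScalarTower k Aᵐᵒᵖ M] :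
    (tensorFunctor k A M).Additive where
  map_add {N₁ N₂ f g} := by
    let : Module k N₁ := Module.compHom N₁ (algebraMap k A)
    let : Module k N₂ := Module.compHom N₂ (algebraMap k A)
    refine ModuleCat.hom_ext (Submodule.linearMap_qext _ (TensorProduct.ext' fun m n => ?_))
    exact congrArg (Submodule.Quotient.mk (p := balancedRelations k A M N₂))
      (TensorProduct.tmul_add m (f.hom n) (g.hom n))

/-- `Tor` over `A` in degree `i` of a right module `M` and a left module `N`: the `i`-th left
derived functor of `M ⊗[A] -`, evaluated at `N`. -/
noncomputable def torModule (M N : Type u) [AddCommGroup M] [Module k M] [Module Aᵐᵒᵖ M]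
    [IsScalarTower k Aᵐᵒᵖ M] [AddCommGroup N] [Module A N] (i : ℕ) : ModuleCat.{u} k :=
  ((tensorFunctor k A M).leftDerived i).obj (ModuleCat.of A N)

end Tor

/-- The homology of an augmented algebra: `Tor` of the trivial right module and the trivial left
module. -/
noncomputable abbrev trivialTor {k A : Type u} [CommRing k] [Ring A] [Algebra k A]
    (ε : A →ₐ[k] k) (i : ℕ) : ModuleCat.{u} k :=
  torModule k A (TrivialModule ε) (TrivialModule ε) i

/-! Write A for the Temperley-Lieb algebra and I for the span of the diagrams with a left-to-left
edge (a "cup"). Cups on the left and on the right are equally many, and multiplication on either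
side never destroys those on the outer column, so I is a two-sided ideal. By planarity a diagram
without cups consists of labelled horizontal edges. Hence A is the direct sum of I and a copy of
k[G^n], A/I is k[G^n], and both trivial modules correspond under A → A/I.

It remains to see that passing to A/I does not change `Tor`. Take a projective resolution P of 𝟙
over A. If the complex I P is acyclic, then P/IP is a projective resolution of 𝟙 over A/I, and 𝟙
⊗[A] P = 𝟙 ⊗[A/I] P/IP, so both `Tor`s are the homology of the same complex
(`SplitSurjection.trivialTorIso`).

For the acyclicity, filter I by the number of nodes on left cups: I_m is spanned by the diagrams
with at least m such nodes. Given a pattern of labelled left cups, let s be the diagram with these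
cups on the left, their mirror images labelled 1 on the right, and horizontal edges labelled 1. Then
s y = y up to loops for every y whose left cups include the pattern. The loops contribute factors g
δ, which are units, so a rescaling of s is an idempotent e_s (`LeftExtends.proj_mul`,
`LeftProjections.idem_mul_of`). Modulo I_{m+1}, the ideal I_m is the direct sum of the right ideals
e_s A, one for each pattern on m nodes (`LeftProjections.idempotentLayer`); there may be infinitely
many patterns, as G may be infinite.

Such a decomposition passes acyclicity from I_{m+1} P to I_m P (`IdempotentLayer.isSMulAcyclic`): a
cycle is a sum of elements e_s p_s modulo I_{m+1} P, and each e_s p_s can be corrected inside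
I_{m+1} P to a cycle of P, which bounds because P is exact. Multiplying the bounding chain by e_s
puts it into I_m P. Descending induction on m, starting from I_m = 0 for m > n, reaches I = I_1. -/

/-! ### Layers of idempotents and acyclicity -/

/-- Modulo `J`, the ideal `F` is the direct sum of the right ideals generated by the idempotents
`e s`. -/
structure IdempotentLayer {A ι : Type*} [Ring A] (F J : Ideal A) (e : ι → A) : Prop where
  le : J ≤ F
  idem : ∀ s, e s * e s = e s
  mem : ∀ s, e s ∈ F
  span : ∀ f ∈ F, ∃ a : ι →₀ A, f - a.sum (fun s x => e s * x) ∈ J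
  indep : ∀ a : ι →₀ A, a.sum (fun s x => e s * x) ∈ J → ∀ s, e s * a s ∈ J

/-- Two-sidedness is essential: a coordinate of `r • m` is `r * m x`, with the element of `J` on the
left. -/
theorem Ideal.apply_mem_of_mem_smul_top {A X : Type*} [Ring A] (J : Ideal A) [J.IsTwoSided]
    {z : X →₀ A} (hz : z ∈ J • (⊤ : Submodule A (X →₀ A))) (x : X) : z x ∈ J := by
  induction hz using Submodule.smul_induction_on' with
  | smul r hr m _ => exact J.mul_mem_right _ hr
  | add a _ b _ ha hb => exact J.add_mem ha hb

theorem Ideal.mem_smul_top_of_apply_mem {A X : Type*} [Ring A] (J : Ideal A)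
    {z : X →₀ A} (hz : ∀ x, z x ∈ J) : z ∈ J • (⊤ : Submodule A (X →₀ A)) := by
  rw [← Finsupp.sum_single z]
  refine Submodule.sum_mem _ fun x _ => ?_
  rw [← mul_one (z x), ← smul_eq_mul, ← Finsupp.smul_single]
  exact Submodule.smul_mem_smul (hz x) trivial

theorem LinearMap.map_mem_smul_top {A P Q : Type*} [Ring A] [AddCommGroup P] [Module A P]
    [AddCommGroup Q] [Module A Q] (J : Ideal A) (f : P →ₗ[A] Q) {x : P}
    (hx : x ∈ J • (⊤ : Submodule A P)) : f x ∈ J • (⊤ : Submodule A Q) := by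
  have h := Submodule.mem_map_of_mem (f := f) hx
  rw [Submodule.map_smul''] at h
  exact Submodule.smul_mono le_rfl le_top h

namespace IdempotentLayer

variable {A ι : Type*} [Ring A] {F J : Ideal A} {e : ι → A}
  {P : Type*} [AddCommGroup P] [Module A P]

/-- If f is congruent to the sum of the e_s a_s modulo J, then f m is congruent to the sum of the
e_s (a_s m) modulo J P. -/
theorem exists_sum (h : IdempotentLayer F J e) {x : P} (hx : x ∈ F • (⊤ : Submodule A P)) :
    ∃ p : ι →₀ P, x - p.sum (fun s y => e s • y) ∈ J • (⊤ : Submodule A P) := by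
  induction hx using Submodule.smul_induction_on' with
  | smul f hf m _ =>
    obtain ⟨a, ha⟩ := h.span f hf
    refine ⟨a.mapRange (fun r => r • m) (zero_smul A m), ?_⟩
    rw [Finsupp.sum_mapRange_index (fun s => smul_zero _)]
    simp only [Finsupp.sum, ← mul_smul, ← Finset.sum_smul, ← sub_smul]
    exact Submodule.smul_mem_smul ha trivial
  | add x _ y _ hx hy =>
    classical
    obtain ⟨p, hp⟩ := hx
    obtain ⟨q, hq⟩ := hy
    refine ⟨p + q, ?_⟩
    rw [Finsupp.sum_add_index' (fun s => smul_zero _) (fun s => smul_add _), add_sub_add_comm]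
    exact Submodule.add_mem _ hp hq

/-- In a free module this is `indep` in each coordinate. A projective module is a retract of a free
one, and linear maps preserve multiples of J. -/
theorem smul_mem_of_sum_mem [J.IsTwoSided] [Module.Projective A P]
    (h : IdempotentLayer F J e) (p : ι →₀ P)
    (hp : p.sum (fun s y => e s • y) ∈ J • (⊤ : Submodule A P)) (s : ι) :
    e s • p s ∈ J • (⊤ : Submodule A P) := by
  obtain ⟨σ, hσ⟩ := Module.projective_def'.1 ‹Module.Projective A P›
  have key : σ (e s • p s) ∈ J • (⊤ : Submodule A (P →₀ A)) := by
    refine J.mem_smul_top_of_apply_mem fun x => ?_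
    have h1 := J.apply_mem_of_mem_smul_top (σ.map_mem_smul_top J hp) x
    have h2 := h.indep (p.mapRange (fun y => σ y x) (by simp)) (by
      rw [Finsupp.sum_mapRange_index (fun s => mul_zero _)]
      simpa [Finsupp.sum, map_sum, Finsupp.finsetSum_apply] using h1) s
    simpa using h2
  have := LinearMap.map_mem_smul_top J (Finsupp.linearCombination A id) key
  rwa [← LinearMap.comp_apply, hσ] at this

end IdempotentLayer

/-- A sequence of modules `⋯ → P 1 → P 0`, with an augmentation `P 0 → N`, which is exact. -/
structure IsAugmentedExact {A N : Type*} [Ring A] [AddCommGroup N] [Module A N] (P : ℕ → Type*)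
    [∀ i, AddCommGroup (P i)] [∀ i, Module A (P i)] (d : ∀ i, P (i + 1) →ₗ[A] P i)
    (aug : P 0 →ₗ[A] N) : Prop where
  d_d : ∀ i x, d i (d (i + 1) x) = 0
  aug_d : ∀ x, aug (d 0 x) = 0
  exact_zero : ∀ x, aug x = 0 → ∃ y, d 0 y = x
  exact_succ : ∀ i x, d i x = 0 → ∃ y, d (i + 1) y = x

/-- Multiplying the sequence by `F` gives an exact sequence that ends in zero. -/
structure IsSMulAcyclic {A : Type*} [Ring A] (F : Ideal A) (P : ℕ → Type*)
    [∀ i, AddCommGroup (P i)] [∀ i, Module A (P i)] (d : ∀ i, P (i + 1) →ₗ[A] P i) : Prop where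
  zero : ∀ x ∈ F • (⊤ : Submodule A (P 0)), ∃ y ∈ F • (⊤ : Submodule A (P 1)), d 0 y = x
  succ : ∀ i, ∀ x ∈ F • (⊤ : Submodule A (P (i + 1))), d i x = 0 →
    ∃ y ∈ F • (⊤ : Submodule A (P (i + 2))), d (i + 1) y = x

theorem isSMulAcyclic_bot {A : Type*} [Ring A] (P : ℕ → Type*)
    [∀ i, AddCommGroup (P i)] [∀ i, Module A (P i)] (d : ∀ i, P (i + 1) →ₗ[A] P i) :
    IsSMulAcyclic ⊥ P d where
  zero x hx := ⟨0, Submodule.zero_mem _, by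
    rw [Submodule.bot_smul, Submodule.mem_bot] at hx
    rw [hx, map_zero]⟩
  succ i x hx _ := ⟨0, Submodule.zero_mem _, by
    rw [Submodule.bot_smul, Submodule.mem_bot] at hx
    rw [hx, map_zero]⟩

theorem IdempotentLayer.isSMulAcyclic {A N ι : Type*} [Ring A] [AddCommGroup N] [Module A N]
    {F J : Ideal A} [J.IsTwoSided] {e : ι → A} (h : IdempotentLayer F J e)
    {P : ℕ → Type*} [∀ i, AddCommGroup (P i)] [∀ i, Module A (P i)]
    [∀ i, Module.Projective A (P i)] {d : ∀ i, P (i + 1) →ₗ[A] P i} {aug : P 0 →ₗ[A] N}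
    (hP : IsAugmentedExact P d aug) (hN : ∀ f ∈ F, ∀ m : N, f • m = 0)
    (hJ : IsSMulAcyclic J P d) : IsSMulAcyclic F P d where
  zero x hx := by
    obtain ⟨p, hp⟩ := h.exists_sum hx
    -- `F` annihilates `N`, so `e s • p s` lies in the kernel of the augmentation.
    have lift : ∀ s, ∃ y, d 0 y = e s • p s := fun s =>
      hP.exact_zero _ (by rw [map_smul, hN _ (h.mem s)])
    choose y hy using lift
    obtain ⟨v, hv, hdv⟩ := hJ.zero _ hp
    -- The lift `y s` need not lie in F P. Replacing it by `e s • y s` achieves this and keeps the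
    -- boundary, since `e s` is idempotent.
    refine ⟨p.sum (fun s _ => e s • y s) + v, Submodule.add_mem _ (Submodule.sum_mem _ fun s _ =>
      Submodule.smul_mem_smul (h.mem s) trivial) (Submodule.smul_mono_left h.le hv), ?_⟩
    simp only [Finsupp.sum, map_add, map_sum, map_smul, hdv, hy, ← mul_smul, h.idem]
    abel
  succ i x hx hdx := by
    obtain ⟨p, hp⟩ := h.exists_sum hx
    -- The differential of the congruence `hp` says that the sum of these elements lies in J P;
    -- independence of the layer separates the summands.
    have hd : ∀ s, e s • d i (p s) ∈ J • (⊤ : Submodule A (P i)) := by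
      have h1 := (d i).map_mem_smul_top J hp
      rw [map_sub, hdx, zero_sub, Submodule.neg_mem_iff] at h1
      intro s
      refine h.smul_mem_of_sum_mem (p.mapRange (d i) (map_zero _)) ?_ s
      rw [Finsupp.sum_mapRange_index (fun s => smul_zero _)]
      simpa [Finsupp.sum, map_sum] using h1
    have hw : ∀ s, ∃ w ∈ J • (⊤ : Submodule A (P (i + 1))), d i w = e s • d i (p s) := by
      intro s
      -- In degree zero no cycle condition is needed, because acyclicity of J P includes
      -- surjectivity onto degree zero.
      cases i with
      | zero => exact hJ.zero _ (hd s)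
      | succ i => exact hJ.succ i _ (hd s) (by rw [map_smul, hP.d_d, smul_zero])
    choose w hwJ hw using hw
    -- The corrected element is a cycle of P. The factor `e s` in front of `w s` makes it a multiple
    -- of `e s`, so that `e s • y s` has the same boundary as `y s`.
    have lift : ∀ s, ∃ y, d (i + 1) y = e s • p s - e s • w s := fun s =>
      hP.exact_succ i _ (by
        rw [map_sub, map_smul, map_smul, hw, ← mul_smul, h.idem, sub_self])
    choose y hy using lift
    -- What is left of `x` after removing the corrected cycles is a cycle in J P, to which the
    -- acyclicity of J P applies.
    have hz : x - p.sum (fun s q => e s • q) + p.sum (fun s _ => e s • w s) ∈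
        J • (⊤ : Submodule A (P (i + 1))) :=
      Submodule.add_mem _ hp (Submodule.sum_mem _ fun s _ => Submodule.smul_mem _ _ (hwJ s))
    obtain ⟨v, hv, hdv⟩ := hJ.succ i _ hz (by
      simp only [Finsupp.sum, map_add, map_sub, map_sum, map_smul, hdx, hw, ← mul_smul, h.idem]
      abel)
    refine ⟨p.sum (fun s _ => e s • y s) + v, Submodule.add_mem _ (Submodule.sum_mem _ fun s _ =>
      Submodule.smul_mem_smul (h.mem s) trivial) (Submodule.smul_mono_left h.le hv), ?_⟩
    simp only [Finsupp.sum, map_add, map_sum, map_smul, hdv, hy, smul_sub, ← mul_smul, h.idem,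
      Finset.sum_sub_distrib]
    abel

/-! ### Monoids in which every element has an idempotent left unit -/

/-- A monoid graded by a bounded height function, in which the elements fixed on the left by the
idempotent `proj x` and of the same height as `x` form a class. -/
structure LeftProjections (M : Type*) [Monoid M] where
  height : M → ℕ
  bound : ℕ
  height_le : ∀ x, height x ≤ bound
  le_height_mul_left : ∀ x y, height x ≤ height (x * y)
  le_height_mul_right : ∀ x y, height y ≤ height (x * y)
  proj : M → M
  proj_mul_self : ∀ x, proj x * x = x
  proj_proj : ∀ x, proj (proj x) = proj x
  height_proj : ∀ x, height (proj x) = height x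
  proj_eq : ∀ x y, proj x * y = y → height x = height y → proj x = proj y

namespace LeftProjections

open TwistedMonoidAlgebra

variable {M k : Type*} [Monoid M] [CommRing k] (L : LeftProjections M) (c : TwoCocycle M k)

theorem proj_mul_proj (x : M) : L.proj x * L.proj x = L.proj x := by
  have := L.proj_mul_self (L.proj x)
  rwa [L.proj_proj] at this

/-- The cocycle identity for (u, u, y) reads c(u,u) c(u,y) = c(u,y) c(u,y), and c(u,y) can be
cancelled. -/
theorem _root_.TwoCocycle.eq_of_mul_eq {c : TwoCocycle M k} {u y : M} (hu : u * u = u)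
    (hy : u * y = y) (hc : IsUnit (c.toFun u y)) : c.toFun u y = c.toFun u u := by
  have := c.assoc u u y
  rw [hu, hy] at this
  exact (hc.mul_right_cancel this).symm

variable {c} in
theorem _root_.TwistedMonoidAlgebra.induction {p : TwistedMonoidAlgebra c → Prop}
    (a : TwistedMonoidAlgebra c) (h0 : p 0) (hadd : ∀ a b, p a → p b → p (a + b))
    (hof : ∀ (r : k) (x : M), p (r • of c x)) :
    p a := by
  refine Finsupp.induction_linear (motive := p) a h0 hadd fun x r => ?_
  have h : (Finsupp.single x r : M →₀ k) = r • Finsupp.single x 1 := by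
    rw [Finsupp.smul_single, smul_eq_mul, mul_one]
  rw [h]
  exact hof r x

/-- The span of the basis elements of height at least `m`, as a submodule. -/
noncomputable def heightSubmodule (m : ℕ) : Submodule k (TwistedMonoidAlgebra c) :=
  Submodule.span k {a | ∃ x, m ≤ L.height x ∧ a = of c x}

theorem of_mem {m : ℕ} {x : M} (hx : m ≤ L.height x) : of c x ∈ L.heightSubmodule c m :=
  Submodule.subset_span ⟨x, hx, rfl⟩

theorem mul_mem_heightSubmodule (m : ℕ) (a : TwistedMonoidAlgebra c) {b : TwistedMonoidAlgebra c}
    (hb : b ∈ L.heightSubmodule c m) :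
    a * b ∈ L.heightSubmodule c m ∧ b * a ∈ L.heightSubmodule c m := by
  induction hb using Submodule.span_induction with
  | mem b hb =>
    obtain ⟨y, hy, rfl⟩ := hb
    induction a using TwistedMonoidAlgebra.induction with
    | h0 => simp
    | hadd a b ha hb =>
      rw [add_mul, mul_add]
      exact ⟨Submodule.add_mem _ ha.1 hb.1, Submodule.add_mem _ ha.2 hb.2⟩
    | hof r x =>
      rw [smul_mul_assoc, mul_smul_comm, of_mul_of, of_mul_of]
      exact ⟨Submodule.smul_mem _ _ (Submodule.smul_mem _ _ (L.of_mem c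
        (hy.trans (L.le_height_mul_right x y)))), Submodule.smul_mem _ _ (Submodule.smul_mem _ _
        (L.of_mem c (hy.trans (L.le_height_mul_left y x))))⟩
  | zero => simp
  | add x y _ _ hx hy =>
    rw [add_mul, mul_add]
    exact ⟨Submodule.add_mem _ hx.1 hy.1, Submodule.add_mem _ hx.2 hy.2⟩
  | smul r x _ hx =>
    rw [smul_mul_assoc, mul_smul_comm]
    exact ⟨Submodule.smul_mem _ _ hx.1, Submodule.smul_mem _ _ hx.2⟩

/-- The span of the basis elements of height at least `m`, as a two-sided ideal. -/
noncomputable def heightIdeal (m : ℕ) : Ideal (TwistedMonoidAlgebra c) where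
  carrier := L.heightSubmodule c m
  add_mem' := Submodule.add_mem _
  zero_mem' := Submodule.zero_mem _
  smul_mem' a _ hb := (L.mul_mem_heightSubmodule c m a hb).1

instance (m : ℕ) : (L.heightIdeal c m).IsTwoSided :=
  ⟨fun a hb => (L.mul_mem_heightSubmodule c m a hb).2⟩

theorem mem_heightIdeal {m : ℕ} {a : TwistedMonoidAlgebra c} :
    a ∈ L.heightIdeal c m ↔ a ∈ L.heightSubmodule c m := Iff.rfl

theorem heightIdeal_eq_bot {m : ℕ} (hm : L.bound < m) : L.heightIdeal c m = ⊥ := by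
  refine (Submodule.eq_bot_iff _).2 fun a ha => ?_
  rw [mem_heightIdeal, heightSubmodule] at ha
  have : {a | ∃ x, m ≤ L.height x ∧ a = of c x} = ∅ := by
    ext a
    simp only [Set.mem_ofPred_eq, Set.mem_empty_iff_false, iff_false, not_exists, not_and]
    intro x hx
    have := L.height_le x
    omega
  rwa [this, Submodule.span_empty, Submodule.mem_bot] at ha

/-- The idempotents of height `m`. -/
abbrev Layer (m : ℕ) : Type _ := {s : M // L.proj s = s ∧ L.height s = m}

variable (hc : ∀ x y, IsUnit (c.toFun x y))

/-- The idempotent of the algebra given by an idempotent of the monoid. -/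
noncomputable def idem (s : M) : TwistedMonoidAlgebra c := (↑(hc s s).unit⁻¹ : k) • of c s

/-- The rescaling that makes `s` idempotent depends on c(s,s) only, but it serves every `y` fixed by
`s`, because c(s,y) = c(s,s). -/
theorem idem_mul_of {s y : M} (hs : s * s = s) (hy : s * y = y) :
    idem c hc s * of c y = of c y := by
  rw [idem, smul_mul_assoc, of_mul_of, hy, TwoCocycle.eq_of_mul_eq hs hy (hc s y), smul_smul,
    IsUnit.val_inv_mul, one_smul]

/-- The projection to the span of the class of `s`. -/
noncomputable def classProj (s : M) : TwistedMonoidAlgebra c →ₗ[k] TwistedMonoidAlgebra c := by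
  classical exact linearLift c fun y => if L.proj y = s then of c y else 0

theorem classProj_eq_zero {s : M} {m : ℕ} (hs : L.height s < m) {a : TwistedMonoidAlgebra c}
    (ha : a ∈ L.heightSubmodule c m) : L.classProj c s a = 0 := by
  classical
  induction ha using Submodule.span_induction with
  | mem b hb =>
    obtain ⟨y, hy, rfl⟩ := hb
    rw [classProj, linearLift_of, if_neg]
    rintro rfl
    rw [L.height_proj] at hs
    omega
  | zero => exact map_zero _
  | add x y _ _ hx hy => rw [map_add, hx, hy, add_zero]
  | smul r x _ hx => rw [map_smul, hx, smul_zero]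

/-- A product s x is fixed by s on the left. If its class were t, it would have the height of s, and
`proj_eq` would force its class to be s. -/
theorem classProj_idem_mul {s t : M} (hs : L.proj s = s)
    (h : L.height s = L.height t) (hst : s ≠ t) (a : TwistedMonoidAlgebra c) :
    L.classProj c t (idem c hc s * a) = 0 := by
  classical
  induction a using TwistedMonoidAlgebra.induction with
  | h0 => rw [mul_zero, map_zero]
  | hadd a b ha hb => rw [mul_add, map_add, ha, hb, add_zero]
  | hof r x =>
    rw [idem, mul_smul_comm, smul_mul_assoc, of_mul_of, map_smul, map_smul, map_smul, classProj,
      linearLift_of, if_neg, smul_zero, smul_zero, smul_zero]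
    intro hx
    refine hst ?_
    rw [← hs, ← hx]
    have hss : s * s = s := by rw [← hs, L.proj_mul_proj]
    refine L.proj_eq _ _ ?_ ?_
    · rw [hs, ← mul_assoc, hss]
    · rw [h, ← hx, L.height_proj]

/-- A product s x either keeps the height of s, and then belongs to the class of s by `proj_eq`, or
has greater height. -/
theorem idem_mul_sub_classProj {s : M} (hs : L.proj s = s) (a : TwistedMonoidAlgebra c) :
    idem c hc s * a - L.classProj c s (idem c hc s * a) ∈
      L.heightSubmodule c (L.height s + 1) := by
  classical
  induction a using TwistedMonoidAlgebra.induction with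
  | h0 => rw [mul_zero, map_zero, sub_zero]; exact Submodule.zero_mem _
  | hadd a b ha hb =>
    rw [mul_add, map_add, add_sub_add_comm]
    exact Submodule.add_mem _ ha hb
  | hof r x =>
    rw [idem, mul_smul_comm, smul_mul_assoc, of_mul_of, map_smul, map_smul, map_smul, classProj,
      linearLift_of, ← smul_sub, ← smul_sub, ← smul_sub]
    refine Submodule.smul_mem _ _ (Submodule.smul_mem _ _ (Submodule.smul_mem _ _ ?_))
    split_ifs with hx
    · rw [sub_self]; exact Submodule.zero_mem _
    · rw [sub_zero]
      refine L.of_mem c ((L.le_height_mul_left s x).lt_of_ne fun h => hx ?_)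
      have hss : s * s = s := by rw [← hs, L.proj_mul_proj]
      refine ((L.proj_eq s (s * x) ?_ h).symm.trans hs)
      rw [hs, ← mul_assoc, hss]

/-- The elements of height m are partitioned into classes by `proj`. Modulo greater height, e_s A is
the span of the class of s, so the sum of these right ideals is direct and exhausts the layer. -/
theorem idempotentLayer (m : ℕ) : IdempotentLayer (L.heightIdeal c m) (L.heightIdeal c (m + 1))
    (fun s : L.Layer m => idem c hc s.1) where
  le := Submodule.span_mono (by rintro _ ⟨x, hx, rfl⟩; exact ⟨x, by omega, rfl⟩)
  idem s := by
    have hss : s.1 * s.1 = s.1 := by rw [← s.2.1, L.proj_mul_proj]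
    conv_lhs => rw [idem.eq_def c hc s.1]
    rw [mul_smul_comm, ← idem.eq_def, idem_mul_of c hc hss hss]
    rfl
  mem s := Submodule.smul_mem _ _ (L.of_mem c s.2.2.ge)
  span f hf := by
    classical
    rw [mem_heightIdeal] at hf
    simp only [mem_heightIdeal]
    induction hf using Submodule.span_induction with
    | mem b hb =>
      obtain ⟨y, hy, rfl⟩ := hb
      -- A basis element of height exactly m is recovered from its own class as e_{proj y} y; a
      -- higher one is already zero modulo the smaller ideal.
      rcases hy.eq_or_lt with h | h
      · refine ⟨Finsupp.single ⟨L.proj y, L.proj_proj y, by rw [L.height_proj, h]⟩ (of c y), ?_⟩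
        rw [Finsupp.sum_single_index (mul_zero _), idem_mul_of c hc (L.proj_mul_proj y)
          (L.proj_mul_self y), sub_self]
        exact Submodule.zero_mem _
      · exact ⟨0, by rw [Finsupp.sum_zero_index, sub_zero]; exact L.of_mem c h⟩
    | zero => exact ⟨0, by rw [Finsupp.sum_zero_index, sub_zero]; exact Submodule.zero_mem _⟩
    | add x y _ _ hx hy =>
      obtain ⟨a, ha⟩ := hx
      obtain ⟨b, hb⟩ := hy
      refine ⟨a + b, ?_⟩
      rw [Finsupp.sum_add_index' (fun s => mul_zero _) (fun s => mul_add _), add_sub_add_comm]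
      exact Submodule.add_mem _ ha hb
    | smul r x _ hx =>
      obtain ⟨a, ha⟩ := hx
      refine ⟨r • a, ?_⟩
      rw [Finsupp.sum_smul_index' (fun s => mul_zero _)]
      simp only [Finsupp.sum, mul_smul_comm, ← Finset.smul_sum, ← smul_sub] at ha ⊢
      exact Submodule.smul_mem _ _ ha
  indep a ha t := by
    classical
    rw [mem_heightIdeal] at ha ⊢
    -- Projecting to the class of `t` kills the whole sum, since it has greater height, and also
    -- every summand other than the one at `t`. So the class component of that summand vanishes, and
    -- what remains has greater height.
    have h1 := L.classProj_eq_zero c (s := t.1) (by rw [t.2.2]; omega) ha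
    have h2 : L.classProj c t.1 (idem c hc t.1 * a t) = 0 := by
      rw [Finsupp.sum, map_sum, Finset.sum_eq_single t] at h1
      · exact h1
      · intro s _ hst
        exact L.classProj_idem_mul c hc s.2.1 (s.2.2.trans t.2.2.symm)
          (fun h => hst (Subtype.ext h)) _
      · intro h
        rw [Finsupp.notMem_support_iff.1 h, mul_zero, map_zero]
    have h3 := L.idem_mul_sub_classProj c hc t.2.1 (a t)
    rwa [h2, sub_zero, t.2.2] at h3

/-- Descending induction on m, with `bound + 1 - m` as induction variable: above the bound the ideal
is zero, and each layer passes acyclicity down by one step. -/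
theorem isSMulAcyclic (hc : ∀ x y, IsUnit (c.toFun x y)) {N : Type*} [AddCommGroup N]
    [Module (TwistedMonoidAlgebra c) N]
    {P : ℕ → Type*} [∀ i, AddCommGroup (P i)] [∀ i, Module (TwistedMonoidAlgebra c) (P i)]
    [∀ i, Module.Projective (TwistedMonoidAlgebra c) (P i)]
    {d : ∀ i, P (i + 1) →ₗ[TwistedMonoidAlgebra c] P i}
    {aug : P 0 →ₗ[TwistedMonoidAlgebra c] N} (hP : IsAugmentedExact P d aug) (m : ℕ)
    (hN : ∀ f ∈ L.heightIdeal c m, ∀ y : N, f • y = 0) :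
    IsSMulAcyclic (L.heightIdeal c m) P d := by
  obtain ⟨j, hj⟩ : ∃ j, L.bound + 1 - m = j := ⟨_, rfl⟩
  induction j generalizing m with
  | zero => rw [L.heightIdeal_eq_bot c (by omega)]; exact isSMulAcyclic_bot P d
  | succ j ih =>
    have h := L.idempotentLayer c hc m
    exact h.isSMulAcyclic hP hN (ih (m + 1) (fun f hf => hN f (h.le hf)) (by omega))

end LeftProjections

/-! ### The tensor product with the trivial module -/

section TrivialTensor

variable {k A : Type u} [CommRing k] [Ring A] [Algebra k A] (ε : A →ₐ[k] k)

/-- The functor `N ↦ 𝟙 ⊗[A] N`. -/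
noncomputable abbrev trivialTensor : ModuleCat.{u} A ⥤ ModuleCat.{u} k :=
  tensorFunctor k A (TrivialModule ε)

/-- The element `1` of the trivial module. -/
def TrivialModule.one : TrivialModule ε := (1 : k)

theorem TrivialModule.op_smul_one (a : A) :
    MulOpposite.op a • TrivialModule.one ε = ε a • TrivialModule.one ε := rfl

theorem TrivialModule.eq_smul_one (m : TrivialModule ε) :
    m = (show k from m) • TrivialModule.one ε := (mul_one (show k from m)).symm

/-- The map `n ↦ 1 ⊗ n`. -/
noncomputable def trivialTensorMk (N : ModuleCat.{u} A) : N →+ (trivialTensor ε).obj N :=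
  letI : Module k N := Module.compHom N (algebraMap k A)
  ((balancedRelations k A (TrivialModule ε) N).mkQ ∘ₗ
    TensorProduct.mk k (TrivialModule ε) N (TrivialModule.one ε)).toAddMonoidHom

/-- This is the balancing relation for the generator 1 of the right module, on which a acts as ε(a).
-/
theorem trivialTensorMk_smul (N : ModuleCat.{u} A) (a : A) (n : N) :
    trivialTensorMk ε N (a • n) = ε a • trivialTensorMk ε N n := by
  let : Module k N := Module.compHom N (algebraMap k A)
  have h := (Submodule.Quotient.eq (balancedRelations k A (TrivialModule ε) N)).2
    (Submodule.subset_span ⟨TrivialModule.one ε, a, n, rfl⟩)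
  rw [TrivialModule.op_smul_one, ← TensorProduct.smul_tmul'] at h
  exact h.symm

theorem trivialTensor_map_mk {N N' : ModuleCat.{u} A} (f : N ⟶ N') (n : N) :
    ((trivialTensor ε).map f).hom (trivialTensorMk ε N n) = trivialTensorMk ε N' (f.hom n) := rfl

variable {ε}

/-- The trivial module is generated over k by 1, so the tensors 1 ⊗ n generate the tensor product.
-/
theorem trivialTensor_hom_ext {N : ModuleCat.{u} A} {X : ModuleCat.{u} k}
    {f g : (trivialTensor ε).obj N ⟶ X}
    (h : ∀ n, f.hom (trivialTensorMk ε N n) = g.hom (trivialTensorMk ε N n)) : f = g := by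
  let : Module k N := Module.compHom N (algebraMap k A)
  refine ModuleCat.hom_ext (Submodule.linearMap_qext _ (TensorProduct.ext' fun m n => ?_))
  have hm : m ⊗ₜ[k] n = (show k from m) • (TrivialModule.one ε ⊗ₜ[k] n) :=
    congrArg (fun m => m ⊗ₜ[k] n) (TrivialModule.eq_smul_one ε m)
  rw [hm, map_smul, map_smul]
  exact congrArg (fun t => (show k from m) • t) (h n)

/-- A map from `N` on which `A` acts through `ε` extends to `𝟙 ⊗[A] N`. -/
noncomputable def trivialTensorDesc {N : ModuleCat.{u} A} {X : ModuleCat.{u} k} (ψ : N →+ X)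
    (h : ∀ (a : A) (n : N), ψ (a • n) = ε a • ψ n) : (trivialTensor ε).obj N ⟶ X :=
  letI : Module k N := Module.compHom N (algebraMap k A)
  letI ψk : N →ₗ[k] X :=
    { toFun := ψ
      map_add' := map_add ψ
      map_smul' := fun r n => (h (algebraMap k A r) n).trans (by rw [ε.commutes]; rfl) }
  letI β : TrivialModule ε →ₗ[k] N →ₗ[k] X :=
    LinearMap.toSpanSingleton k (N →ₗ[k] X) ψk
  ModuleCat.ofHom (Submodule.liftQ _ (TensorProduct.lift β) (by
    rw [balancedRelations, Submodule.span_le]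
    rintro _ ⟨m, a, n, rfl⟩
    refine LinearMap.mem_ker.2 ?_
    rw [map_sub, TensorProduct.lift.tmul, TensorProduct.lift.tmul, sub_eq_zero]
    show (ε a * (show k from m)) • ψ n = (show k from m) • ψ (a • n)
    rw [h, smul_smul, mul_comm]))

@[simp] theorem trivialTensorDesc_mk {N : ModuleCat.{u} A} {X : ModuleCat.{u} k} (ψ : N →+ X)
    (h : ∀ (a : A) (n : N), ψ (a • n) = ε a • ψ n) (n : N) :
    (trivialTensorDesc ψ h).hom (trivialTensorMk ε N n) = ψ n :=
  one_smul k (ψ n)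

end TrivialTensor

/-! ### Change of algebra along a split surjection -/

/-- A surjective homomorphism of algebras with a section. -/
structure SplitSurjection (k A B : Type u) [CommRing k] [Ring A] [Algebra k A] [Ring B]
    [Algebra k B] where
  hom : A →ₐ[k] B
  sec : B →ₐ[k] A
  hom_sec : ∀ b, hom (sec b) = b

namespace SplitSurjection

variable {k A B : Type u} [CommRing k] [Ring A] [Algebra k A] [Ring B] [Algebra k B]
  (S : SplitSurjection k A B)

/-- The kernel of the surjection. -/
abbrev ker : Ideal A := RingHom.ker S.hom

theorem sec_hom_sub_mem (a : A) : S.sec (S.hom a) - a ∈ S.ker := by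
  rw [RingHom.mem_ker, map_sub, S.hom_sec, sub_self]

/-- The quotient `N / I N`, where `I` is the kernel of the surjection. -/
abbrev Quo (N : Type u) [AddCommGroup N] [Module A N] : Type u :=
  N ⧸ (S.ker • (⊤ : Submodule A N))

/-- The two scalars differ by an element of the kernel I, which acts as zero on N / I N. Hence
restricting along the section gives the B-module structure induced by A → B. -/
theorem sec_hom_smul {N : Type u} [AddCommGroup N] [Module A N] (a : A) (x : S.Quo N) :
    S.sec (S.hom a) • x = a • x := by
  obtain ⟨n, rfl⟩ := Submodule.mkQ_surjective _ x
  rw [← map_smul, ← map_smul, ← sub_eq_zero, ← map_sub, ← sub_smul]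
  exact (Submodule.Quotient.mk_eq_zero _).2 (Submodule.smul_mem_smul (S.sec_hom_sub_mem a) trivial)

/-- The functor `N ↦ N / I N` from `A`-modules to `A`-modules. -/
noncomputable def quotientFunctor : ModuleCat.{u} A ⥤ ModuleCat.{u} A where
  obj N := ModuleCat.of A (S.Quo N)
  map f := ModuleCat.ofHom (Submodule.mapQ _ _ f.hom fun _ hx =>
    LinearMap.map_mem_smul_top S.ker f.hom hx)
  map_id _ := ModuleCat.hom_ext (Submodule.linearMap_qext _ rfl)
  map_comp _ _ := ModuleCat.hom_ext (Submodule.linearMap_qext _ rfl)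

instance : S.quotientFunctor.Additive where
  map_add {_ _ _ _} := ModuleCat.hom_ext (Submodule.linearMap_qext _ rfl)

/-- The functor `N ↦ N / I N` from `A`-modules to `B`-modules. -/
noncomputable def baseChange : ModuleCat.{u} A ⥤ ModuleCat.{u} B :=
  S.quotientFunctor ⋙ ModuleCat.restrictScalars S.sec.toRingHom

instance : S.baseChange.Additive := inferInstanceAs
  (S.quotientFunctor ⋙ ModuleCat.restrictScalars S.sec.toRingHom).Additive

/-- The quotient map `N → N / I N`. -/
noncomputable def baseChangeMk (N : ModuleCat.{u} A) : N →+ S.baseChange.obj N :=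
  (Submodule.mkQ (S.ker • (⊤ : Submodule A N))).toAddMonoidHom

theorem baseChangeMk_surjective (N : ModuleCat.{u} A) :
    Function.Surjective (S.baseChangeMk N) := Submodule.mkQ_surjective _

theorem baseChangeMk_eq_zero {N : ModuleCat.{u} A} {n : N} :
    S.baseChangeMk N n = 0 ↔ n ∈ S.ker • (⊤ : Submodule A N) := Submodule.Quotient.mk_eq_zero _

theorem baseChangeMk_smul (N : ModuleCat.{u} A) (a : A) (n : N) :
    S.baseChangeMk N (a • n) = S.hom a • S.baseChangeMk N n :=
  (S.sec_hom_smul a (Submodule.mkQ (S.ker • (⊤ : Submodule A N)) n)).symm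

/-- A `φ`-semilinear map from `N` to a `B`-module factors through `N / I N`. -/
noncomputable def baseChangeDesc {N : ModuleCat.{u} A} {E : Type*} [AddCommGroup E] [Module B E]
    (ψ : N →+ E) (h : ∀ (a : A) (n : N), ψ (a • n) = S.hom a • ψ n) :
    S.baseChange.obj N →ₗ[B] E where
  toFun := QuotientAddGroup.lift (S.ker • (⊤ : Submodule A N)).toAddSubgroup ψ (by
    intro x hx
    refine Submodule.smul_induction_on (p := fun x => ψ x = 0) hx ?_ ?_
    · intro a ha n _
      rw [h, (RingHom.mem_ker).1 ha, zero_smul]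
    · intro x y hx hy
      rw [map_add, hx, hy, add_zero])
  map_add' := map_add _
  map_smul' b x := by
    obtain ⟨n, rfl⟩ := S.baseChangeMk_surjective N x
    have h1 : b • S.baseChangeMk N n = S.baseChangeMk N (S.sec b • n) := by
      rw [baseChangeMk_smul, S.hom_sec]
    rw [h1]
    show ψ (S.sec b • n) = b • ψ n
    rw [h, S.hom_sec]

variable {S} in
theorem baseChange_ext {N : ModuleCat.{u} A} {E : Type*} [AddCommGroup E] [Module B E]
    {f g : S.baseChange.obj N →ₗ[B] E}
    (h : ∀ n, f (S.baseChangeMk N n) = g (S.baseChangeMk N n)) : f = g := by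
  ext x
  obtain ⟨n, rfl⟩ := S.baseChangeMk_surjective N x
  exact h n

/-- To split a B-linear surjection f onto N / I N, lift the quotient map N → N / I N through f over
A. The lift takes values in a B-module, so it kills I N and descends to a B-linear section. -/
theorem projective_baseChange (N : ModuleCat.{u} A) [Module.Projective A N] :
    Module.Projective B (S.baseChange.obj N) := by
  refine Module.Projective.of_lifting_property'' fun f hf => ?_
  let : Module A (S.baseChange.obj N →₀ B) := Module.compHom _ S.hom.toRingHom
  let : Module A (S.baseChange.obj N) := Module.compHom _ S.hom.toRingHom
  let f' : (S.baseChange.obj N →₀ B) →ₗ[A] S.baseChange.obj N :=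
    { toFun := f
      map_add' := map_add f
      map_smul' := fun a x => map_smul f (S.hom a) x }
  let q : N →ₗ[A] S.baseChange.obj N :=
    { toFun := S.baseChangeMk N
      map_add' := map_add _
      map_smul' := S.baseChangeMk_smul N }
  obtain ⟨g, hg⟩ := Module.projective_lifting_property f' q hf
  refine ⟨S.baseChangeDesc g.toAddMonoidHom fun a n => map_smul g a n, baseChange_ext fun n => ?_⟩
  exact LinearMap.congr_fun hg n

variable {εA : A →ₐ[k] k} {εB : B →ₐ[k] k} (hε : ∀ a, εB (S.hom a) = εA a)

/-- The map `𝟙 ⊗[A] N → 𝟙 ⊗[B] (N / I N)`. -/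
noncomputable def trivialTensorHom (N : ModuleCat.{u} A) :
    (trivialTensor εA).obj N ⟶ (trivialTensor εB).obj (S.baseChange.obj N) :=
  trivialTensorDesc ((trivialTensorMk εB _).comp (S.baseChangeMk N)) (fun a n => by
    simp only [AddMonoidHom.comp_apply, baseChangeMk_smul, trivialTensorMk_smul, hε])

/-- The map `𝟙 ⊗[B] (N / I N) → 𝟙 ⊗[A] N`. -/
noncomputable def trivialTensorInv (N : ModuleCat.{u} A) :
    (trivialTensor εB).obj (S.baseChange.obj N) ⟶ (trivialTensor εA).obj N :=
  letI : Module B ((trivialTensor εA).obj N) := Module.compHom _ εB.toRingHom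
  letI ψ : S.baseChange.obj N →ₗ[B] (trivialTensor εA).obj N :=
    S.baseChangeDesc (trivialTensorMk εA N) (fun a n =>
      (trivialTensorMk_smul εA N a n).trans (by rw [← hε]; rfl))
  trivialTensorDesc ψ.toAddMonoidHom (fun b x => ψ.map_smul b x)

@[simp] theorem trivialTensorHom_mk (N : ModuleCat.{u} A) (n : N) :
    (S.trivialTensorHom hε N).hom (trivialTensorMk εA N n) =
      trivialTensorMk εB _ (S.baseChangeMk N n) := trivialTensorDesc_mk _ _ n

@[simp] theorem trivialTensorInv_mk (N : ModuleCat.{u} A) (n : N) :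
    (S.trivialTensorInv hε N).hom (trivialTensorMk εB _ (S.baseChangeMk N n)) =
      trivialTensorMk εA N n := trivialTensorDesc_mk _ _ _

/-- The trivial tensor products over `A` and over `B` agree. -/
noncomputable def trivialTensorIso :
    trivialTensor εA ≅ S.baseChange ⋙ trivialTensor εB :=
  NatIso.ofComponents (fun N =>
    { hom := S.trivialTensorHom hε N
      inv := S.trivialTensorInv hε N
      hom_inv_id := trivialTensor_hom_ext fun n => by
        rw [ModuleCat.hom_comp, LinearMap.comp_apply, trivialTensorHom_mk, trivialTensorInv_mk,
          ModuleCat.hom_id, LinearMap.id_apply]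
      inv_hom_id := trivialTensor_hom_ext fun x => by
        obtain ⟨n, rfl⟩ := S.baseChangeMk_surjective N x
        exact (congrArg (S.trivialTensorHom hε N).hom (S.trivialTensorInv_mk hε N n)).trans
          (S.trivialTensorHom_mk hε N n) })
    (fun {N N'} f => trivialTensor_hom_ext fun n =>
      ((congrArg (S.trivialTensorHom hε N').hom (trivialTensor_map_mk εA f n)).trans
        (S.trivialTensorHom_mk hε N' (f.hom n))).trans
        (congrArg ((trivialTensor εB).map (S.baseChange.map f)).hom
          (S.trivialTensorHom_mk hε N n)).symm)

end SplitSurjection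

/-! ### Change of algebra for projective resolutions -/

namespace CategoryTheory.ProjectiveResolution

variable {A : Type u} [Ring A] {Z : ModuleCat.{u} A} (P : ProjectiveResolution Z)

/-- The augmentation of a projective resolution. -/
noncomputable def aug : P.complex.X 0 ⟶ Z :=
  (ChainComplex.toSingle₀Equiv P.complex Z P.π).1

theorem isAugmentedExact : IsAugmentedExact (fun i => P.complex.X i)
      (fun i => (P.complex.d (i + 1) i).hom) P.aug.hom where
  d_d i x := congrArg (fun f => f.hom x) (P.complex.d_comp_d (i + 2) (i + 1) i)
  aug_d x := congrArg (fun f => f.hom x) (ChainComplex.toSingle₀Equiv P.complex Z P.π).2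
  exact_zero := (ShortComplex.moduleCat_exact_iff _).1 P.exact₀
  exact_succ i := (ShortComplex.moduleCat_exact_iff _).1 (P.exact_succ i)

theorem aug_surjective : Function.Surjective P.aug.hom :=
  (ModuleCat.epi_iff_surjective _).1 (inferInstanceAs (Epi (P.π.f 0)))

end CategoryTheory.ProjectiveResolution

/-- In degree zero the condition is that the augmentation is a cokernel of the last differential; in
positive degrees the target is zero and exactness suffices. -/
theorem ChainComplex.quasiIso_toSingle₀ {B : Type u} [Ring B] (C : ChainComplex (ModuleCat.{u} B) ℕ)
    {Z : ModuleCat.{u} B} (f : C.X 0 ⟶ Z) (hf : C.d 1 0 ≫ f = 0)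
    (hsurj : Function.Surjective f.hom) (h0 : ∀ x, f.hom x = 0 → ∃ y, (C.d 1 0).hom y = x)
    (hs : ∀ i x, (C.d (i + 1) i).hom x = 0 → ∃ y, (C.d (i + 2) (i + 1)).hom y = x) :
    QuasiIso ((ChainComplex.toSingle₀Equiv C Z).symm ⟨f, hf⟩) := ⟨fun i => by
  cases i with
  | zero =>
    rw [ChainComplex.quasiIsoAt₀_iff,
      ShortComplex.quasiIso_iff_of_zeros' _ (C.shape _ _ (by simp)) rfl rfl]
    have h1 : ((ChainComplex.toSingle₀Equiv C Z).symm ⟨f, hf⟩).f 0 = f :=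
      ChainComplex.toSingle₀Equiv_symm_apply_f_zero f hf
    have hex : (ShortComplex.mk _ _ hf).Exact := (ShortComplex.moduleCat_exact_iff _).2 h0
    refine (ShortComplex.exact_and_epi_g_iff_of_iso (S₂ := ShortComplex.mk _ _ hf) ?_).2
      ⟨hex, (ModuleCat.epi_iff_surjective _).2 hsurj⟩
    exact ShortComplex.isoMk (Iso.refl _) (Iso.refl _) (Iso.refl _)
      ((Category.id_comp _).trans (Category.comp_id _).symm)
      ((Category.id_comp f).trans (h1.symm.trans (Category.comp_id _).symm))
  | succ i =>
    rw [quasiIsoAt_iff_exactAt']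
    · rw [HomologicalComplex.exactAt_iff' _ (i + 2) (i + 1) i (by simp) (by simp)]
      exact (ShortComplex.moduleCat_exact_iff _).2 (hs i)
    · apply ChainComplex.exactAt_succ_single_obj⟩

namespace SplitSurjection

variable {k A B : Type u} [CommRing k] [Ring A] [Algebra k A] [Ring B] [Algebra k B]
  (S : SplitSurjection k A B)

variable {N N' : Type u} [AddCommGroup N] [Module A N] [AddCommGroup N'] [Module B N']

/-- The augmentation of `P / I P`. -/
noncomputable def baseChangeAug (P : ProjectiveResolution (ModuleCat.of A N))
    (q : N →+ N') (hq : ∀ (a : A) (m : N), q (a • m) = S.hom a • q m) :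
    S.baseChange.obj (P.complex.X 0) ⟶ ModuleCat.of B N' :=
  ConcreteCategory.ofHom (C := ModuleCat.{u} B)
    (S.baseChangeDesc (q.comp P.aug.hom.toAddMonoidHom) (fun a n =>
    (congrArg q (map_smul P.aug.hom a n)).trans (hq a (P.aug.hom n))))

/-- The resolution `P / I P`, if `I P` is acyclic. -/
noncomputable def baseChangeResolution (P : ProjectiveResolution (ModuleCat.of A N))
    (hP : IsSMulAcyclic S.ker (fun i => P.complex.X i) fun i => (P.complex.d (i + 1) i).hom)
    (q : N ≃+ N') (hq : ∀ (a : A) (m : N), q (a • m) = S.hom a • q m) :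
    ProjectiveResolution (ModuleCat.of B N') where
  complex := (S.baseChange.mapHomologicalComplex _).obj P.complex
  projective i := by
    have : Module.Projective A (P.complex.X i) :=
      (IsProjective.iff_projective _).2 (P.projective i)
    have := S.projective_baseChange (P.complex.X i)
    exact (IsProjective.iff_projective (S.baseChange.obj (P.complex.X i))).1 this
  π := (ChainComplex.toSingle₀Equiv _ _).symm ⟨S.baseChangeAug P q hq, by
    refine ModuleCat.hom_ext (baseChange_ext fun n => ?_)
    exact (congrArg q (P.isAugmentedExact.aug_d n)).trans (map_zero q)⟩
  quasiIso := by
    have hE := P.isAugmentedExact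
    refine ChainComplex.quasiIso_toSingle₀ _ _ _ ?_ ?_ ?_
    · intro y
      obtain ⟨x, hx⟩ := P.aug_surjective (q.symm y)
      exact ⟨S.baseChangeMk _ x, (congrArg q hx).trans (q.apply_symm_apply y)⟩
    · intro x hx
      obtain ⟨x, rfl⟩ := S.baseChangeMk_surjective _ x
      -- Since `q` is injective, any representative of `x` already has zero augmentation, so it
      -- needs no correction.
      obtain ⟨y, rfl⟩ := hE.exact_zero x ((map_eq_zero_iff q q.injective).1 hx)
      exact ⟨S.baseChangeMk _ y, rfl⟩
    · intro i x hx
      obtain ⟨x, rfl⟩ := S.baseChangeMk_surjective (P.complex.X (i + 1)) x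
      have hx' := (S.baseChangeMk_eq_zero (N := P.complex.X i)
        (n := (P.complex.d (i + 1) i).hom x)).1 hx
      -- A cycle of P / I P has boundary in I P. Acyclicity of I P allows a change of representative
      -- by `w` in I P that makes it a cycle of P.
      obtain ⟨w, hw, hwx⟩ : ∃ w ∈ S.ker • (⊤ : Submodule A (P.complex.X (i + 1))),
          (P.complex.d (i + 1) i).hom w = (P.complex.d (i + 1) i).hom x := by
        cases i with
        | zero => exact hP.zero _ hx'
        | succ i => exact hP.succ i _ hx' (hE.d_d i x)
      obtain ⟨y, hy⟩ := hE.exact_succ i (x - w) (by rw [map_sub, hwx, sub_self])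
      refine ⟨S.baseChangeMk _ y, ?_⟩
      refine (congrArg (S.baseChangeMk (P.complex.X (i + 1))) hy).trans ?_
      rw [map_sub, S.baseChangeMk_eq_zero.2 hw, sub_zero]

/-- If `I P` is acyclic for a projective resolution `P` of the trivial module, where `I` is the
kernel of the surjection, then the trivial modules over `A` and `B` have the same `Tor`. -/
noncomputable def trivialTorIso {εA : A →ₐ[k] k} {εB : B →ₐ[k] k}
    (hε : ∀ a, εB (S.hom a) = εA a)
    (P : ProjectiveResolution (ModuleCat.of A (TrivialModule εA)))
    (hP : IsSMulAcyclic S.ker (fun i => P.complex.X i) fun i => (P.complex.d (i + 1) i).hom)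
    (i : ℕ) : trivialTor εA i ≅ trivialTor εB i :=
  -- Both `Tor`s are computed from one complex: 𝟙 ⊗[A] P is naturally 𝟙 ⊗[B] (P / I P).
  P.isoLeftDerivedObj (trivialTensor εA) i ≪≫
    (HomologicalComplex.homologyFunctor _ _ i).mapIso
      ((NatIso.mapHomologicalComplex (S.trivialTensorIso hε) _).app P.complex) ≪≫
    ((S.baseChangeResolution P hP (N' := TrivialModule εB)
      (show TrivialModule εA ≃+ TrivialModule εB from AddEquiv.refl k) (fun a (m : k) => by
      show (εA a * m : k) = εB (S.hom a) * m
      rw [hε])).isoLeftDerivedObj (trivialTensor εB) i).symm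

end SplitSurjection

/-! ### Group homology as `Tor` over the group algebra -/

section GroupHomology

variable (k H : Type u) [CommRing k] [Group H]

theorem groupAugmentation_single (g : H) (r : k) :
    groupAugmentation k H (MonoidAlgebra.single g r) = r := by
  simp [groupAugmentation]

variable {k H}

/-- The diagonal action fixes the factor 1, so 1 ⊗ g v is the translate of 1 ⊗ v by g, with the same
class in the coinvariants. -/
theorem Rep.coinvariantsTensorMk_trivial_rho (V : Rep.{u} k H) (g : H) (v : V) :
    Rep.coinvariantsTensorMk (Rep.trivial k H k) V (1 : k) (V.ρ g v) =
      Rep.coinvariantsTensorMk (Rep.trivial k H k) V (1 : k) v :=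
  Representation.Coinvariants.mk_self_apply ((Rep.trivial k H k).ρ.tprod V.ρ) g ((1 : k) ⊗ₜ[k] v)

theorem Rep.coinvariantsTensorMk_trivial_smul (V : Rep.{u} k H) (a : MonoidAlgebra k H)
    (v : V.ρ.asModule) :
    Rep.coinvariantsTensorMk (Rep.trivial k H k) V (1 : k) (V.ρ.asModuleEquiv (a • v)) =
      groupAugmentation k H a • Rep.coinvariantsTensorMk (Rep.trivial k H k) V (1 : k)
        (V.ρ.asModuleEquiv v) := by
  rw [Representation.asModuleEquiv_map_smul]
  induction a using MonoidAlgebra.induction_linear with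
  | zero => simp only [map_zero, zero_smul, LinearMap.zero_apply]
  | add a b ha hb => simp only [map_add, add_smul, LinearMap.add_apply, ha, hb]
  | single g r =>
    rw [groupAugmentation_single, Representation.asAlgebraHom_single, LinearMap.smul_apply,
      map_smul, Rep.coinvariantsTensorMk_trivial_rho]

/-- The map from the trivial tensor product to the coinvariants. -/
noncomputable def trivialTensorToCoinvariants (V : Rep.{u} k H) :
    (trivialTensor (groupAugmentation k H)).obj (Rep.toModuleMonoidAlgebra.obj V) ⟶
      ((Rep.coinvariantsTensor k H).obj (Rep.trivial k H k)).obj V :=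
  trivialTensorDesc ((Rep.coinvariantsTensorMk (Rep.trivial k H k) V (1 : k)).toAddMonoidHom.comp
    V.ρ.asModuleEquiv.toLinearMap.toAddMonoidHom) (Rep.coinvariantsTensorMk_trivial_smul V)

theorem trivialTensorToCoinvariants_mk (V : Rep.{u} k H) (v : V.ρ.asModule) :
    (trivialTensorToCoinvariants V).hom (trivialTensorMk _ (Rep.toModuleMonoidAlgebra.obj V) v) =
      Rep.coinvariantsTensorMk (Rep.trivial k H k) V (1 : k) (V.ρ.asModuleEquiv v) :=
  trivialTensorDesc_mk (N := Rep.toModuleMonoidAlgebra.obj V) _ _ v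

/-- The map `v ↦ 1 ⊗ v`, for a representation. -/
noncomputable def trivialTensorRepMk (V : Rep.{u} k H) :
    V →ₗ[k] (trivialTensor (groupAugmentation k H)).obj (Rep.toModuleMonoidAlgebra.obj V) where
  toFun v := trivialTensorMk _ (Rep.toModuleMonoidAlgebra.obj V) (V.ρ.asModuleEquiv.symm v)
  map_add' v w := by rw [map_add]; exact map_add _ _ _
  map_smul' r v := by
    rw [Representation.asModuleEquiv_symm_map_smul]
    refine (trivialTensorMk_smul _ (Rep.toModuleMonoidAlgebra.obj V) _ _).trans ?_
    rw [AlgHom.commutes]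
    rfl

theorem trivialTensorRepMk_rho (V : Rep.{u} k H) (g : H) (v : V) :
    trivialTensorRepMk V (V.ρ g v) = trivialTensorRepMk V v := by
  refine (congrArg (trivialTensorMk _ (Rep.toModuleMonoidAlgebra.obj V))
    (Representation.asModuleEquiv_symm_map_rho V.ρ g v)).trans
    ((trivialTensorMk_smul _ (Rep.toModuleMonoidAlgebra.obj V) _ _).trans ?_)
  rw [MonoidAlgebra.of_apply, groupAugmentation_single, one_smul]
  rfl

/-- The map from the coinvariants to the trivial tensor product. -/
noncomputable def trivialTensorOfCoinvariants (V : Rep.{u} k H) :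
    ((Rep.coinvariantsTensor k H).obj (Rep.trivial k H k)).obj V ⟶
      (trivialTensor (groupAugmentation k H)).obj (Rep.toModuleMonoidAlgebra.obj V) :=
  ModuleCat.ofHom (Representation.Coinvariants.lift ((Rep.trivial k H k).ρ.tprod V.ρ)
    (TensorProduct.lift (LinearMap.toSpanSingleton k _ (trivialTensorRepMk V))) (fun g =>
      TensorProduct.ext' fun (r : k) v =>
        congrArg (fun t => r • t) (trivialTensorRepMk_rho V g v)))

theorem trivialTensorOfCoinvariants_mk (V : Rep.{u} k H) (r : k) (v : V) :
    (trivialTensorOfCoinvariants V).hom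
      (Rep.coinvariantsTensorMk (Rep.trivial k H k) V r v) = r • trivialTensorRepMk V v := rfl

/-- Coinvariants are the tensor product with the trivial module. -/
noncomputable def trivialTensorCoinvariantsIso :
    Rep.toModuleMonoidAlgebra ⋙ trivialTensor (groupAugmentation k H) ≅
      (Rep.coinvariantsTensor k H).obj (Rep.trivial k H k) :=
  NatIso.ofComponents (fun V =>
    { hom := trivialTensorToCoinvariants V
      inv := trivialTensorOfCoinvariants V
      hom_inv_id := trivialTensor_hom_ext fun v =>
        ((congrArg (trivialTensorOfCoinvariants V).hom (trivialTensorToCoinvariants_mk V v)).trans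
          (trivialTensorOfCoinvariants_mk V 1 (V.ρ.asModuleEquiv v))).trans (one_smul k _)
      inv_hom_id := Rep.coinvariantsTensor_hom_ext (LinearMap.ext fun (r : k) => LinearMap.ext
        fun v => by
          refine (congrArg (trivialTensorToCoinvariants V).hom
            (trivialTensorOfCoinvariants_mk V r v)).trans ?_
          rw [map_smul]
          refine (congrArg (fun t => r • t) (trivialTensorToCoinvariants_mk V _)).trans ?_
          rw [← LinearMap.smul_apply, ← map_smul]
          exact congrArg (fun s : k => Rep.coinvariantsTensorMk (Rep.trivial k H k) V s v)
            (mul_one r)) })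
    (fun {V W} f => trivialTensor_hom_ext fun v =>
      (trivialTensorToCoinvariants_mk W (f.hom v)).trans
        (congrArg (((Rep.coinvariantsTensor k H).obj (Rep.trivial k H k)).map f).hom
          (trivialTensorToCoinvariants_mk V v)).symm)

instance : (Rep.toModuleMonoidAlgebra (k := k) (G := H)).Additive where
  map_add := rfl

theorem asAlgebraHom_trivial (a : MonoidAlgebra k H) (m : k) :
    (Rep.trivial k H k).ρ.asAlgebraHom a m = groupAugmentation k H a * m := by
  induction a using MonoidAlgebra.induction_linear with
  | zero => rw [map_zero, map_zero, zero_mul]; rfl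
  | add a b ha hb => rw [map_add, map_add, LinearMap.add_apply, ha, hb, add_mul]
  | single g r =>
    rw [groupAugmentation_single, Representation.asAlgebraHom_single]
    rfl

/-- The trivial module over the group algebra comes from the trivial representation. -/
noncomputable def trivialModuleIso :
    ModuleCat.of (MonoidAlgebra k H) (TrivialModule (groupAugmentation k H)) ≅
      Rep.toModuleMonoidAlgebra.obj (Rep.trivial k H k) :=
  LinearEquiv.toModuleIso
    { (show TrivialModule (groupAugmentation k H) ≃+ (Rep.trivial k H k).ρ.asModule from
        AddEquiv.refl k) with
      map_smul' := fun a (m : k) =>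
        (asAlgebraHom_trivial a m).symm }

/-- Group homology with trivial coefficients is the `Tor` of the trivial modules over the group
algebra. -/
noncomputable def trivialTorIsoGroupHomology (i : ℕ) :
    trivialTor (groupAugmentation k H) i ≅ groupHomology (Rep.trivial k H k) i :=
  letI := Classical.decEq H
  -- The standard resolution, viewed over the group algebra, is a projective resolution of the
  -- trivial module; tensoring it with 𝟙 gives the coinvariants complex that computes group
  -- homology.
  ((trivialTensor (groupAugmentation k H)).leftDerived i).mapIso trivialModuleIso ≪≫
    (Rep.toModuleMonoidAlgebra.mapProjectiveResolution
      (Rep.standardResolution k H)).isoLeftDerivedObj (trivialTensor (groupAugmentation k H)) i ≪≫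
    (HomologicalComplex.homologyFunctor _ _ i).mapIso
      ((NatIso.mapHomologicalComplex trivialTensorCoinvariantsIso _).app
        (Rep.standardResolution k H).complex) ≪≫
    (groupHomologyIso (Rep.trivial k H k) i (Rep.standardResolution k H)).symm

end GroupHomology

/-! ### Diagrams described by the partner of each node -/

/-- An element to which nothing is glued forms a class by itself: the predicate "equal to `b`" is
compatible with the gluing and descends to the pushout. -/
theorem Glue.eq_inl_of_mk_eq {I B E : Type*} {f : I → B} {g : I → E} {b : B} (hb : ∀ i, f i ≠ b)
    {a : B ⊕ E} (h : Glue.mk f g a = Glue.mk f g (Sum.inl b)) : a = Sum.inl b := by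
  let F : Glue f g → Prop := Glue.lift (fun b' => b' = b) (fun _ => False)
    (fun i => by simp [hb i])
  have hF : F (Glue.mk f g a) = F (Glue.mk f g (Sum.inl b)) := congrArg F h
  have h1 : F (Glue.mk f g (Sum.inl b)) := rfl
  rw [← hF] at h1
  rcases a with a | a
  · exact congrArg Sum.inl h1
  · exact h1.elim

namespace GBrauerDiagram

variable {G : Type u} {n : ℕ}

theorem rel_iff_mate (x : GBrauerDiagram G n) {v w : Fin n ⊕ Fin n} :
    x.rel v w ↔ w = v ∨ w = x.mate v := by
  constructor
  · intro h
    by_cases hw : w = v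
    · exact Or.inl hw
    · exact Or.inr (x.eq_mate hw h)
  · rintro (rfl | rfl)
    · exact x.rel.refl _
    · exact x.rel_mate v

theorem label_mate (x : GBrauerDiagram G n) (v : Fin n ⊕ Fin n) : x.label (x.mate v) = x.label v :=
  (x.label_eq _ _ (x.rel_mate v)).symm

theorem ext_mate {x y : GBrauerDiagram G n} (h : ∀ v, x.mate v = y.mate v)
    (h' : ∀ v, x.label v = y.label v) : x = y :=
  GBrauerDiagram.ext (fun v w => by rw [rel_iff_mate, rel_iff_mate, h]) h'

/-- The diagram in which `v` is joined to `m v`. -/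
def ofMate (m : Fin n ⊕ Fin n → Fin n ⊕ Fin n) (hm : ∀ v, m (m v) = v) (hne : ∀ v, m v ≠ v)
    (l : Fin n ⊕ Fin n → G) (hl : ∀ v, l (m v) = l v) : GBrauerDiagram G n where
  rel :=
    { r := fun v w => w = v ∨ w = m v
      iseqv :=
        { refl := fun _ => Or.inl rfl
          symm := by
            rintro v w (rfl | rfl)
            · exact Or.inl rfl
            · exact Or.inr (hm v).symm
          trans := by
            rintro v w t (rfl | rfl) (rfl | rfl)
            · exact Or.inl rfl
            · exact Or.inr rfl
            · exact Or.inr rfl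
            · exact Or.inl (hm v) } }
  pair v := ⟨m v, ⟨hne v, Or.inr rfl⟩, fun _ hw => hw.2.resolve_left hw.1⟩
  label := l
  label_eq := by
    rintro v w (rfl | rfl)
    · rfl
    · exact (hl v).symm

theorem mate_ofMate (m : Fin n ⊕ Fin n → Fin n ⊕ Fin n) (hm : ∀ v, m (m v) = v)
    (hne : ∀ v, m v ≠ v) (l : Fin n ⊕ Fin n → G) (hl : ∀ v, l (m v) = l v) (v : Fin n ⊕ Fin n) :
    (ofMate m hm hne l hl).mate v = m v :=
  ((ofMate m hm hne l hl).eq_mate (hne v) (Or.inr rfl)).symm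

theorem position_inl (i : Fin n) : position (Sum.inl i : Fin n ⊕ Fin n) = i := rfl

/-- The right column is traversed upwards, so positions there decrease with the index; the additive
form avoids truncated subtraction. -/
theorem position_inr (i : Fin n) : position (Sum.inr i : Fin n ⊕ Fin n) + i + 1 = 2 * n := by
  simp only [position, Sum.elim_inr, Fin.val_rev]; omega

theorem isPlanar_of_mate {x : GBrauerDiagram G n} (h : ∀ a b, position a < position b →
    position b < position (x.mate a) → position (x.mate a) < position (x.mate b) → False) :
    x.IsPlanar := by
  rintro a b c d hac hbd ⟨h1, h2, h3⟩
  rcases x.rel_iff_mate.1 hac with rfl | rfl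
  · omega
  rcases x.rel_iff_mate.1 hbd with rfl | rfl
  · omega
  exact h a b h1 h2 h3

theorem IsPlanar.mate {x : GBrauerDiagram G n} (hx : x.IsPlanar) {a b : Fin n ⊕ Fin n}
    (h1 : position a < position b) (h2 : position b < position (x.mate a))
    (h3 : position (x.mate a) < position (x.mate b)) : False :=
  hx a b _ _ (x.rel_mate a) (x.rel_mate b) ⟨h1, h2, h3⟩

theorem mate_swap (x : GBrauerDiagram G n) {v w : Fin n ⊕ Fin n} (h : x.mate v = w) :
    x.mate w = v := by rw [← h, mate_mate]

/-! ### The idempotent with prescribed left-to-left edges -/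

/-- The partner of a node in the diagram with the left-to-left edges of `x`, their mirror images,
and horizontal edges. -/
noncomputable def projMate (x : GBrauerDiagram G n) : Fin n ⊕ Fin n → Fin n ⊕ Fin n
  | Sum.inl i => Sum.elim Sum.inl (fun _ => Sum.inr i) (x.mate (Sum.inl i))
  | Sum.inr i => Sum.elim Sum.inr (fun _ => Sum.inl i) (x.mate (Sum.inl i))

theorem projMate_inl_of_inl {x : GBrauerDiagram G n} {i j : Fin n}
    (h : x.mate (Sum.inl i) = Sum.inl j) : x.projMate (Sum.inl i) = Sum.inl j := by
  simp [projMate, h]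

theorem projMate_inl_of_inr {x : GBrauerDiagram G n} {i j : Fin n}
    (h : x.mate (Sum.inl i) = Sum.inr j) : x.projMate (Sum.inl i) = Sum.inr i := by
  simp [projMate, h]

theorem projMate_inr_of_inl {x : GBrauerDiagram G n} {i j : Fin n}
    (h : x.mate (Sum.inl i) = Sum.inl j) : x.projMate (Sum.inr i) = Sum.inr j := by
  simp [projMate, h]

theorem projMate_inr_of_inr {x : GBrauerDiagram G n} {i j : Fin n}
    (h : x.mate (Sum.inl i) = Sum.inr j) : x.projMate (Sum.inr i) = Sum.inl i := by
  simp [projMate, h]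

theorem projMate_projMate (x : GBrauerDiagram G n) (v : Fin n ⊕ Fin n) :
    x.projMate (x.projMate v) = v := by
  rcases v with i | i <;> rcases h : x.mate (Sum.inl i) with j | j
  · rw [projMate_inl_of_inl h, projMate_inl_of_inl (x.mate_swap h)]
  · rw [projMate_inl_of_inr h, projMate_inr_of_inr h]
  · rw [projMate_inr_of_inl h, projMate_inr_of_inl (x.mate_swap h)]
  · rw [projMate_inr_of_inr h, projMate_inl_of_inr h]

theorem projMate_ne (x : GBrauerDiagram G n) (v : Fin n ⊕ Fin n) : x.projMate v ≠ v := by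
  have hne := fun v => x.mate_ne v
  rcases v with i | i <;> rcases h : x.mate (Sum.inl i) with j | j
  · rw [projMate_inl_of_inl h, ← h]; exact hne _
  · rw [projMate_inl_of_inr h]; simp
  · rw [projMate_inr_of_inl h]
    rintro hj
    rw [Sum.inr_injective hj] at h
    exact hne _ h
  · rw [projMate_inr_of_inr h]; simp

variable [CommMonoid G]

/-- The labels of the left-to-left edges, and `1` elsewhere. -/
noncomputable def projLabel (x : GBrauerDiagram G n) : Fin n ⊕ Fin n → G
  | Sum.inl i => Sum.elim (fun _ => x.label (Sum.inl i)) (fun _ => 1) (x.mate (Sum.inl i))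
  | Sum.inr _ => 1

theorem projLabel_inl_of_inl {x : GBrauerDiagram G n} {i j : Fin n}
    (h : x.mate (Sum.inl i) = Sum.inl j) : x.projLabel (Sum.inl i) = x.label (Sum.inl i) := by
  simp [projLabel, h]

theorem projLabel_inl_of_inr {x : GBrauerDiagram G n} {i j : Fin n}
    (h : x.mate (Sum.inl i) = Sum.inr j) : x.projLabel (Sum.inl i) = 1 := by
  simp [projLabel, h]

theorem projLabel_projMate (x : GBrauerDiagram G n) (v : Fin n ⊕ Fin n) :
    x.projLabel (x.projMate v) = x.projLabel v := by
  rcases v with i | i <;> rcases h : x.mate (Sum.inl i) with j | j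
  · rw [projMate_inl_of_inl h, projLabel_inl_of_inl h, projLabel_inl_of_inl (x.mate_swap h), ← h,
      label_mate]
  · rw [projMate_inl_of_inr h, projLabel_inl_of_inr h]; rfl
  · rw [projMate_inr_of_inl h]; rfl
  · rw [projMate_inr_of_inr h, projLabel_inl_of_inr h]; rfl

/-- The diagram with the left-to-left edges of `x`, their mirror images labelled by `1`, and
horizontal edges labelled by `1`. -/
noncomputable def proj (x : GBrauerDiagram G n) : GBrauerDiagram G n :=
  ofMate x.projMate x.projMate_projMate x.projMate_ne x.projLabel x.projLabel_projMate

theorem mate_proj (x : GBrauerDiagram G n) (v : Fin n ⊕ Fin n) : x.proj.mate v = x.projMate v :=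
  mate_ofMate ..

theorem label_proj (x : GBrauerDiagram G n) (v : Fin n ⊕ Fin n) : x.proj.label v = x.projLabel v :=
  rfl

/-- A crossing of `x.proj` comes from a crossing of `x`. Two cups on the same side would cross, up
to reflection, as left cups of `x`. A horizontal edge at k meeting a cup means that k lies between
the ends of a cup of `x` while the edge of `x` at k leads to the right column. -/
theorem IsPlanar.proj {x : GBrauerDiagram G n} (hx : x.IsPlanar) : x.proj.IsPlanar := by
  refine isPlanar_of_mate fun a b h1 h2 h3 => ?_
  rw [mate_proj] at h2 h3
  rw [mate_proj] at h3
  rcases a with i | i <;> rcases hi : x.mate (Sum.inl i) with j | j <;>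
    rcases b with k | k <;> rcases hk : x.mate (Sum.inl k) with l | l <;>
    simp only [projMate, hi, hk, Sum.elim_inl, Sum.elim_inr] at h2 h3
  all_goals
    have pi := position_inr i
    have pj := position_inr j
    have pk := position_inr k
    have pl := position_inr l
    -- The instances below cover the possible orders of the end nodes; reflected copies on the right
    -- reverse the order, which is why each end of an edge can play the first role.
    have cross : ∀ v w : Fin n ⊕ Fin n, ¬ (position v < position w ∧
        position w < position (x.mate v) ∧ position (x.mate v) < position (x.mate w)) :=
      fun _ _ h => hx.mate h.1 h.2.1 h.2.2
    have c1 := cross (Sum.inl i) (Sum.inl k)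
    have c2 := cross (Sum.inl l) (Sum.inl i)
    have c3 := cross (Sum.inl l) (Sum.inl j)
    have c4 := cross (Sum.inl j) (Sum.inl l)
    have c5 := cross (Sum.inl k) (Sum.inl i)
    have c6 := cross (Sum.inl i) (Sum.inl l)
    have c7 := cross (Sum.inl j) (Sum.inl k)
    have c8 := cross (Sum.inl k) (Sum.inl j)
    have hj := x.mate_swap hi
    have hl := x.mate_swap hk
    have := i.isLt
    have := j.isLt
    have := k.isLt
    have := l.isLt
    simp only [hi, hk, hj, hl, position_inl] at c1 c2 c3 c4 c5 c6 c7 c8 h1 h2 h3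
    omega

end GBrauerDiagram

/-! ### Cups of a diagram and their behaviour under composition -/

namespace GBrauerDiagram

variable {G : Type u} {n : ℕ}

theorem edge_inr_ne_of_mate {x : GBrauerDiagram G n} {i j : Fin n}
    (h : x.mate (Sum.inl i) = Sum.inl j) (m : Fin n) :
    x.edge (Sum.inr m) ≠ x.edge (Sum.inl i) := by
  intro hm
  rcases x.rel_iff_mate.1 (x.rel.symm (x.edge_eq_iff.1 hm)) with h' | h'
  · cases h'
  · rw [h] at h'; cases h'

theorem edge_mate (x : GBrauerDiagram G n) (v : Fin n ⊕ Fin n) : x.edge (x.mate v) = x.edge v :=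
  x.edge_eq_iff.2 (x.rel.symm (x.rel_mate v))

theorem edge_eq_of_mate {x : GBrauerDiagram G n} {v w : Fin n ⊕ Fin n} (h : x.mate v = w) :
    x.edge v = x.edge w := by rw [← h, edge_mate]

/-- Every left-to-left edge of `x` is an edge of `y`, with the same label. -/
def LeftExtends (x y : GBrauerDiagram G n) : Prop :=
  ∀ i j, x.mate (Sum.inl i) = Sum.inl j →
    y.mate (Sum.inl i) = Sum.inl j ∧ y.label (Sum.inl i) = x.label (Sum.inl i)

/-- The left-hand nodes on left-to-left edges. -/
noncomputable def leftCups (x : GBrauerDiagram G n) : Finset (Fin n) :=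
  {i | (x.mate (Sum.inl i)).isLeft}

/-- The right-hand nodes on right-to-right edges. -/
noncomputable def rightCups (x : GBrauerDiagram G n) : Finset (Fin n) :=
  {i | (x.mate (Sum.inr i)).isRight}

theorem mem_leftCups {x : GBrauerDiagram G n} {i : Fin n} :
    i ∈ x.leftCups ↔ ∃ j, x.mate (Sum.inl i) = Sum.inl j := by
  simp [leftCups, Sum.isLeft_iff]

theorem mem_rightCups {x : GBrauerDiagram G n} {i : Fin n} :
    i ∈ x.rightCups ↔ ∃ j, x.mate (Sum.inr i) = Sum.inr j := by
  simp [rightCups, Sum.isRight_iff]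

/-- The edges running from left to right match the remaining nodes of the two columns, and both
columns have n nodes. -/
theorem card_leftCups (x : GBrauerDiagram G n) : x.leftCups.card = x.rightCups.card := by
  have hl := Finset.card_filter_add_card_filter_not (s := (Finset.univ : Finset (Fin n)))
    fun i => (x.mate (Sum.inl i)).isLeft
  have hr := Finset.card_filter_add_card_filter_not (s := (Finset.univ : Finset (Fin n)))
    fun i => (x.mate (Sum.inr i)).isRight
  have h : (Finset.univ.filter fun i : Fin n => ¬ (x.mate (Sum.inl i)).isLeft).card =
      (Finset.univ.filter fun i : Fin n => ¬ (x.mate (Sum.inr i)).isRight).card := by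
    refine Finset.card_nbij' (fun i => Sum.elim id id (x.mate (Sum.inl i)))
      (fun i => Sum.elim id id (x.mate (Sum.inr i))) ?_ ?_ ?_ ?_
    all_goals
      intro i hi
      simp only [Finset.coe_filter, Finset.mem_univ, true_and, Set.mem_ofPred_eq,
        Bool.not_eq_true, Sum.isLeft_eq_false, Sum.isRight_eq_false] at hi ⊢
      first
        | obtain ⟨j, hj⟩ := Sum.isRight_iff.1 hi
          simp [hj, x.mate_swap hj]
        | obtain ⟨j, hj⟩ := Sum.isLeft_iff.1 hi
          simp [hj, x.mate_swap hj]
  simp only [leftCups, rightCups]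
  omega

theorem LeftExtends.subset {x y : GBrauerDiagram G n} (h : LeftExtends x y) :
    x.leftCups ⊆ y.leftCups := by
  intro i hi
  obtain ⟨j, hj⟩ := mem_leftCups.1 hi
  exact mem_leftCups.2 ⟨j, (h i j hj).1⟩

/-- The nodes on cups of `x` are among those of `y`; equal cardinality makes the two sets equal,
leaving no room for further cups. -/
theorem LeftExtends.symm_of_card {x y : GBrauerDiagram G n} (h : LeftExtends x y)
    (hc : x.leftCups.card = y.leftCups.card) : LeftExtends y x := by
  intro i j hj
  have hi : i ∈ x.leftCups := by
    rw [Finset.eq_of_subset_of_card_le h.subset hc.ge]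
    exact mem_leftCups.2 ⟨j, hj⟩
  obtain ⟨j', hj'⟩ := mem_leftCups.1 hi
  obtain ⟨h1, h2⟩ := h i j' hj'
  exact ⟨by rw [hj', ← h1, hj], h2.symm⟩

theorem allThrough_iff_card_leftCups {x : GBrauerDiagram G n} :
    x.AllThrough ↔ x.leftCups.card = 0 := by
  rw [Finset.card_eq_zero, Finset.eq_empty_iff_forall_notMem]
  constructor
  · intro h i hi
    obtain ⟨j, hj⟩ := mem_leftCups.1 hi
    have h1 := h.1 i j (hj ▸ x.rel_mate (Sum.inl i))
    rw [h1] at hj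
    exact x.mate_ne _ hj
  · intro h
    refine allThrough_of_left fun i j hij => ?_
    rcases x.rel_iff_mate.1 hij with h' | h'
    · exact (Sum.inl_injective h').symm
    · exact absurd (mem_leftCups.2 ⟨j, h'.symm⟩) (h i)

theorem projMate_inl_eq_inl {x : GBrauerDiagram G n} {i j : Fin n} :
    x.projMate (Sum.inl i) = Sum.inl j ↔ x.mate (Sum.inl i) = Sum.inl j := by
  rcases h : x.mate (Sum.inl i) with k | k
  · rw [projMate_inl_of_inl h]
  · rw [projMate_inl_of_inr h]; simp

theorem leftExtends_refl (x : GBrauerDiagram G n) : LeftExtends x x := fun _ _ h => ⟨h, rfl⟩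

/-! ### Diagrams without left-to-left edges -/

/-- The edges define an injective map from left to right nodes. An inversion of it would be a
crossing, so it is a strictly increasing self-map of a finite chain, hence the identity. -/
theorem IsPlanar.mate_inl_of_allThrough {x : GBrauerDiagram G n} (hx : x.IsPlanar)
    (h : x.AllThrough) (i : Fin n) : x.mate (Sum.inl i) = Sum.inr i := by
  choose f hf using h.exists_right
  have hm : ∀ i, x.mate (Sum.inl i) = Sum.inr (f i) := fun i =>
    (x.eq_mate (by simp) (hf i)).symm
  have hmono : StrictMono f := by
    intro i k hik
    by_contra! hle
    have hne : f i ≠ f k := fun he => hik.ne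
      (Sum.inl_injective (by rw [← x.mate_swap (hm i), ← x.mate_swap (hm k), he]))
    have hlt := lt_of_le_of_ne hle hne.symm
    have p1 := position_inr (f i)
    have p2 := position_inr (f k)
    have hk := k.isLt
    have hfi := (f i).isLt
    refine hx.mate (a := Sum.inl i) (b := Sum.inl k) hik ?_ ?_
    · rw [hm, position_inl]; omega
    · rw [hm, hm]
      have : (f k : ℕ) < f i := hlt
      omega
  have : f = id := (hmono.range_inj strictMono_id).1 (by
    rw [Set.range_id, (Finite.surjective_of_injective hmono.injective).range_eq])
  rw [hm, this]; rfl

/-- The diagram with horizontal edges, with label `g i` on the `i`-th edge. -/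
def diag (g : Fin n → G) : GBrauerDiagram G n :=
  ofMate Sum.swap Sum.swap_swap (by rintro (i | i) <;> simp) (Sum.elim g g)
    (by rintro (i | i) <;> rfl)

theorem mate_diag (g : Fin n → G) (v : Fin n ⊕ Fin n) : (diag g).mate v = v.swap :=
  mate_ofMate ..

theorem isPlanar_diag (g : Fin n → G) : (diag g).IsPlanar := by
  refine isPlanar_of_mate fun a b h1 h2 h3 => ?_
  rw [mate_diag] at h2 h3
  rw [mate_diag] at h3
  rcases a with i | i <;> rcases b with k | k <;>
    simp only [Sum.swap_inl, Sum.swap_inr] at h2 h3 <;>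
    have pi := position_inr i <;> have pk := position_inr k <;>
    simp only [position_inl] at * <;> omega

theorem IsPlanar.eq_diag {x : GBrauerDiagram G n} (hx : x.IsPlanar) (h : x.AllThrough) :
    x = diag fun i => x.label (Sum.inl i) := by
  have hm := hx.mate_inl_of_allThrough h
  refine ext_mate (fun v => ?_) fun v => ?_
  · rw [mate_diag]
    rcases v with i | i
    · exact hm i
    · exact x.mate_swap (hm i)
  · rcases v with i | i
    · rfl
    · exact (congrArg x.label (hm i).symm).trans (x.label_mate _)

theorem allThrough_diag (g : Fin n → G) : (diag g).AllThrough := by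
  rw [allThrough_iff_card_leftCups, Finset.card_eq_zero, Finset.eq_empty_iff_forall_notMem]
  intro i hi
  obtain ⟨j, hj⟩ := mem_leftCups.1 hi
  rw [mate_diag] at hj
  cases hj

/-! ### Composition and left-to-left edges -/

variable [CommMonoid G]

theorem mate_mul {x y : GBrauerDiagram G n} {v w : Fin n ⊕ Fin n} (hne : w ≠ v)
    (h : outer x y v = outer x y w) : (x * y).mate v = w :=
  ((x * y).eq_mate hne h).symm

/-- A left cup of `x` does not touch the middle column, so it is a whole strand of the concatenation
and keeps its label. -/
theorem leftExtends_mul (x y : GBrauerDiagram G n) : LeftExtends x (x * y) := by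
  intro i j hj
  constructor
  · refine mate_mul (fun h => x.mate_ne (Sum.inl i) (hj.trans h)) ?_
    exact congrArg (fun e => Glue.mk _ _ (Sum.inl e)) (edge_eq_of_mate hj)
  · exact fibreProd_single (Glue.mk _ _) (Sum.elim x.edgeLabel y.edgeLabel)
      (Sum.inl (x.edge (Sum.inl i)))
      fun a ha => Glue.eq_inl_of_mk_eq (edge_inr_ne_of_mate hj) ha

theorem rightCups_subset_mul (x y : GBrauerDiagram G n) : y.rightCups ⊆ (x * y).rightCups := by
  intro i hi
  obtain ⟨j, hj⟩ := mem_rightCups.1 hi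
  refine mem_rightCups.2 ⟨j, mate_mul (fun h => y.mate_ne (Sum.inr i) (hj.trans h)) ?_⟩
  exact congrArg (fun e => Glue.mk _ _ (Sum.inr e)) (edge_eq_of_mate hj)

theorem leftExtends_proj_left {x y : GBrauerDiagram G n} :
    LeftExtends x.proj y ↔ LeftExtends x y := by
  unfold LeftExtends
  simp only [mate_proj, projMate_inl_eq_inl, label_proj]
  refine forall₂_congr fun i j => imp_congr_right fun h => ?_
  rw [projLabel_inl_of_inl h]

theorem leftExtends_proj_right {x y : GBrauerDiagram G n} (h : LeftExtends x y) :
    LeftExtends x y.proj := by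
  intro i j hj
  obtain ⟨h1, h2⟩ := h i j hj
  rw [mate_proj, label_proj, projLabel_inl_of_inl h1, projMate_inl_eq_inl]
  exact ⟨h1, h2⟩

/-- The construction `proj` uses only the labelled left cups, and the two hypotheses say that these
coincide. -/
theorem proj_eq_proj {x y : GBrauerDiagram G n} (h : LeftExtends x y) (h' : LeftExtends y x) :
    x.proj = y.proj := by
  have right : ∀ i j, x.mate (Sum.inl i) = Sum.inr j → ∃ j', y.mate (Sum.inl i) = Sum.inr j' := by
    intro i j hj
    rcases hk : y.mate (Sum.inl i) with k | k
    · rw [(h' i k hk).1] at hj; cases hj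
    · exact ⟨k, rfl⟩
  refine ext_mate (fun v => ?_) fun v => ?_
  · rw [mate_proj, mate_proj]
    rcases v with i | i <;> rcases hj : x.mate (Sum.inl i) with j | j
    · rw [projMate_inl_of_inl hj, projMate_inl_of_inl (h i j hj).1]
    · obtain ⟨j', hj'⟩ := right i j hj
      rw [projMate_inl_of_inr hj, projMate_inl_of_inr hj']
    · rw [projMate_inr_of_inl hj, projMate_inr_of_inl (h i j hj).1]
    · obtain ⟨j', hj'⟩ := right i j hj
      rw [projMate_inr_of_inr hj, projMate_inr_of_inr hj']
  · rw [label_proj, label_proj]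
    rcases v with i | i
    · rcases hj : x.mate (Sum.inl i) with j | j
      · rw [projLabel_inl_of_inl hj, projLabel_inl_of_inl (h i j hj).1, (h i j hj).2]
      · obtain ⟨j', hj'⟩ := right i j hj
        rw [projLabel_inl_of_inr hj, projLabel_inl_of_inr hj']
    · rfl

theorem proj_proj (x : GBrauerDiagram G n) : x.proj.proj = x.proj :=
  proj_eq_proj (leftExtends_proj_left.2 (leftExtends_refl x))
    (leftExtends_proj_right (leftExtends_refl x))

theorem leftCups_proj (x : GBrauerDiagram G n) : x.proj.leftCups = x.leftCups := by
  ext i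
  simp only [mem_leftCups, mate_proj, projMate_inl_eq_inl]

theorem LeftExtends.of_proj_mul_eq {x y : GBrauerDiagram G n} (h : x.proj * y = y) :
    LeftExtends x y := by
  rw [← leftExtends_proj_left]
  have := leftExtends_mul x.proj y
  rwa [h] at this

/-- The edge of `y` to which an edge of `x.proj` leads, when `y` extends the left-to-left edges
of `x`. -/
noncomputable def LeftExtends.strandEdge {x y : GBrauerDiagram G n} (h : LeftExtends x y) :
    Strand x.proj y → Option y.Edge :=
  let f : Fin n ⊕ Fin n → Option y.Edge :=
    Sum.elim
      (fun i => Sum.elim (fun _ => none) (fun _ => some (y.edge (Sum.inl i))) (x.mate (Sum.inl i)))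
      (fun i => some (y.edge (Sum.inl i)))
  -- The case of a right cup of `x.proj` is where `h` enters: its two ends meet the ends of the same
  -- cup of `y`, hence a single edge of `y`. Left cups of `x.proj` meet no edge of `y` and get
  -- `none`.
  have hf : ∀ v, f v = f (x.projMate v) := by
    rintro (i | i) <;> rcases hj : x.mate (Sum.inl i) with j | j
    · rw [projMate_inl_of_inl hj]
      simp [f, hj, x.mate_swap hj]
    · rw [projMate_inl_of_inr hj]
      simp [f, hj]
    · rw [projMate_inr_of_inl hj]
      simp only [f, Sum.elim_inr]
      rw [edge_eq_of_mate (h i j hj).1]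
    · rw [projMate_inr_of_inr hj]
      simp [f, hj]
  Glue.lift (Quotient.lift f (by
    intro v w hvw
    rcases x.proj.rel_iff_mate.1 hvw with rfl | rfl
    · rfl
    · rw [mate_proj]; exact hf v)) some fun _ => rfl

/-- The right cups of `x.proj` close up with the matching cups of `y` to loops, which are deleted.
The left cups of `x.proj` put these cups back with their labels, and the horizontal edges, labelled
1, prolong the other edges of `y` without change. -/
theorem LeftExtends.proj_mul {x y : GBrauerDiagram G n} (h : LeftExtends x y) :
    x.proj * y = y := by
  have cup : ∀ i j, x.mate (Sum.inl i) = Sum.inl j →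
      (x.proj * y).mate (Sum.inl i) = y.mate (Sum.inl i) ∧
      (x.proj * y).label (Sum.inl i) = y.label (Sum.inl i) := by
    intro i j hj
    obtain ⟨h1, h2⟩ := leftExtends_proj_left.1 (leftExtends_mul x.proj y) i j hj
    obtain ⟨h3, h4⟩ := h i j hj
    exact ⟨h1.trans h3.symm, h2.trans h4.symm⟩
  -- The free nodes are those not on left cups of `x`; their strands are the ones that pass through
  -- edges of `y`.
  let Free : Fin n ⊕ Fin n → Prop := fun v => ∀ i j, v = Sum.inl i → x.mate v ≠ Sum.inl j
  have outer_eq : ∀ v, Free v →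
      outer x.proj y v = Glue.mk _ _ (Sum.inr (y.edge v)) := by
    rintro (i | i) hv
    · rcases hj : x.mate (Sum.inl i) with j | j
      · exact (hv i j rfl hj).elim
      · have he : x.proj.edge (Sum.inl i) = x.proj.edge (Sum.inr i) :=
          edge_eq_of_mate (by rw [mate_proj, projMate_inl_of_inr hj])
        refine (congrArg (fun e => Glue.mk _ _ (Sum.inl e)) he).trans ?_
        exact Glue.sound (fun m : Fin n => x.proj.edge (Sum.inr m)) (fun m => y.edge (Sum.inl m)) i
    · rfl
  have cases_node : ∀ v, Free v ∨ ∃ i j, v = Sum.inl i ∧ x.mate (Sum.inl i) = Sum.inl j := by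
    intro v
    by_contra! hc
    exact hc.1 fun i j hi hj => hc.2 i j hi (hi ▸ hj)
  refine ext_mate (fun v => ?_) fun v => ?_
  · rcases cases_node v with hv | ⟨i, j, rfl, hj⟩
    · refine mate_mul (y.mate_ne v) ?_
      have hw : Free (y.mate v) := by
        intro i j hi hj
        rw [hi] at hj
        have h1 := (h i j hj).1
        rw [← hi, mate_mate] at h1
        rw [h1] at hv
        exact hv j i rfl (x.mate_swap hj)
      rw [outer_eq v hv, outer_eq _ hw, edge_mate]
    · exact (cup i j hj).1
  · rcases cases_node v with hv | ⟨i, j, rfl, hj⟩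
    · rw [mul_label, outer_eq v hv, strandLabel, Glue.label_eq_mul]
      -- Only left cups of `x.proj` can have a label other than 1, and `strandEdge` separates them
      -- from every strand containing an edge of `y`.
      have h1 : fibreProd (fun b => Glue.mk (fun m : Fin n => x.proj.edge (Sum.inr m))
          (fun m => y.edge (Sum.inl m)) (Sum.inl b)) x.proj.edgeLabel
          (Glue.mk _ _ (Sum.inr (y.edge v))) = 1 := by
        refine Finset.prod_eq_one fun b hb => ?_
        simp only [Finset.mem_filter, Finset.mem_univ, true_and] at hb
        obtain ⟨t, rfl⟩ := x.proj.edge_surjective b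
        rw [edgeLabel_edge, label_proj]
        rcases t with i | i
        · rcases hj : x.mate (Sum.inl i) with j | j
          · have := congrArg h.strandEdge hb
            have h2 : h.strandEdge (Glue.mk _ _ (Sum.inl (x.proj.edge (Sum.inl i)))) = none := by
              show Sum.elim _ _ (x.mate (Sum.inl i)) = _
              rw [hj]; rfl
            rw [h2] at this
            cases this
          · exact projLabel_inl_of_inr hj
        · rfl
      rw [h1, one_mul]
      -- `strandEdge` recovers the edge of `y` from its strand, so the strand contains just one edge
      -- of `y`.
      exact fibreProd_single (fun e => Glue.mk (fun m : Fin n => x.proj.edge (Sum.inr m))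
        (fun m => y.edge (Sum.inl m)) (Sum.inr e)) y.edgeLabel (y.edge v)
        fun e he => Option.some_injective _ (congrArg h.strandEdge he)
    · exact (cup i j hj).2

theorem diag_one : diag (1 : Fin n → G) = 1 :=
  (isPlanar_one.eq_diag allThrough_one).symm

/-- All edges are horizontal, so the height `F` of a strand is well defined and shows that the
strand at `i` consists of exactly one edge of each diagram. -/
theorem label_mul_of_allThrough {x y : GBrauerDiagram G n} (hx : x.IsPlanar) (hx' : x.AllThrough)
    (hy : y.IsPlanar) (hy' : y.AllThrough) (i : Fin n) :
    (x * y).label (Sum.inl i) = x.label (Sum.inl i) * y.label (Sum.inl i) := by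
  have key : ∀ {z : GBrauerDiagram G n}, z.IsPlanar → z.AllThrough → ∀ v w, z.rel v w →
      (Sum.elim id id v : Fin n) = Sum.elim id id w := by
    intro z hz hz' v w hvw
    have hm := hz.mate_inl_of_allThrough hz'
    rcases z.rel_iff_mate.1 hvw with rfl | rfl
    · rfl
    · rcases v with i | i
      · rw [hm]; rfl
      · rw [z.mate_swap (hm i)]; rfl
  have edge_eq : ∀ {z : GBrauerDiagram G n}, z.IsPlanar → z.AllThrough → ∀ v,
      z.edge v = z.edge (Sum.inl (Sum.elim id id v)) := by
    rintro z hz hz' (i | i)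
    · rfl
    · exact (edge_eq_of_mate (hz.mate_inl_of_allThrough hz' i)).symm
  let F : Strand x y → Fin n := Glue.lift (Quotient.lift _ (key hx hx'))
    (Quotient.lift _ (key hy hy')) fun _ => rfl
  have hs : Glue.mk (fun m : Fin n => x.edge (Sum.inr m)) (fun m => y.edge (Sum.inl m))
      (Sum.inl (x.edge (Sum.inl i))) = Glue.mk _ _ (Sum.inr (y.edge (Sum.inl i))) := by
    rw [show x.edge (Sum.inl i) = x.edge (Sum.inr i) from (edge_eq hx hx' (Sum.inr i)).symm]
    exact Glue.sound (fun m : Fin n => x.edge (Sum.inr m)) (fun m => y.edge (Sum.inl m)) i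
  refine (Glue.label_eq_mul (fun m : Fin n => x.edge (Sum.inr m)) (fun m => y.edge (Sum.inl m))
    x.edgeLabel y.edgeLabel (Glue.mk _ _ (Sum.inl (x.edge (Sum.inl i))))).trans ?_
  congr 1
  · refine fibreProd_single (fun e => Glue.mk (fun m : Fin n => x.edge (Sum.inr m))
      (fun m => y.edge (Sum.inl m)) (Sum.inl e)) x.edgeLabel (x.edge (Sum.inl i)) fun e he => ?_
    obtain ⟨v, rfl⟩ := x.edge_surjective e
    have : Sum.elim id id v = i := congrArg F he
    rw [edge_eq hx hx' v, this]
  · rw [hs]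
    refine fibreProd_single (fun e => Glue.mk (fun m : Fin n => x.edge (Sum.inr m))
      (fun m => y.edge (Sum.inl m)) (Sum.inr e)) y.edgeLabel (y.edge (Sum.inl i)) fun e he => ?_
    obtain ⟨v, rfl⟩ := y.edge_surjective e
    have : Sum.elim id id v = i := congrArg F he
    rw [edge_eq hy hy' v, this]

/-- The product is again planar without cups, hence of the form `diag`, and only the labels have to
be compared. -/
theorem diag_mul (g h : Fin n → G) : diag g * diag h = diag (g * h) := by
  rw [((isPlanar_diag g).mul (isPlanar_diag h)).eq_diag
    ((allThrough_diag g).mul (allThrough_diag h))]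
  refine congrArg diag (funext fun i => ?_)
  exact label_mul_of_allThrough (isPlanar_diag g) (allThrough_diag g) (isPlanar_diag h)
    (allThrough_diag h) i

/-- G acts by ring homomorphisms, so every g δ is a unit. This is where invertibility of δ enters.
-/
theorem loopFactor_isUnit {k G : Type*} [CommRing k] [CommGroup G] [MulSemiringAction G k] {δ : k}
    (hδ : IsUnit δ) (x y : GBrauerDiagram G n) : IsUnit (loopFactor δ x y) :=
  Finset.prod_induction _ IsUnit (fun _ _ => IsUnit.mul) isUnit_one fun s _ =>
    hδ.map (MulSemiringAction.toRingHom G k (strandLabel x y s))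

end GBrauerDiagram

/-! ### The monoid of planar diagrams, its height function and its submonoid G^n -/

namespace GTLDiagram

/-- The idempotents of the monoid of planar diagrams, graded by the number of left-hand nodes on
left-to-left edges. -/
noncomputable def leftProjections (G : Type u) [CommMonoid G] (n : ℕ) :
    LeftProjections (GTLDiagram G n) where
  height x := x.1.leftCups.card
  bound := n
  height_le x := (Finset.card_le_univ _).trans_eq (Fintype.card_fin n)
  le_height_mul_left x y := Finset.card_le_card (GBrauerDiagram.leftExtends_mul x.1 y.1).subset
  le_height_mul_right x y := by
    -- The right factor controls only the right cups of the product, so the count is moved to the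
    -- right column.
    rw [GBrauerDiagram.card_leftCups, GBrauerDiagram.card_leftCups]
    exact Finset.card_le_card (GBrauerDiagram.rightCups_subset_mul x.1 y.1)
  proj x := ⟨x.1.proj, GBrauerDiagram.IsPlanar.proj x.2⟩
  proj_mul_self x := Subtype.ext (GBrauerDiagram.leftExtends_refl x.1).proj_mul
  proj_proj x := Subtype.ext x.1.proj_proj
  height_proj x := congrArg Finset.card x.1.leftCups_proj
  proj_eq x y h hc := by
    have h' : GBrauerDiagram.LeftExtends x.1 y.1 := .of_proj_mul_eq (congrArg Subtype.val h)
    exact Subtype.ext (GBrauerDiagram.proj_eq_proj h' (h'.symm_of_card hc))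

theorem one_le_height_iff {G : Type u} [CommMonoid G] {n : ℕ} (x : GTLDiagram G n) :
    1 ≤ (leftProjections G n).height x ↔ ¬ x.1.AllThrough := by
  rw [GBrauerDiagram.allThrough_iff_card_leftCups, Nat.one_le_iff_ne_zero]
  rfl

/-- The diagrams with horizontal edges, as a submonoid isomorphic to `G ^ n`. -/
def diagHom (G : Type u) [CommMonoid G] (n : ℕ) : (Fin n → G) →* GTLDiagram G n where
  toFun g := ⟨GBrauerDiagram.diag g, GBrauerDiagram.isPlanar_diag g⟩
  map_one' := Subtype.ext GBrauerDiagram.diag_one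
  map_mul' g h := Subtype.ext (GBrauerDiagram.diag_mul g h).symm

end GTLDiagram

/-! ### The split surjection onto the group algebra of G^n and its kernel -/

open Classical in
/-- The element of the group algebra given by the left-hand labels of a diagram without
left-to-left edges; other diagrams are sent to zero. -/
noncomputable def throughValue (k : Type u) [CommRing k] {G : Type u} [CommGroup G] {n : ℕ}
    (x : GTLDiagram G n) : MonoidAlgebra k (Fin n → G) :=
  if x.1.AllThrough then MonoidAlgebra.of k _ (fun i => x.1.label (Sum.inl i)) else 0

theorem throughValue_diagHom (k : Type u) [CommRing k] {G : Type u} [CommGroup G] {n : ℕ}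
    (g : Fin n → G) :
    throughValue k (GTLDiagram.diagHom G n g) = MonoidAlgebra.of k _ g :=
  if_pos (GBrauerDiagram.allThrough_diag g)

section

variable {k G : Type u} [CommRing k] [CommGroup G] [MulSemiringAction G k] (n : ℕ) (δ : k)

theorem loopCocycle_of_allThrough {x y : GTLDiagram G n} (hx : x.1.AllThrough)
    (hy : y.1.AllThrough) : (loopCocycle n δ).toFun x y = 1 :=
  GBrauerDiagram.loopFactor_eq_one _ _ _ (hx.surjective_outer hy)

/-- A product has no cups exactly when both factors have none. In that case no loops arise and the
labels multiply; otherwise both sides vanish. -/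
theorem throughValue_mul (x y : GTLDiagram G n) :
    (loopCocycle n δ).toFun x y • throughValue k (x * y) = throughValue k x * throughValue k y := by
  by_cases hx : x.1.AllThrough
  · by_cases hy : y.1.AllThrough
    · have h : (x * y).1.AllThrough := hx.mul hy
      rw [loopCocycle_of_allThrough n δ hx hy, one_smul, throughValue, throughValue, throughValue,
        if_pos hx, if_pos hy, if_pos h, ← map_mul]
      refine congrArg _ (funext fun i => ?_)
      exact GBrauerDiagram.label_mul_of_allThrough x.2 hx y.2 hy i
    · have h : ¬ (x * y).1.AllThrough := fun h => hy (GBrauerDiagram.AllThrough.of_mul h).2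
      rw [throughValue, if_neg h, smul_zero, throughValue, throughValue, if_neg hy, mul_zero]
  · have h : ¬ (x * y).1.AllThrough := fun h => hx (GBrauerDiagram.AllThrough.of_mul h).1
    rw [throughValue, if_neg h, smul_zero, throughValue, if_neg hx, zero_mul]

/-- The homomorphism from the `G`-Temperley-Lieb algebra onto the group algebra of `G ^ n` that
annihilates the diagrams with a left-to-left edge. -/
noncomputable def gtlToGroupAlgebra : GTLAlgebra k G n δ →ₐ[k] MonoidAlgebra k (Fin n → G) :=
  AlgHom.ofLinearMap (TwistedMonoidAlgebra.linearLift _ (throughValue k))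
    (by
      rw [TwistedMonoidAlgebra.one_def, TwistedMonoidAlgebra.linearLift_of,
        ← map_one (GTLDiagram.diagHom G n), throughValue_diagHom, map_one])
    (fun a b => by
      induction a using TwistedMonoidAlgebra.induction with
      | h0 => rw [zero_mul, map_zero, zero_mul]
      | hadd a a' ha ha' => rw [add_mul, map_add, map_add, ha, ha', add_mul]
      | hof r x =>
        induction b using TwistedMonoidAlgebra.induction with
        | h0 => rw [mul_zero, map_zero, mul_zero]
        | hadd b b' hb hb' => rw [mul_add, map_add, map_add, hb, hb', mul_add]
        | hof s y =>
          rw [smul_mul_smul_comm, TwistedMonoidAlgebra.of_mul_of, map_smul, map_smul, map_smul,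
            map_smul, TwistedMonoidAlgebra.linearLift_of, TwistedMonoidAlgebra.linearLift_of,
            TwistedMonoidAlgebra.linearLift_of, throughValue_mul, smul_mul_smul_comm])

theorem gtlToGroupAlgebra_of (x : GTLDiagram G n) :
    gtlToGroupAlgebra n δ (TwistedMonoidAlgebra.of (loopCocycle n δ) x) = throughValue k x :=
  TwistedMonoidAlgebra.linearLift_of _ _ x

/-- The embedding of the group algebra of `G ^ n` as the span of the diagrams with horizontal
edges. -/
noncomputable def groupAlgebraToGTL : MonoidAlgebra k (Fin n → G) →ₐ[k] GTLAlgebra k G n δ :=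
  MonoidAlgebra.lift k _ (Fin n → G)
    { toFun := fun g => TwistedMonoidAlgebra.of _ (GTLDiagram.diagHom G n g)
      map_one' := by rw [map_one]; rfl
      map_mul' := fun g h => by
        rw [TwistedMonoidAlgebra.of_mul_of, ← map_mul, loopCocycle_of_allThrough n δ
          (GBrauerDiagram.allThrough_diag g) (GBrauerDiagram.allThrough_diag h), one_smul] }

theorem groupAlgebraToGTL_of (g : Fin n → G) : groupAlgebraToGTL n δ (MonoidAlgebra.of k _ g) =
    TwistedMonoidAlgebra.of _ (GTLDiagram.diagHom G n g) :=
  MonoidAlgebra.lift_of ..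

/-- The `G`-Temperley-Lieb algebra splits onto the group algebra of `G ^ n`. -/
noncomputable def gtlSplitSurjection :
    SplitSurjection k (GTLAlgebra k G n δ) (MonoidAlgebra k (Fin n → G)) where
  hom := gtlToGroupAlgebra n δ
  sec := groupAlgebraToGTL n δ
  hom_sec b := by
    induction b using MonoidAlgebra.induction_on with
    | of g => rw [groupAlgebraToGTL_of, gtlToGroupAlgebra_of, throughValue_diagHom]
    | add a b ha hb => rw [map_add, map_add, ha, hb]
    | smul r a ha => rw [map_smul, map_smul, ha]

theorem groupAugmentation_gtlToGroupAlgebra (a : GTLAlgebra k G n δ) :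
    groupAugmentation k (Fin n → G) (gtlToGroupAlgebra n δ a) = gtlAugmentation k G n δ a := by
  induction a using TwistedMonoidAlgebra.induction with
  | h0 => simp only [map_zero]
  | hadd a b ha hb => rw [map_add, map_add, map_add, ha, hb]
  | hof r x =>
    rw [map_smul, map_smul, map_smul, gtlToGroupAlgebra_of, gtlAugmentation,
      TwistedMonoidAlgebra.liftToBase_of, throughValue]
    split_ifs
    · rw [groupAugmentation, MonoidAlgebra.lift_of, MonoidHom.one_apply]
    · rw [map_zero]

theorem heightIdeal_le_ker :
    (GTLDiagram.leftProjections G n).heightIdeal (loopCocycle n δ) 1 ≤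
      (gtlSplitSurjection n δ).ker := by
  have h : (GTLDiagram.leftProjections G n).heightSubmodule (loopCocycle n δ) 1 ≤
      LinearMap.ker (gtlToGroupAlgebra n δ).toLinearMap := by
    refine Submodule.span_le.2 ?_
    rintro _ ⟨x, hx, rfl⟩
    exact (gtlToGroupAlgebra_of n δ x).trans (if_neg ((GTLDiagram.one_le_height_iff x).1 hx))
  exact fun a ha => h ha

/-- A diagram without cups equals the horizontal diagram with its labels and contributes zero; a
diagram with cups is sent to zero and already lies in the ideal. With `heightIdeal_le_ker` this
identifies the kernel. -/
theorem sub_mem_heightIdeal (a : GTLAlgebra k G n δ) :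
    a - groupAlgebraToGTL n δ (gtlToGroupAlgebra n δ a) ∈
      (GTLDiagram.leftProjections G n).heightIdeal (loopCocycle n δ) 1 := by
  induction a using TwistedMonoidAlgebra.induction with
  | h0 => simp only [map_zero, sub_zero, zero_mem]
  | hadd a b ha hb =>
    rw [map_add, map_add, add_sub_add_comm]
    exact add_mem ha hb
  | hof r x =>
    rw [map_smul, map_smul, ← smul_sub, gtlToGroupAlgebra_of]
    refine Submodule.smul_of_tower_mem _ r ?_
    by_cases hx : x.1.AllThrough
    · have : GTLDiagram.diagHom G n (fun i => x.1.label (Sum.inl i)) = x :=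
        Subtype.ext (GBrauerDiagram.IsPlanar.eq_diag x.2 hx).symm
      rw [throughValue, if_pos hx, groupAlgebraToGTL_of, this, sub_self]
      exact zero_mem _
    · rw [throughValue, if_neg hx, map_zero, sub_zero]
      exact LeftProjections.of_mem _ _ ((GTLDiagram.one_le_height_iff x).2 hx)

theorem ker_gtlSplitSurjection :
    (gtlSplitSurjection n δ).ker =
      (GTLDiagram.leftProjections G n).heightIdeal (loopCocycle n δ) 1 := by
  refine le_antisymm (fun a ha => ?_) (heightIdeal_le_ker n δ)
  have ha' : gtlToGroupAlgebra n δ a = 0 := ha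
  have := sub_mem_heightIdeal n δ a
  rwa [ha', map_zero, sub_zero] at this

/-- The kernel is the ideal of height at least 1. It annihilates the trivial module because the
augmentation factors through k[G^n], so the induction over layers applies with m = 1. -/
theorem isSMulAcyclic_gtl (hδ : IsUnit δ)
    (P : ProjectiveResolution (ModuleCat.of (GTLAlgebra k G n δ)
      (TrivialModule (gtlAugmentation k G n δ)))) :
    IsSMulAcyclic (gtlSplitSurjection n δ).ker (fun i => P.complex.X i)
      fun i => (P.complex.d (i + 1) i).hom := by
  have : ∀ i, Module.Projective (GTLAlgebra k G n δ) (P.complex.X i) := fun i =>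
    (IsProjective.iff_projective _).2 (P.projective i)
  rw [ker_gtlSplitSurjection]
  refine LeftProjections.isSMulAcyclic _ _ (fun x y => GBrauerDiagram.loopFactor_isUnit hδ x.1 y.1)
    P.isAugmentedExact 1 fun f hf (y : k) => ?_
  rw [← ker_gtlSplitSurjection] at hf
  have hf' : gtlToGroupAlgebra n δ f = 0 := hf
  have h0 : gtlAugmentation k G n δ f = 0 := by
    rw [← groupAugmentation_gtlToGroupAlgebra, hf', map_zero]
  show (gtlAugmentation k G n δ f : k) * y = 0
  rw [h0, zero_mul]

/-- The homology of the `G`-Temperley-Lieb algebra with invertible parameter is that of the group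
algebra of `G ^ n`. -/
noncomputable def trivialTorGTLIso (hδ : IsUnit δ) (i : ℕ) :
    trivialTor (gtlAugmentation k G n δ) i ≅ trivialTor (groupAugmentation k (Fin n → G)) i :=
  let P := ProjectiveResolution.of (ModuleCat.of (GTLAlgebra k G n δ)
    (TrivialModule (gtlAugmentation k G n δ)))
  (gtlSplitSurjection n δ).trivialTorIso (groupAugmentation_gtlToGroupAlgebra n δ) P
    (isSMulAcyclic_gtl n δ hδ P) i

end

/-- The comparison with group homology is composed from the change of algebra and the identification
of `Tor` over k[H] with group homology, valid for every group H. -/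
theorem mainTheorem7 {k G : Type u} [CommRing k] [CommGroup G] [MulSemiringAction G k]
    (n : ℕ) (δ : k) (hδ : IsUnit δ) :
    Nonempty (∀ i : ℕ, trivialTor (gtlAugmentation k G n δ) i ≅
      trivialTor (groupAugmentation k (Fin n → G)) i) ∧
    Nonempty (∀ i : ℕ, trivialTor (gtlAugmentation k G n δ) i ≅
      groupHomology (Rep.trivial k (Fin n → G) k) i) :=
  ⟨⟨trivialTorGTLIso n δ hδ⟩,
    ⟨fun i => trivialTorGTLIso n δ hδ i ≪≫ trivialTorIsoGroupHomology i⟩⟩
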